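/- **Setting.** Let $M$ be a smooth ($C^\infty$, Hausdorff, finite-dimensional) manifold and $V\to M$ a smooth vector bundle. *Gauge algebroid.* $\mathfrak D V$ is the vector bundle whose fibre at $m$ consists of the pairs of an $\mathbb R$-linear map $\mathfrak d:\Gamma(V)\to V_m$ and a vector $x=\alpha(\mathfrak d)\in T_mM$ with $\mathfrak d(fu)=f(m)\,\mathfrak d(u)+x(f)\,u(m)$. Its smooth sections act as derivations of $\Gamma(V)$; its bracket is the commutator, and its anchor is $\alpha$. There is an inclusion $\mathbb i:\mathfrak{gl}(V)\hookrightarrow\mathfrak D V$, $\Phi\mapsto (u\mapsto\Phi(u(m)))$. *Jet bundle.* $\mathfrak J V\subset \mathrm{Hom}(\mathfrak D V,V)$ is the bundle of $\nu$ with $\nu(\Phi)=\Phi(\nu(\mathbf 1_V))$ for all $\Phi\in\mathfrak{gl}(V)$; the 1-jet $[u]_m$ of a section $u$ is the element $\mathfrak d\mapsto \mathfrak d u$. Put $\mathbb p:\mathfrak J V\to V$, $\mathbb p(\nu)=\nu(\mathbf 1_V)$, and $\mathbb e:\mathrm{Hom}(TM,V)\to\mathfrak J V$, $\mathbb e(y)(\mathfrak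 d)=y(\alpha(\mathfrak d))$. Write $\mathbb d u\in\Gamma(\mathfrak J V)$ for the section $m\mapsto[u]_m$. *Jet Lie algebroid.* If $V$ is a Lie algebroid with anchor $\rho$, let $\pi:\mathfrak J V\to\mathfrak D V$ be the bundle map with $\pi([u]_m)=[u,\cdot\,](m)$. Then $\mathfrak J V$ carries the anchor $\alpha\circ\pi=\rho\circ\mathbb p$ and the bracket $$[\mu,\nu]_\pi=L_{\pi\mu}\nu-L_{\pi\nu}\mu-\mathbb d\langle\nu,\pi\mu\rangle,\qquad \langle L_{\mathfrak d}\nu,\mathfrak d'\rangle=\mathfrak d\langle\nu,\mathfrak d'\rangle-\langle\nu,[\mathfrak d,\mathfrak d']\rangle .$$ *Poisson structure.* Let $\Pi:T^*M\to TM$ be a Poisson structure, that is, a smooth skew-symmetric bundle map such that $\{f,g\}=dg(\Pi\,df)$ satisfies the Jacobi identity. $T^*M$ is regarded as a Lie algebroid with anchor $\Pi$ and bracket $[\alpha,\beta]=L_{\Pi\alpha}\beta-L_{\Pi\beta}\alpha-d(\beta(\Pi\alpha))$; $TM$ has its usual Lie algebroid structure. **Theorem.** Let $(M,\Pi)$ be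 a Poisson manifold. Then $\mathfrak J(T^*M)$ and $\mathfrak D(TM)$, with the structures above, are Lie algebroids over $M$, and there is a morphism of Lie algebroids over the identity of $M$ $$\hat\Pi:\mathfrak J(T^*M)\to\mathfrak D(TM),\qquad \hat\Pi([\alpha]_m)(X)=[\Pi\alpha,X](m)\quad(\alpha\in\Omega^1(M),\ X\in\mathfrak X(M)),$$ for which the following diagram with exact rows commutes: $$\begin{array}{ccccccccc} 0&\to&\mathrm{Hom}(TM,T^*M)&\xrightarrow{\ \mathbb e\ }&\mathfrak J(T^*M)&\xrightarrow{\ \mathbb p\ }&T^*M&\to&0\\ &&\downarrow{\scriptstyle -\mathbf 1\otimes\Pi}&&\downarrow{\scriptstyle\hat\Pi}&&\downarrow{\scriptstyle\Pi}&&\\ 0&\to&\mathfrak{gl}(TM)&\xrightarrow{\ \mathbb i\ }&\mathfrak D(TM)&\xrightarrow{\ \alpha\ }&TM&\to&0 \end{array}$$ that is, $\hat\Pi(\mathbb e(y))=\mathbb i(-\Pi\circ y)$ for $y\in\mathrm{Hom}(T_mM,T^*_mM)$, and $\alpha\circ\hat\Pi=\Pi\circ\mathbb p$. If every $\Pi_m$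 is bijective, then $\hat\Pi$ is an isomorphism of Lie algebroids. In particular, let $(M,\omega)$ be a symplectic manifold. Then there is a Poisson structure $\Pi$ with $\Pi(\omega(x,\cdot))=x$ for all $x\in TM$, and for this $\Pi$ a map $\hat\Pi$ as above that is an isomorphism of Lie algebroids $\mathfrak J(T^*M)\cong\mathfrak D(TM)$. -/

import Mathlib

open Bundle VectorField Filter
open scoped Manifold ContDiff Topology

set_option linter.unusedSectionVars false

noncomputable section

section Sections

variable {E : Type*} [NormedAddCommGroup E] [NormedSpace ℝ E] [FiniteDimensional ℝ E]
  {M : Type*} [TopologicalSpace M] [ChartedSpace E M]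

/-- The algebra of smooth functions on `M`. -/
abbrev SmoothFun (E M : Type*) [NormedAddCommGroup E] [NormedSpace ℝ E]
    [TopologicalSpace M] [ChartedSpace E M] : Type _ :=
  C^∞⟮𝓘(ℝ, E), M; 𝓘(ℝ, ℝ), ℝ⟯

/-- The smooth sections of a vector bundle `V` with model fibre `F`. -/
abbrev Sec (E F : Type*) {M : Type*} [NormedAddCommGroup E] [NormedSpace ℝ E]
    [NormedAddCommGroup F] [NormedSpace ℝ F] [TopologicalSpace M] [ChartedSpace E M]
    (V : M → Type*) [TopologicalSpace (TotalSpace F V)] [∀ m, TopologicalSpace (V m)]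
    [FiberBundle F V] : Type _ :=
  Cₛ^∞⟮𝓘(ℝ, E); F, V⟯

/-- Smooth vector fields. -/
abbrev VF (E M : Type*) [NormedAddCommGroup E] [NormedSpace ℝ E]
    [TopologicalSpace M] [ChartedSpace E M] [IsManifold 𝓘(ℝ, E) ∞ M] : Type _ :=
  Sec E E (TangentSpace 𝓘(ℝ, E) : M → Type _)

variable [IsManifold 𝓘(ℝ, E) ∞ M]

/-- The derivative `X f` of a smooth function along a vector field. -/
def VF.deriv (X : VF E M) (f : SmoothFun E M) : SmoothFun E M where
  val m := mvfderiv 𝓘(ℝ, E) f m (X m)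
  property := by
    have h := (f.contMDiff.contMDiff_tangentMap (m := ∞) (by simp)).comp X.contMDiff
    have h2 := (contMDiff_snd_tangentBundle_modelSpace ℝ 𝓘(ℝ, ℝ) (n := ∞)).comp h
    exact h2

theorem isManifold_two : IsManifold 𝓘(ℝ, E) (minSmoothness ℝ 2) M := by
  simp only [minSmoothness_of_isRCLikeNormedField]
  exact IsManifold.of_le (n := ∞) (WithTop.coe_le_coe.2 le_top)

/-- The Lie bracket of two smooth vector fields. -/
def VF.bracket (X Y : VF E M) : VF E M where
  toFun := mlieBracket 𝓘(ℝ, E) X Y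
  contMDiff_toFun := by
    have : IsManifold 𝓘(ℝ, E) (((⊤ : ℕ∞) : ℕ∞ω) + 1) M := by
      simpa using ‹IsManifold 𝓘(ℝ, E) ∞ M›
    have := isManifold_two (E := E) (M := M)
    intro x
    exact ContMDiffAt.mlieBracket_vectorField (n := ⊤) (m := ⊤)
      (X.contMDiff x) (Y.contMDiff x) (by simp)

theorem VF.bracket_deriv (X Y : VF E M) (f : SmoothFun E M) (m : M) :
    mvfderiv 𝓘(ℝ, E) f m (mlieBracket 𝓘(ℝ, E) X Y m) =
      X.deriv (Y.deriv f) m - Y.deriv (X.deriv f) m := by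
  set φ := extChartAt 𝓘(ℝ, E) m with hφ
  have hM1 : IsManifold 𝓘(ℝ, E) 1 M := IsManifold.of_le (n := ∞) (by simp)
  have hM2 : IsManifold 𝓘(ℝ, E) 2 M := by simpa using isManifold_two (E := E) (M := M)
  let R (Z : VF E M) : E → E :=
    mpullbackWithin 𝓘(ℝ, E) 𝓘(ℝ, E) φ.symm Z (Set.range 𝓘(ℝ, E))
  have ht : φ.target ∈ 𝓝 (φ m) := extChartAt_target_mem_nhds m
  have key (g : SmoothFun E M) (Z : VF E M) (y : E) (hy : y ∈ φ.target) (v : E)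
      (hv : v = (mfderiv 𝓘(ℝ, E) 𝓘(ℝ, E) φ.symm y).inverse (Z (φ.symm y))) :
      Z.deriv g (φ.symm y) = fderiv ℝ (g ∘ φ.symm) y v := by
    have hs : MDifferentiableAt 𝓘(ℝ, E) 𝓘(ℝ, E) φ.symm y :=
      ((contMDiffOn_extChartAt_symm (I := 𝓘(ℝ, E)) (n := 1) m).contMDiffAt
        ((isOpen_extChartAt_target m).mem_nhds hy)).mdifferentiableAt one_ne_zero
    have hinv := isInvertible_mfderivWithin_extChartAt_symm (I := 𝓘(ℝ, E)) (x := m) hy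
    have h1 : fderiv ℝ (g ∘ φ.symm) y v =
        (mfderiv 𝓘(ℝ, E) 𝓘(ℝ, ℝ) g (φ.symm y))
          (mfderiv 𝓘(ℝ, E) 𝓘(ℝ, E) φ.symm y v) := by
      rw [← mfderiv_eq_fderiv]
      exact congrArg (fun L => L v) (mfderiv_comp y g.mdifferentiableAt hs)
    simp only [modelWithCornersSelf_coe, Set.range_id, mfderivWithin_univ] at hinv
    rw [← hφ] at hinv
    obtain ⟨e, he⟩ := hinv
    rw [h1, hv, ← he]
    simp [VF.deriv, mvfderiv]
    rfl
  have hm : φ.symm (φ m) = m := extChartAt_to_inv m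
  have hRd (Z : VF E M) : DifferentiableAt ℝ (R Z) (φ m) := by
    have := MDifferentiableWithinAt.differentiableWithinAt_mpullbackWithin_vectorField
      (I := 𝓘(ℝ, E)) (s := Set.univ) (x := m) (V := Z)
      ((Z.contMDiff m).mdifferentiableAt (by simp)).mdifferentiableWithinAt
    simp only [Set.preimage_univ, Set.univ_inter, modelWithCornersSelf_coe, Set.range_id] at this
    simp only [modelWithCornersSelf_coe, Set.range_id, R]
    exact differentiableWithinAt_univ.1 this
  have hkey (g : SmoothFun E M) (Z : VF E M) :
      (Z.deriv g ∘ φ.symm) =ᶠ[𝓝 (φ m)] fun y => fderiv ℝ (g ∘ φ.symm) y (R Z y) := by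
    filter_upwards [ht] with y hy
    exact key g Z y hy _ (by simp [R, mpullback_apply]; rfl)
  have hgd (g : SmoothFun E M) : ContDiffAt ℝ 2 (g ∘ φ.symm) (φ m) := by
    have h1 : ContMDiffAt 𝓘(ℝ, E) 𝓘(ℝ, E) 2 φ.symm (φ m) :=
      (contMDiffOn_extChartAt_symm (I := 𝓘(ℝ, E)) (n := 2) m).contMDiffAt ht
    have h2 : ContMDiffAt 𝓘(ℝ, E) 𝓘(ℝ, ℝ) 2 g (φ.symm (φ m)) :=
      (g.contMDiff _).of_le (WithTop.coe_le_coe.2 le_top)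
    exact contMDiffAt_iff_contDiffAt.1 (h2.comp _ h1)
  have hdd (A B : VF E M) : A.deriv (B.deriv f) m =
      fderiv ℝ (fderiv ℝ (f ∘ φ.symm)) (φ m) (R A (φ m)) (R B (φ m)) +
      fderiv ℝ (f ∘ φ.symm) (φ m) (fderiv ℝ (R B) (φ m) (R A (φ m))) := by
    have h1 : A.deriv (B.deriv f) m = fderiv ℝ (B.deriv f ∘ φ.symm) (φ m) (R A (φ m)) := by
      have := (hkey (B.deriv f) A).self_of_nhds
      rwa [Function.comp_apply, hm] at this
    rw [h1, (hkey f B).fderiv_eq]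
    have h2 : DifferentiableAt ℝ (fderiv ℝ (f ∘ φ.symm)) (φ m) :=
      ((hgd f).fderiv_right (m := 1) (by norm_num)).differentiableAt one_ne_zero
    rw [fderiv_clm_apply h2 (hRd B)]
    simp [add_comm]
  have hbr : mvfderiv 𝓘(ℝ, E) f m (mlieBracket 𝓘(ℝ, E) X Y m) =
      fderiv ℝ (f ∘ φ.symm) (φ m) (lieBracket ℝ (R X) (R Y) (φ m)) := by
    have h := key f (VF.bracket X Y) (φ m) (mem_extChartAt_target m) _ rfl
    rw [hm] at h
    refine h.trans (congrArg _ ?_)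
    have hinv := isInvertible_mfderiv_extChartAt (I := 𝓘(ℝ, E)) (mem_extChartAt_source m)
    rw [← hφ] at hinv
    have h1 := mfderiv_extChartAt_inverse_comp_mfderivWithin_extChartAT_symm (I := 𝓘(ℝ, E))
      (mlieBracket 𝓘(ℝ, E) X Y m)
    let L : E := lieBracket ℝ (R X) (R Y) (φ m)
    have h2 : mlieBracket 𝓘(ℝ, E) X Y m = (mfderiv 𝓘(ℝ, E) 𝓘(ℝ, E) φ m).inverse L := by
      rw [← mlieBracketWithin_univ, mlieBracketWithin_apply]
      simp only [Set.preimage_univ, Set.univ_inter, modelWithCornersSelf_coe, Set.range_id, L, R]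
      exact congrArg _ (congrFun lieBracketWithin_univ _)
    obtain ⟨e, he⟩ := hinv
    rw [← hφ] at h1
    simp only [modelWithCornersSelf_coe, Set.range_id, mfderivWithin_univ] at h1
    have h3 := h1.trans h2
    rw [← he, ContinuousLinearMap.inverse_equiv] at h3
    exact e.symm.injective h3
  rw [hbr, hdd, hdd, lieBracket_eq]
  have hsymm := (hgd f).isSymmSndFDerivAt (by simp)
  rw [hsymm.eq (R X (φ m)) (R Y (φ m))]
  simp


variable {F : Type*} [NormedAddCommGroup F] [NormedSpace ℝ F]
  {V : M → Type*} [TopologicalSpace (TotalSpace F V)] [∀ m, AddCommGroup (V m)]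
  [∀ m, Module ℝ (V m)] [∀ m, TopologicalSpace (V m)] [FiberBundle F V] [VectorBundle ℝ F V]

theorem Sec.ext' {u v : Sec E F V} (h : ∀ m, u m = v m) : u = v := ContMDiffSection.ext h

/-- Multiplication of a section by a smooth function. -/
def Sec.fsmul (f : SmoothFun E M) (u : Sec E F V) : Sec E F V where
  toFun m := f m • u m
  contMDiff_toFun := ContMDiff.smul_section (V := V) f.contMDiff u.contMDiff

/-- Evaluation of sections at `m`. -/
def Sec.eval (E F : Type*) {M : Type*} [NormedAddCommGroup E] [NormedSpace ℝ E]
    [NormedAddCommGroup F] [NormedSpace ℝ F] [TopologicalSpace M] [ChartedSpace E M]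
    (V : M → Type*) [TopologicalSpace (TotalSpace F V)] [∀ m, AddCommGroup (V m)]
    [∀ m, Module ℝ (V m)] [∀ m, TopologicalSpace (V m)]
    [FiberBundle F V] [VectorBundle ℝ F V] (m : M) : Sec E F V →ₗ[ℝ] V m where
  toFun u := u m
  map_add' _ _ := rfl
  map_smul' _ _ := rfl

theorem exists_sec_eventuallyEq [T2Space M] {m : M} {U : Set M} (hU : IsOpen U) (hm : m ∈ U)
    (s : ∀ m, V m)
    (hs : ContMDiffOn 𝓘(ℝ, E) (𝓘(ℝ, E).prod 𝓘(ℝ, F)) ∞ (fun m => TotalSpace.mk' F m (s m)) U) :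
    ∃ u : Sec E F V, ∀ᶠ p in 𝓝 m, u p = s p := by
  obtain ⟨ψ, -, hψ⟩ := (SmoothBumpFunction.nhds_basis_tsupport (I := 𝓘(ℝ, E)) m).mem_iff.1
    (hU.mem_nhds hm)
  refine ⟨⟨(ψ : M → ℝ) • s, ContMDiffOn.smul_section_of_tsupport ψ.contMDiff.contMDiffOn hU hψ hs⟩, ?_⟩
  filter_upwards [ψ.eventuallyEq_one] with p hp
  change ψ p • s p = s p
  rw [hp]; simp

theorem exists_fun_eventuallyEq [T2Space M] {m : M} {U : Set M} (hU : IsOpen U) (hm : m ∈ U)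
    (g : M → ℝ) (hg : ContMDiffOn 𝓘(ℝ, E) 𝓘(ℝ, ℝ) ∞ g U) :
    ∃ f : SmoothFun E M, ∀ᶠ p in 𝓝 m, f p = g p := by
  obtain ⟨ψ, -, hψ⟩ := (SmoothBumpFunction.nhds_basis_tsupport (I := 𝓘(ℝ, E)) m).mem_iff.1
    (hU.mem_nhds hm)
  refine ⟨⟨fun p => ψ p • g p, contMDiff_of_tsupport fun p hp => ?_⟩, ?_⟩
  · have : p ∈ U := hψ (closure_mono (Function.support_smul_subset_left _ _) hp)
    exact ψ.contMDiffAt.smul ((hg p this).contMDiffAt (hU.mem_nhds this))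
  · filter_upwards [ψ.eventuallyEq_one] with p hp
    change ψ p • g p = g p
    rw [hp]; simp

variable [ContMDiffVectorBundle ∞ F V 𝓘(ℝ, E)]

theorem exists_sec_apply_eq [T2Space M] (m : M) (v : V m) : ∃ u : Sec E F V, u m = v := by
  obtain ⟨s, hs, hs'⟩ := FiberBundle.exists_contMDiffOn_extend (k := ∞) 𝓘(ℝ, E) F v
  obtain ⟨u, hu⟩ := exists_sec_eventuallyEq (isOpen_interior (s := s)) (mem_interior_iff_mem_nhds.2 hs) _
    (hs'.mono interior_subset)
  exact ⟨u, by simpa using hu.self_of_nhds⟩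

variable {W : Type*} [AddCommGroup W] [Module ℝ W]

theorem tensorial_local [T2Space M] {m : M} (T : Sec E F V →ₗ[ℝ] W)
    (hT : ∀ (f : SmoothFun E M) (u : Sec E F V), T (u.fsmul f) = f m • T u)
    {u v : Sec E F V} (huv : ∀ᶠ p in 𝓝 m, u p = v p) : T u = T v := by
  obtain ⟨ψ, -, hψ⟩ := (SmoothBumpFunction.nhds_basis_tsupport (I := 𝓘(ℝ, E)) m).mem_iff.1 huv
  let f : SmoothFun E M := ⟨ψ, ψ.contMDiff⟩
  have hf : f m = 1 := ψ.eq_one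
  have h : u.fsmul f = v.fsmul f := by
    apply Sec.ext'
    intro p
    change ψ p • u p = ψ p • v p
    by_cases hp : p ∈ tsupport ψ
    · rw [hψ hp]
    · rw [image_eq_zero_of_notMem_tsupport hp]; simp
  have := congrArg T h
  simpa [hT, hf] using this

theorem tensorial_pointwise [T2Space M] [FiniteDimensional ℝ F] {m : M} (T : Sec E F V →ₗ[ℝ] W)
    (hT : ∀ (f : SmoothFun E M) (u : Sec E F V), T (u.fsmul f) = f m • T u)
    {u : Sec E F V} (hu : u m = 0) : T u = 0 := by
  have : ContMDiffVectorBundle 1 F V 𝓘(ℝ, E) := ContMDiffVectorBundle.of_le (n := ∞) (by simp)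
  let t := trivializationAt F V m
  have hm : m ∈ t.baseSet := FiberBundle.mem_baseSet_trivializationAt F V m
  let b := Module.finBasis ℝ F
  have hfr (i) := t.contMDiffOn_localFrame_baseSet (I := 𝓘(ℝ, E)) ∞ b i
  choose S hS using fun i => exists_sec_eventuallyEq t.open_baseSet hm _ (hfr i)
  have hco (i) := contMDiffOn_baseSet_localFrameCoeff (k := ∞) (e := t) b
    (s := u) u.contMDiff.contMDiffOn i
  choose c hc using fun i => exists_fun_eventuallyEq t.open_baseSet hm _ (hco i)
  have h1 : T u = T (∑ i, (S i).fsmul (c i)) := by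
    apply tensorial_local T hT
    filter_upwards [t.eventually_eq_localFrame_sum_coeff_smul (I := 𝓘(ℝ, E)) b (s := u) hm,
      eventually_all.2 hS, eventually_all.2 hc] with p h1 h2 h3
    rw [h1]
    have : (∑ i, (S i).fsmul (c i)) p = ∑ i, ((S i).fsmul (c i)) p := by
      exact map_sum (Sec.eval E F V p) _ _
    rw [this]
    refine Finset.sum_congr rfl fun i _ => ?_
    change _ = c i p • S i p
    rw [h2, h3]
    rfl
  rw [h1, map_sum]
  refine Finset.sum_eq_zero fun i _ => ?_
  rw [hT, (hc i).self_of_nhds]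
  simp [hu]

/-- The linear map on the fibre at `m` induced by an operation on sections that is linear over
the smooth functions, in the sense that `T (f u) = f(m) T u`. -/
def tensorialLift [T2Space M] [FiniteDimensional ℝ F] (m : M) (T : Sec E F V →ₗ[ℝ] W)
    (hT : ∀ (f : SmoothFun E M) (u : Sec E F V), T (u.fsmul f) = f m • T u) : V m →ₗ[ℝ] W :=
  (LinearMap.ker (Sec.eval E F V m)).liftQ T (fun _ hu => tensorial_pointwise T hT hu) ∘ₗ
    ((Sec.eval E F V m).quotKerEquivOfSurjective (exists_sec_apply_eq m)).symm.toLinearMap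

theorem tensorialLift_apply [T2Space M] [FiniteDimensional ℝ F] (m : M) (T : Sec E F V →ₗ[ℝ] W)
    (hT : ∀ (f : SmoothFun E M) (u : Sec E F V), T (u.fsmul f) = f m • T u) (u : Sec E F V) :
    tensorialLift m T hT (u m) = T u := by
  have : ((Sec.eval E F V m).quotKerEquivOfSurjective (exists_sec_apply_eq m)).symm (u m) =
      Submodule.Quotient.mk u := by
    rw [LinearEquiv.symm_apply_eq]; rfl
  rw [tensorialLift, LinearMap.comp_apply, LinearEquiv.coe_coe, this]
  rfl


section Hom

variable [T2Space M] [FiniteDimensional ℝ F] {F' : Type*} [NormedAddCommGroup F'] [NormedSpace ℝ F']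
  {V' : M → Type*} [TopologicalSpace (TotalSpace F' V')] [∀ m, AddCommGroup (V' m)]
  [∀ m, Module ℝ (V' m)] [∀ m, TopologicalSpace (V' m)] [FiberBundle F' V'] [VectorBundle ℝ F' V']
  [∀ m, IsTopologicalAddGroup (V' m)] [∀ m, ContinuousSMul ℝ (V' m)]

theorem contMDiff_hom_of_apply (s : ∀ m, V m →L[ℝ] V' m)
    (hs : ∀ u : Sec E F V, ContMDiff 𝓘(ℝ, E) (𝓘(ℝ, E).prod 𝓘(ℝ, F')) ∞
      (fun m => TotalSpace.mk' F' m (s m (u m)))) :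
    ContMDiff 𝓘(ℝ, E) (𝓘(ℝ, E).prod 𝓘(ℝ, F →L[ℝ] F')) ∞
      (fun m => TotalSpace.mk' (F →L[ℝ] F') (E := fun m => V m →L[ℝ] V' m) m (s m)) := by
  intro m
  rw [contMDiffAt_hom_bundle]
  refine ⟨contMDiffAt_id, ?_⟩
  let b := Module.finBasis ℝ F
  let g : M → F →L[ℝ] F' :=
    fun p => ContinuousLinearMap.inCoordinates F V F' V' m p m p (s p)
  have hg : ∀ p, g p = ∑ i, ContinuousLinearMap.smulRightL ℝ F F'
      (LinearMap.toContinuousLinearMap (b.coord i)) (g p (b i)) := by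
    intro p
    apply ContinuousLinearMap.coe_injective
    apply b.ext
    intro j
    simp [Finsupp.single_apply]
  have hb (i) : ContMDiffAt 𝓘(ℝ, E) 𝓘(ℝ, F') ∞ (fun p => g p (b i)) m := by
    let t := trivializationAt F V m
    have hm : m ∈ t.baseSet := FiberBundle.mem_baseSet_trivializationAt F V m
    obtain ⟨S, hS⟩ := exists_sec_eventuallyEq t.open_baseSet hm _
      (t.contMDiffOn_localFrame_baseSet (I := 𝓘(ℝ, E)) ∞ b i)
    have h1 := (contMDiffAt_section m).1 (hs S m)
    refine h1.congr_of_eventuallyEq ?_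
    filter_upwards [hS, t.open_baseSet.mem_nhds hm,
      (trivializationAt F' V' m).open_baseSet.mem_nhds
        (FiberBundle.mem_baseSet_trivializationAt F' V' m)] with p hp hp1 hp2
    simp only [g]
    rw [ContinuousLinearMap.inCoordinates_eq hp1 hp2, hp]
    simp [hp1, t, Trivialization.basisAt]
  have : ContMDiffAt 𝓘(ℝ, E) 𝓘(ℝ, F →L[ℝ] F') ∞ (fun p => ∑ i, ContinuousLinearMap.smulRightL ℝ F F'
      (LinearMap.toContinuousLinearMap (b.coord i)) (g p (b i))) m := by
    refine ContMDiffAt.sum fun i _ => ?_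
    exact (ContinuousLinearMap.contMDiff _).contMDiffAt.comp m (hb i)
  exact this.congr_of_eventuallyEq (Eventually.of_forall hg)

end Hom


section Gauge

variable (E F V) in
/-- The fibre at `m` of the gauge algebroid `𝔇V`: `ℝ`-linear operators `d : Γ(V) → V_m` together
with an anchor `x ∈ T_m M` such that `d (f u) = f(m) d(u) + x(f) u(m)`. -/
def Gauge (m : M) : Submodule ℝ ((Sec E F V →ₗ[ℝ] V m) × TangentSpace 𝓘(ℝ, E) m) where
  carrier := {d | ∀ (f : SmoothFun E M) (u : Sec E F V),
    d.1 (u.fsmul f) = f m • d.1 u + mvfderiv 𝓘(ℝ, E) f m d.2 • u m}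
  zero_mem' := by intro f u; simp
  add_mem' := by
    intro a b ha hb f u
    simp only [Prod.fst_add, LinearMap.add_apply, ha f u, hb f u, Prod.snd_add, map_add, add_smul,
      smul_add]
    abel
  smul_mem' := by
    intro c a ha f u
    simp only [Prod.smul_fst, LinearMap.smul_apply, ha f u, Prod.smul_snd, map_smul, smul_add,
      smul_smul, smul_eq_mul, mul_comm c]

/-- The anchor of `𝔇V`. -/
def Gauge.anchor {m : M} : Gauge E F V m →ₗ[ℝ] TangentSpace 𝓘(ℝ, E) m :=
  LinearMap.snd ℝ _ _ ∘ₗ (Gauge E F V m).subtype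

/-- The inclusion `gl(V) → 𝔇V`. -/
def Gauge.ofEnd {m : M} : (V m →ₗ[ℝ] V m) →ₗ[ℝ] Gauge E F V m where
  toFun Φ := ⟨(Φ ∘ₗ Sec.eval E F V m, 0), fun f u => by
    simp only [LinearMap.comp_apply, map_zero, zero_smul, add_zero]
    exact map_smul Φ (f m) (u m)⟩
  map_add' _ _ := Subtype.ext (Prod.ext rfl (add_zero _).symm)
  map_smul' _ _ := Subtype.ext (Prod.ext rfl (smul_zero _).symm)

variable (E F V) in
/-- The smooth sections of `𝔇V`: those families `δ` of elements of the fibres whose anchor is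
a smooth vector field and that map smooth sections of `V` to smooth sections of `V`. -/
def GaugeSec : Submodule ℝ (∀ m : M, Gauge E F V m) where
  carrier := {δ |
    (∀ u : Sec E F V, ContMDiff 𝓘(ℝ, E) (𝓘(ℝ, E).prod 𝓘(ℝ, F)) ∞
      (fun m => TotalSpace.mk' F m ((δ m).1.1 u))) ∧
    ContMDiff 𝓘(ℝ, E) (𝓘(ℝ, E).prod 𝓘(ℝ, E)) ∞
      (fun m => TotalSpace.mk' E (E := (TangentSpace 𝓘(ℝ, E) : M → Type _)) m (Gauge.anchor (δ m)))}
  zero_mem' := ⟨fun _ => (0 : Sec E F V).contMDiff, (0 : VF E M).contMDiff⟩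
  add_mem' ha hb := ⟨fun u => (ha.1 u).add_section (hb.1 u), ha.2.add_section hb.2⟩
  smul_mem' c _ ha := ⟨fun u => (ha.1 u).const_smul_section (a := c),
    ha.2.const_smul_section (a := c)⟩

/-- The operator `Γ(V) → Γ(V)` given by a section of `𝔇V`. -/
def GaugeSec.op (δ : GaugeSec E F V) : Sec E F V →ₗ[ℝ] Sec E F V where
  toFun u := ⟨fun m => (δ.1 m).1.1 u, δ.2.1 u⟩
  map_add' u v := Sec.ext' fun m => map_add (δ.1 m).1.1 u v
  map_smul' c u := Sec.ext' fun m => map_smul (δ.1 m).1.1 c u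

/-- The anchor of a section of `𝔇V`. -/
def GaugeSec.anchor (δ : GaugeSec E F V) : VF E M := ⟨fun m => Gauge.anchor (δ.1 m), δ.2.2⟩

theorem GaugeSec.op_apply (δ : GaugeSec E F V) (u : Sec E F V) (m : M) :
    (GaugeSec.op δ) u m = (δ.1 m).1.1 u := rfl

theorem GaugeSec.op_fsmul (δ : GaugeSec E F V) (f : SmoothFun E M) (u : Sec E F V) :
    (GaugeSec.op δ) (u.fsmul f) = ((GaugeSec.op δ) u).fsmul f + u.fsmul ((GaugeSec.anchor δ).deriv f) :=
  Sec.ext' fun m => (δ.1 m).2 f u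

theorem GaugeSec.ext {δ δ' : GaugeSec E F V} (h : ∀ u, (GaugeSec.op δ) u = (GaugeSec.op δ') u)
    (h' : (GaugeSec.anchor δ) = (GaugeSec.anchor δ')) : δ = δ' := by
  refine Subtype.ext (funext fun m => Subtype.ext (Prod.ext (LinearMap.ext fun u => ?_) ?_))
  · exact congrArg (fun v : Sec E F V => v m) (h u)
  · exact congrArg (fun X : VF E M => X m) h'

/-- A section of `𝔇V` from an operator on sections with an anchor. -/
def GaugeSec.mk (D : Sec E F V →ₗ[ℝ] Sec E F V) (X : VF E M)
    (h : ∀ f u, D (u.fsmul f) = (D u).fsmul f + u.fsmul (X.deriv f)) : GaugeSec E F V :=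
  ⟨fun m => ⟨(Sec.eval E F V m ∘ₗ D, X m), fun f u =>
    congrArg (fun v : Sec E F V => v m) (h f u)⟩,
    fun u => (D u).contMDiff, X.contMDiff⟩

/-- The bracket of `Γ(𝔇V)`: the commutator of operators, with anchor the bracket of the anchors. -/
def GaugeSec.bracket (δ δ' : GaugeSec E F V) : GaugeSec E F V :=
  GaugeSec.mk ((GaugeSec.op δ) ∘ₗ (GaugeSec.op δ') - (GaugeSec.op δ') ∘ₗ (GaugeSec.op δ)) ((GaugeSec.anchor δ).bracket (GaugeSec.anchor δ')) (by
    intro f u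
    have h : ∀ m, ((GaugeSec.anchor δ).bracket (GaugeSec.anchor δ')).deriv f m =
        (GaugeSec.anchor δ).deriv ((GaugeSec.anchor δ').deriv f) m - (GaugeSec.anchor δ').deriv ((GaugeSec.anchor δ).deriv f) m :=
      fun m => VF.bracket_deriv _ _ f m
    simp only [LinearMap.sub_apply, LinearMap.comp_apply, GaugeSec.op_fsmul, map_add]
    apply Sec.ext'
    intro m
    change f m • _ + (GaugeSec.anchor δ).deriv f m • _ +
        ((GaugeSec.anchor δ').deriv f m • _ + (GaugeSec.anchor δ).deriv ((GaugeSec.anchor δ').deriv f) m • u m) -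
      (f m • _ + (GaugeSec.anchor δ').deriv f m • _ +
        ((GaugeSec.anchor δ).deriv f m • _ + (GaugeSec.anchor δ').deriv ((GaugeSec.anchor δ).deriv f) m • u m)) =
      f m • (_ - _) + ((GaugeSec.anchor δ).bracket (GaugeSec.anchor δ')).deriv f m • u m
    rw [h m, sub_smul, smul_sub]
    abel)

/-- Multiplication of a section of `𝔇V` by a smooth function. -/
def GaugeSec.fsmul (f : SmoothFun E M) (δ : GaugeSec E F V) : GaugeSec E F V :=
  ⟨fun m => f m • δ.1 m, fun u => (((GaugeSec.op δ) u).fsmul f).contMDiff, ((GaugeSec.anchor δ).fsmul f).contMDiff⟩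

end Gauge


section Lift

theorem contMDiff_mvfderiv_apply {G : Type*} [NormedAddCommGroup G] [NormedSpace ℝ G]
    {g : M → G} (hg : ContMDiff 𝓘(ℝ, E) 𝓘(ℝ, G) ∞ g) (X : VF E M) :
    ContMDiff 𝓘(ℝ, E) 𝓘(ℝ, G) ∞ (fun m => mvfderiv 𝓘(ℝ, E) g m (X m)) := by
  have h := (hg.contMDiff_tangentMap (m := ∞) (by simp)).comp X.contMDiff
  exact (contMDiff_snd_tangentBundle_modelSpace G 𝓘(ℝ, G) (n := ∞)).comp h

/-- Near every point there is a linear connection, cut off by a smooth function. -/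
theorem exists_local_connection [T2Space M] (m₀ : M) :
    ∃ (D : VF E M →ₗ[ℝ] GaugeSec E F V) (χ : SmoothFun E M),
      (∀ f X, D (X.fsmul f) = GaugeSec.fsmul f (D X)) ∧ (∀ᶠ m in 𝓝 m₀, χ m = 1) ∧
      ∀ X, GaugeSec.anchor (D X) = X.fsmul χ := by
  let t := trivializationAt F V m₀
  have hm : m₀ ∈ t.baseSet := FiberBundle.mem_baseSet_trivializationAt F V m₀
  obtain ⟨ψ, -, hψ⟩ := (SmoothBumpFunction.nhds_basis_tsupport (I := 𝓘(ℝ, E)) m₀).mem_iff.1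
    (t.open_baseSet.mem_nhds hm)
  have hψ0 : ∀ p, p ∉ t.baseSet → ψ p = 0 := fun p hp =>
    image_eq_zero_of_notMem_tsupport fun h => hp (hψ h)
  let loc (u : Sec E F V) (p : M) : F := ψ p • (t ⟨p, u p⟩).2
  have hloc (u : Sec E F V) : ContMDiff 𝓘(ℝ, E) 𝓘(ℝ, F) ∞ (loc u) := by
    refine contMDiff_of_tsupport fun p hp => ?_
    have hp' : p ∈ t.baseSet := hψ (closure_mono (Function.support_smul_subset_left _ _) hp)
    exact ψ.contMDiffAt.smul ((t.contMDiffAt_section_iff hp').1 (u.contMDiff p))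
  have hlocd (u : Sec E F V) (p : M) : MDifferentiableAt 𝓘(ℝ, E) 𝓘(ℝ, F) (loc u) p :=
    (hloc u p).mdifferentiableAt (by simp)
  have loc_add (u v : Sec E F V) : loc (u + v) = loc u + loc v := by
    funext p
    by_cases hp : p ∈ t.baseSet
    · have := (t.linear ℝ hp).map_add (u p) (v p)
      change ψ p • (t ⟨p, u p + v p⟩).2 = ψ p • _ + ψ p • _
      rw [this, smul_add]
    · simp [loc, hψ0 p hp]
  have loc_fsmul (f : SmoothFun E M) (u : Sec E F V) : loc (u.fsmul f) = (f : M → ℝ) • loc u := by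
    funext p
    by_cases hp : p ∈ t.baseSet
    · have := (t.linear ℝ hp).map_smul (f p) (u p)
      change ψ p • (t ⟨p, f p • u p⟩).2 = f p • ψ p • _
      rw [this, smul_comm]
    · simp [loc, hψ0 p hp]
  have loc_smul (c : ℝ) (u : Sec E F V) : loc (c • u) = c • loc u := by
    funext p
    by_cases hp : p ∈ t.baseSet
    · have := (t.linear ℝ hp).map_smul c (u p)
      change ψ p • (t ⟨p, c • u p⟩).2 = c • ψ p • _
      rw [this, smul_comm]
    · simp [loc, hψ0 p hp]
  have symm_loc (u : Sec E F V) (p : M) : ψ p • t.symmₗ ℝ p (loc u p) = (ψ p * ψ p) • u p := by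
    by_cases hp : p ∈ t.baseSet
    · have : t.symmₗ ℝ p (t ⟨p, u p⟩).2 = u p := by
        simp [hp]
      simp only [loc, map_smul, this, smul_smul]
    · simp [hψ0 p hp]
  let χ : SmoothFun E M := ⟨fun p => ψ p * ψ p, ψ.contMDiff.mul ψ.contMDiff⟩
  let op (X : VF E M) (u : Sec E F V) : Sec E F V :=
    ⟨(ψ : M → ℝ) • fun p => t.symmₗ ℝ p (mvfderiv 𝓘(ℝ, E) (loc u) p (X p)), by
      refine ContMDiffOn.smul_section_of_tsupport ψ.contMDiff.contMDiffOn t.open_baseSet hψ ?_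
      intro p hp
      refine ContMDiffAt.contMDiffWithinAt ?_
      rw [t.contMDiffAt_section_iff hp]
      refine (contMDiff_mvfderiv_apply (hloc u) X p).congr_of_eventuallyEq ?_
      filter_upwards [t.open_baseSet.mem_nhds hp] with q hq
      simp [hq]⟩
  have op_apply (X : VF E M) (u : Sec E F V) (p : M) :
    op X u p = ψ p • t.symmₗ ℝ p (mvfderiv 𝓘(ℝ, E) (loc u) p (X p)) := rfl
  let δ (X : VF E M) : GaugeSec E F V := GaugeSec.mk
    { toFun := op X
      map_add' := fun u v => Sec.ext' fun p => by
        change _ = op X u p + op X v p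
        simp only [op_apply, loc_add, mvfderiv_add (hlocd u p) (hlocd v p), ← smul_add, ← map_add]
        rfl
      map_smul' := fun c u => Sec.ext' fun p => by
        change _ = c • op X u p
        have h : mvfderiv 𝓘(ℝ, E) (loc (c • u)) p (X p) =
            c • mvfderiv 𝓘(ℝ, E) (loc u) p (X p) := by
          have := mvfderiv_smul (I := 𝓘(ℝ, E)) (a := fun _ => c) (x := p) mdifferentiableAt_const
            (hlocd u p)
          rw [loc_smul]
          have h2 : (fun _ : M => c) • loc u = c • loc u := rfl
          rw [h2, mvfderiv_const] at this
          simp [this]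
        rw [op_apply, h, map_smul, smul_comm]
        rfl }
    (X.fsmul χ) (fun f u => Sec.ext' fun p => by
      change op X (u.fsmul f) p = f p • op X u p + mvfderiv 𝓘(ℝ, E) f p (χ p • X p) • u p
      have h := mvfderiv_smul (I := 𝓘(ℝ, E)) (a := f) (x := p) f.mdifferentiableAt (hlocd u p)
      rw [op_apply, loc_fsmul, h, op_apply]
      have h2 := symm_loc u p
      simp only [add_apply, smul_apply, map_add, map_smul,
        ContinuousLinearMap.smulRight_apply, smul_add, smul_eq_mul]
      congr 1
      · rw [smul_comm]
      · rw [smul_comm, h2, smul_smul, mul_comm]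
        rfl)
  have δ_apply (X : VF E M) (u : Sec E F V) (p : M) : GaugeSec.op (δ X) u p = op X u p := rfl
  refine ⟨{ toFun := δ, map_add' := ?_, map_smul' := ?_ }, χ, ?_, ?_, fun X => rfl⟩
  · intro X Y
    refine GaugeSec.ext (fun u => Sec.ext' fun p => ?_) (Sec.ext' fun p => ?_)
    · change op (X + Y) u p = op X u p + op Y u p
      simp only [op_apply, ← smul_add, ← map_add]
      rfl
    · exact smul_add (χ p) (X p) (Y p)
  · intro c X
    refine GaugeSec.ext (fun u => Sec.ext' fun p => ?_) (Sec.ext' fun p => ?_)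
    · change op (c • X) u p = c • op X u p
      have h : (c • X) p = c • X p := rfl
      rw [op_apply, op_apply, h, map_smul, map_smul, smul_comm]
    · exact smul_comm (χ p) c (X p)
  · intro f X
    refine GaugeSec.ext (fun u => Sec.ext' fun p => ?_) (Sec.ext' fun p => ?_)
    · change op (X.fsmul f) u p = f p • op X u p
      have h : X.fsmul f p = f p • X p := rfl
      rw [op_apply, op_apply, h, map_smul, map_smul, smul_comm]
    · exact smul_comm (χ p) (f p) (X p)
  · filter_upwards [ψ.eventuallyEq_one] with p hp
    change ψ p * ψ p = 1
    rw [hp]; simp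

variable [T2Space M] [FiniteDimensional ℝ F]

theorem Gauge.exists_eq_ofEnd {m : M} (d : Gauge E F V m) (hd : Gauge.anchor d = 0) :
    ∃ Φ : V m →ₗ[ℝ] V m, d = Gauge.ofEnd Φ := by
  have hT : ∀ (f : SmoothFun E M) (u : Sec E F V), d.1.1 (u.fsmul f) = f m • d.1.1 u := by
    intro f u
    have h := d.2 f u
    have h2 : d.1.2 = 0 := hd
    simpa [h2] using h
  refine ⟨tensorialLift m d.1.1 hT, Subtype.ext (Prod.ext (LinearMap.ext fun u => ?_) hd)⟩
  exact (tensorialLift_apply m d.1.1 hT u).symm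

variable [∀ m, IsTopologicalAddGroup (V m)] [∀ m, ContinuousSMul ℝ (V m)]

/-- A smooth field of endomorphisms of `V`, as a section of `𝔇V`. -/
def GaugeSec.ofHom : Sec E (F →L[ℝ] F) (fun m => V m →L[ℝ] V m) →ₗ[ℝ] GaugeSec E F V where
  toFun A := ⟨fun m => Gauge.ofEnd (A m).toLinearMap,
    fun u => ContMDiff.clm_bundle_apply A.contMDiff u.contMDiff, (0 : VF E M).contMDiff⟩
  map_add' A B := Subtype.ext <| funext fun m =>
    map_add (Gauge.ofEnd (E := E) (F := F)) (A m).toLinearMap (B m).toLinearMap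
  map_smul' c A := Subtype.ext <| funext fun m =>
    map_smul (Gauge.ofEnd (E := E) (F := F)) c (A m).toLinearMap

theorem GaugeSec.ofHom_fsmul (f : SmoothFun E M)
    (A : Sec E (F →L[ℝ] F) (fun m => V m →L[ℝ] V m)) :
    GaugeSec.ofHom (A.fsmul f) = GaugeSec.fsmul f (GaugeSec.ofHom A) :=
  Subtype.ext <| funext fun m =>
    map_smul (Gauge.ofEnd (E := E) (F := F)) (f m) (A m).toLinearMap

theorem exists_clm_eq {m : M} (Φ : V m →ₗ[ℝ] V m) (_ : Sec E F V) :
    ∃ A : V m →L[ℝ] V m, A.toLinearMap = Φ := by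
  have : T2Space (V m) := FiberBundle.t2Space F V m
  have : FiniteDimensional ℝ (V m) := VectorBundle.finiteDimensional ℝ F V m
  exact ⟨LinearMap.toContinuousLinearMap Φ, rfl⟩

theorem GaugeSec.exists_eq_ofHom (δ : GaugeSec E F V) (hδ : GaugeSec.anchor δ = 0) :
    ∃ A, δ = GaugeSec.ofHom A := by
  have h0 (m : M) : ∃ A : V m →L[ℝ] V m, δ.1 m = Gauge.ofEnd A.toLinearMap := by
    obtain ⟨Φ, hΦ⟩ := Gauge.exists_eq_ofEnd (δ.1 m) (congrArg (fun X : VF E M => X m) hδ)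
    obtain ⟨A, rfl⟩ := exists_clm_eq Φ (0 : Sec E F V)
    exact ⟨A, hΦ⟩
  choose A hA using h0
  refine ⟨⟨A, contMDiff_hom_of_apply A fun u => ?_⟩, Subtype.ext (funext hA)⟩
  refine (GaugeSec.op δ u).contMDiff.congr fun m => ?_
  rw [GaugeSec.op_apply, hA m]
  rfl

theorem gauge_tensorial_local {m : M} (T : GaugeSec E F V →ₗ[ℝ] W)
    (hT : ∀ (f : SmoothFun E M) (δ : GaugeSec E F V), T (GaugeSec.fsmul f δ) = f m • T δ)
    {δ δ' : GaugeSec E F V} (h : ∀ᶠ p in 𝓝 m, δ.1 p = δ'.1 p) : T δ = T δ' := by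
  obtain ⟨ψ, -, hψ⟩ := (SmoothBumpFunction.nhds_basis_tsupport (I := 𝓘(ℝ, E)) m).mem_iff.1 h
  let f : SmoothFun E M := ⟨ψ, ψ.contMDiff⟩
  have hf : f m = 1 := ψ.eq_one
  have h : GaugeSec.fsmul f δ = GaugeSec.fsmul f δ' := by
    refine Subtype.ext (funext fun p => ?_)
    change ψ p • δ.1 p = ψ p • δ'.1 p
    by_cases hp : p ∈ tsupport ψ
    · rw [hψ hp]
    · rw [image_eq_zero_of_notMem_tsupport hp]; simp
  have := congrArg T h
  simpa [hT, hf] using this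

theorem gauge_tensorial_pointwise {m : M} (T : GaugeSec E F V →ₗ[ℝ] W)
    (hT : ∀ (f : SmoothFun E M) (δ : GaugeSec E F V), T (GaugeSec.fsmul f δ) = f m • T δ)
    {δ : GaugeSec E F V} (hδ : δ.1 m = 0) : T δ = 0 := by
  obtain ⟨D, χ, hD, hχ, hDa⟩ := exists_local_connection (V := V) (F := F) (E := E) m
  have hX : GaugeSec.anchor δ m = 0 := by
    change Gauge.anchor (δ.1 m) = 0
    rw [hδ, map_zero]
  -- the connection part
  have h1 : T (D (GaugeSec.anchor δ)) = 0 :=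
    tensorial_pointwise (m := m) (T ∘ₗ D) (fun f X => by simp [hD, hT]) hX
  have h1' : (D (GaugeSec.anchor δ)).1 m = 0 :=
    tensorial_pointwise (m := m) ((LinearMap.proj m ∘ₗ (GaugeSec E F V).subtype) ∘ₗ D)
      (fun f X => by simp only [LinearMap.comp_apply, hD]; rfl) hX
  -- the endomorphism part
  obtain ⟨ψ, -, hψ⟩ := (SmoothBumpFunction.nhds_basis_tsupport (I := 𝓘(ℝ, E)) m).mem_iff.1 hχ
  let f : SmoothFun E M := ⟨ψ, ψ.contMDiff⟩
  have hf : f m = 1 := ψ.eq_one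
  let ε : GaugeSec E F V := GaugeSec.fsmul f (δ - D (GaugeSec.anchor δ))
  obtain ⟨A, hA⟩ := GaugeSec.exists_eq_ofHom ε (by
    refine Sec.ext' fun p => ?_
    have h2 : GaugeSec.anchor (D (GaugeSec.anchor δ)) p = χ p • GaugeSec.anchor δ p := by
      rw [hDa]; rfl
    change ψ p • (GaugeSec.anchor δ p - GaugeSec.anchor (D (GaugeSec.anchor δ)) p) = 0
    rw [h2]
    by_cases hp : p ∈ tsupport ψ
    · have : χ p = 1 := hψ hp
      simp [this]
    · rw [image_eq_zero_of_notMem_tsupport hp]; simp)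
  have hA0 : A m = 0 := by
    have h3 : ε.1 m = 0 := by
      change f m • (δ.1 m - (D (GaugeSec.anchor δ)).1 m) = 0
      rw [hδ, h1']; simp
    ext v
    obtain ⟨u, rfl⟩ := exists_sec_apply_eq (E := E) (F := F) m v
    have h4 : (ε.1 m).1.1 u = A m (u m) := by rw [hA]; rfl
    rw [← h4, h3]; rfl
  have h5 : T ε = 0 := by
    rw [hA]
    exact tensorial_pointwise (m := m) (T ∘ₗ GaugeSec.ofHom)
      (fun f A => by simp [GaugeSec.ofHom_fsmul, hT]) hA0
  have h6 : T ε + T (D (GaugeSec.anchor δ)) = T δ := by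
    rw [hT, hf, one_smul, ← T.map_add]
    exact congrArg T (sub_add_cancel δ (D (GaugeSec.anchor δ)))
  rw [h5, h1, add_zero] at h6
  exact h6.symm

theorem gauge_tensorial_eq {m : M} (T : GaugeSec E F V →ₗ[ℝ] W)
    (hT : ∀ (f : SmoothFun E M) (δ : GaugeSec E F V), T (GaugeSec.fsmul f δ) = f m • T δ)
    {δ δ' : GaugeSec E F V} (h : δ.1 m = δ'.1 m) : T δ = T δ' := by
  have h1 : T (δ - δ') = 0 := gauge_tensorial_pointwise T hT (by
    change δ.1 m - δ'.1 m = 0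
    rw [h, sub_self])
  have h2 : T (δ - δ') + T δ' = T δ := by
    rw [← T.map_add]
    exact congrArg T (sub_add_cancel δ δ')
  rw [h1, zero_add] at h2
  exact h2.symm

theorem exists_gaugeSec_apply_eq (m : M) (d : Gauge E F V m) :
    ∃ δ : GaugeSec E F V, δ.1 m = d := by
  obtain ⟨D, χ, hD, hχ, hDa⟩ := exists_local_connection (V := V) (F := F) (E := E) m
  obtain ⟨X, hX⟩ := exists_sec_apply_eq (E := E) (F := E) m (Gauge.anchor d)
  obtain ⟨Φ, hΦ⟩ := Gauge.exists_eq_ofEnd (d - (D X).1 m) (by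
    have h2 : GaugeSec.anchor (D X) m = χ m • X m := by rw [hDa]; rfl
    have h3 : Gauge.anchor ((D X).1 m) = χ m • X m := h2
    rw [map_sub, h3, hX, hχ.self_of_nhds, one_smul, sub_self])
  obtain ⟨A₀, rfl⟩ := exists_clm_eq Φ (0 : Sec E F V)
  obtain ⟨A, rfl⟩ := exists_sec_apply_eq (E := E) (F := F →L[ℝ] F)
    (V := fun m => V m →L[ℝ] V m) m A₀
  refine ⟨GaugeSec.ofHom A + D X, ?_⟩
  change Gauge.ofEnd (A m).toLinearMap + (D X).1 m = d
  rw [← hΦ, sub_add_cancel]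

/-- The linear map on the fibre of `𝔇V` at `m` induced by an operation on sections of `𝔇V` that is
linear over the smooth functions, in the sense that `T (f δ) = f(m) T δ`. -/
def gaugeLift (m : M) (T : GaugeSec E F V →ₗ[ℝ] W)
    (hT : ∀ (f : SmoothFun E M) (δ : GaugeSec E F V), T (GaugeSec.fsmul f δ) = f m • T δ) :
    Gauge E F V m →ₗ[ℝ] W where
  toFun d := T (exists_gaugeSec_apply_eq m d).choose
  map_add' d d' := by
    rw [← T.map_add]
    apply gauge_tensorial_eq T hT
    have h := (exists_gaugeSec_apply_eq m d).choose_spec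
    have h' := (exists_gaugeSec_apply_eq m d').choose_spec
    exact (exists_gaugeSec_apply_eq m (d + d')).choose_spec.trans (congrArg₂ (· + ·) h h').symm
  map_smul' c d := by
    rw [RingHom.id_apply, ← T.map_smul]
    apply gauge_tensorial_eq T hT
    have h := (exists_gaugeSec_apply_eq m d).choose_spec
    exact (exists_gaugeSec_apply_eq m (c • d)).choose_spec.trans (congrArg (c • ·) h).symm

theorem gaugeLift_apply (m : M) (T : GaugeSec E F V →ₗ[ℝ] W)
    (hT : ∀ (f : SmoothFun E M) (δ : GaugeSec E F V), T (GaugeSec.fsmul f δ) = f m • T δ)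
    (δ : GaugeSec E F V) : gaugeLift m T hT (δ.1 m) = T δ :=
  gauge_tensorial_eq T hT (exists_gaugeSec_apply_eq m (δ.1 m)).choose_spec

end Lift


section Bracket

theorem Sec.mdifferentiableAt (u : Sec E F V) (m : M) :
    MDifferentiableAt 𝓘(ℝ, E) (𝓘(ℝ, E).prod 𝓘(ℝ, F)) (fun m => TotalSpace.mk' F m (u m)) m :=
  (u.contMDiff m).mdifferentiableAt (by simp)

theorem VF.bracket_add_right (X Y Z : VF E M) : X.bracket (Y + Z) = X.bracket Y + X.bracket Z :=
  Sec.ext' fun m => by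
    have : IsManifold 𝓘(ℝ, E) (minSmoothness ℝ 2) M := isManifold_two
    exact mlieBracket_add_right (Y.mdifferentiableAt m) (Z.mdifferentiableAt m)

theorem VF.bracket_swap (X Y : VF E M) : X.bracket Y = - Y.bracket X :=
  Sec.ext' fun _ => mlieBracket_swap_apply

theorem VF.bracket_add_left (X Y Z : VF E M) : (X + Y).bracket Z = X.bracket Z + Y.bracket Z := by
  rw [VF.bracket_swap, VF.bracket_add_right, VF.bracket_swap X, VF.bracket_swap Y, neg_add]

theorem VF.bracket_smul_right (c : ℝ) (X Y : VF E M) : X.bracket (c • Y) = c • X.bracket Y :=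
  Sec.ext' fun m => by
    have : IsManifold 𝓘(ℝ, E) (minSmoothness ℝ 2) M := isManifold_two
    exact mlieBracket_const_smul_right (Y.mdifferentiableAt m)

theorem VF.bracket_smul_left (c : ℝ) (X Y : VF E M) : (c • X).bracket Y = c • X.bracket Y := by
  rw [VF.bracket_swap, VF.bracket_smul_right, VF.bracket_swap X, smul_neg]

theorem VF.bracket_fsmul_right (f : SmoothFun E M) (X Y : VF E M) :
    X.bracket (Y.fsmul f) = (X.bracket Y).fsmul f + Y.fsmul (X.deriv f) :=
  Sec.ext' fun m => by
    have : IsManifold 𝓘(ℝ, E) (minSmoothness ℝ 2) M := isManifold_two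
    refine (mlieBracket_smul_right f.mdifferentiableAt (Y.mdifferentiableAt m)).trans ?_
    rw [add_comm]
    rfl

theorem GaugeSec.op_bracket (δ δ' : GaugeSec E F V) (u : Sec E F V) :
    GaugeSec.op (GaugeSec.bracket δ δ') u =
      GaugeSec.op δ (GaugeSec.op δ' u) - GaugeSec.op δ' (GaugeSec.op δ u) := rfl

theorem GaugeSec.bracket_add_right (δ δ₁ δ₂ : GaugeSec E F V) :
    GaugeSec.bracket δ (δ₁ + δ₂) = GaugeSec.bracket δ δ₁ + GaugeSec.bracket δ δ₂ := by
  refine GaugeSec.ext (fun u => ?_) ?_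
  · change GaugeSec.op δ (GaugeSec.op δ₁ u + GaugeSec.op δ₂ u) -
      (GaugeSec.op δ₁ (GaugeSec.op δ u) + GaugeSec.op δ₂ (GaugeSec.op δ u)) =
      (GaugeSec.op δ (GaugeSec.op δ₁ u) - GaugeSec.op δ₁ (GaugeSec.op δ u)) +
      (GaugeSec.op δ (GaugeSec.op δ₂ u) - GaugeSec.op δ₂ (GaugeSec.op δ u))
    rw [(GaugeSec.op δ).map_add]
    abel
  · exact VF.bracket_add_right (GaugeSec.anchor δ) (GaugeSec.anchor δ₁) (GaugeSec.anchor δ₂)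

theorem GaugeSec.bracket_smul_right (c : ℝ) (δ δ' : GaugeSec E F V) :
    GaugeSec.bracket δ (c • δ') = c • GaugeSec.bracket δ δ' := by
  refine GaugeSec.ext (fun u => ?_) ?_
  · change GaugeSec.op δ (c • GaugeSec.op δ' u) - c • (GaugeSec.op δ' (GaugeSec.op δ u)) =
      c • (GaugeSec.op δ (GaugeSec.op δ' u) - GaugeSec.op δ' (GaugeSec.op δ u))
    rw [(GaugeSec.op δ).map_smul, smul_sub]
  · exact VF.bracket_smul_right c (GaugeSec.anchor δ) (GaugeSec.anchor δ')

theorem GaugeSec.bracket_fsmul_right (f : SmoothFun E M) (δ δ' : GaugeSec E F V) :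
    GaugeSec.bracket δ (GaugeSec.fsmul f δ') =
      GaugeSec.fsmul f (GaugeSec.bracket δ δ') +
        GaugeSec.fsmul ((GaugeSec.anchor δ).deriv f) δ' := by
  refine GaugeSec.ext (fun u => Sec.ext' fun m => ?_) ?_
  · change (GaugeSec.op δ ((GaugeSec.op δ' u).fsmul f)) m - f m • (GaugeSec.op δ' (GaugeSec.op δ u)) m =
      f m • (GaugeSec.op δ (GaugeSec.op δ' u) m - GaugeSec.op δ' (GaugeSec.op δ u) m) +
        (GaugeSec.anchor δ).deriv f m • GaugeSec.op δ' u m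
    rw [GaugeSec.op_fsmul, smul_sub]
    change (f m • GaugeSec.op δ (GaugeSec.op δ' u) m +
      (GaugeSec.anchor δ).deriv f m • GaugeSec.op δ' u m) - _ = _
    abel
  · exact VF.bracket_fsmul_right f (GaugeSec.anchor δ) (GaugeSec.anchor δ')

end Bracket

section Jet

variable (E F V) in
/-- The fibre at `m` of the jet bundle `𝔍V`, inside `Hom(𝔇V, V)`: linear maps `ν : 𝔇V_m → V_m` with
`ν(Φ) = Φ(ν(1))` for `Φ ∈ gl(V_m)`. The 1-jet of `u` at `m` is the map `d ↦ d(u)`. -/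
def Jet (m : M) : Submodule ℝ (Gauge E F V m →ₗ[ℝ] V m) where
  carrier := {ν | ∀ Φ : V m →ₗ[ℝ] V m, ν (Gauge.ofEnd Φ) = Φ (ν (Gauge.ofEnd LinearMap.id))}
  zero_mem' := by intro Φ; simp
  add_mem' := by
    intro a b ha hb Φ
    rw [LinearMap.add_apply, ha Φ, hb Φ, LinearMap.add_apply, map_add]
  smul_mem' := by
    intro c a ha Φ
    rw [LinearMap.smul_apply, ha Φ, LinearMap.smul_apply, map_smul]

/-- The inclusion `Hom(TM, V) → 𝔍V`. -/
def Jet.incl {m : M} (y : TangentSpace 𝓘(ℝ, E) m →ₗ[ℝ] V m) : Jet E F V m :=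
  ⟨y ∘ₗ Gauge.anchor, fun Φ => by
    have h (Ψ : V m →ₗ[ℝ] V m) :
      Gauge.anchor (Gauge.ofEnd (E := E) (F := F) (V := V) Ψ) = 0 := rfl
    simp only [LinearMap.comp_apply, h, map_zero]⟩

/-- The projection `𝔍V → V`. -/
def Jet.proj {m : M} : Jet E F V m →ₗ[ℝ] V m :=
  LinearMap.applyₗ (Gauge.ofEnd LinearMap.id) ∘ₗ (Jet E F V m).subtype

variable (E F V) in
/-- The smooth sections of `𝔍V`: those families `ν` for which `ν(δ)` is a smooth section of `V`
whenever `δ` is a smooth section of `𝔇V`. -/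
def JetSec : Submodule ℝ (∀ m : M, Jet E F V m) where
  carrier := {ν | ∀ δ : GaugeSec E F V, ContMDiff 𝓘(ℝ, E) (𝓘(ℝ, E).prod 𝓘(ℝ, F)) ∞
      (fun m => TotalSpace.mk' F m ((ν m).1 (δ.1 m)))}
  zero_mem' := fun _ => (0 : Sec E F V).contMDiff
  add_mem' ha hb := fun δ => (ha δ).add_section (hb δ)
  smul_mem' c _ ha := fun δ => (ha δ).const_smul_section (a := c)

/-- The pairing `⟨ν, δ⟩` of sections of `𝔍V` and `𝔇V`, a section of `V`. -/
def JetSec.pair (ν : JetSec E F V) (δ : GaugeSec E F V) : Sec E F V :=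
  ⟨fun m => (ν.1 m).1 (δ.1 m), ν.2 δ⟩

/-- The jet prolongation of a section. -/
def JetSec.jet (u : Sec E F V) : JetSec E F V :=
  ⟨fun m => ⟨LinearMap.applyₗ u ∘ₗ LinearMap.fst ℝ _ _ ∘ₗ (Gauge E F V m).subtype, fun _ => rfl⟩,
    fun δ => (GaugeSec.op δ u).contMDiff⟩

variable (V) in
/-- The identity of `V` as a section of `𝔇V`. -/
def GaugeSec.one : GaugeSec E F V :=
  GaugeSec.mk LinearMap.id 0 fun f u => Sec.ext' fun m => by
    change f m • u m = f m • u m + mvfderiv 𝓘(ℝ, E) f m 0 • u m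
    simp

/-- The projection `𝔍V → V` on sections. -/
def JetSec.proj (ν : JetSec E F V) : Sec E F V := JetSec.pair ν (GaugeSec.one V)

variable [T2Space M] [FiniteDimensional ℝ F]
  [∀ m, IsTopologicalAddGroup (V m)] [∀ m, ContinuousSMul ℝ (V m)]

/-- The map `δ' ↦ δ⟨ν, δ'⟩(m) - ⟨ν, [δ, δ']⟩(m)`. -/
def JetSec.lieDerivMap (δ : GaugeSec E F V) (ν : JetSec E F V) (m : M) :
    GaugeSec E F V →ₗ[ℝ] V m where
  toFun := fun δ' => GaugeSec.op δ (JetSec.pair ν δ') m -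
    JetSec.pair ν (GaugeSec.bracket δ δ') m
  map_add' := fun a b => by
    have h1 : JetSec.pair ν (a + b) = JetSec.pair ν a + JetSec.pair ν b :=
      Sec.ext' fun m => (ν.1 m).1.map_add (a.1 m) (b.1 m)
    have h2 : JetSec.pair ν (GaugeSec.bracket δ (a + b)) =
        JetSec.pair ν (GaugeSec.bracket δ a) + JetSec.pair ν (GaugeSec.bracket δ b) := by
      rw [GaugeSec.bracket_add_right]
      exact Sec.ext' fun m =>
        (ν.1 m).1.map_add ((GaugeSec.bracket δ a).1 m) ((GaugeSec.bracket δ b).1 m)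
    rw [h1, h2, (GaugeSec.op δ).map_add]
    exact add_sub_add_comm _ _ _ _
  map_smul' := fun c a => by
    have h1 : JetSec.pair ν (c • a) = c • JetSec.pair ν a :=
      Sec.ext' fun m => (ν.1 m).1.map_smul c (a.1 m)
    have h2 : JetSec.pair ν (GaugeSec.bracket δ (c • a)) =
        c • JetSec.pair ν (GaugeSec.bracket δ a) := by
      rw [GaugeSec.bracket_smul_right]
      exact Sec.ext' fun m => (ν.1 m).1.map_smul c ((GaugeSec.bracket δ a).1 m)
    rw [h1, h2, (GaugeSec.op δ).map_smul]
    exact (smul_sub c _ _).symm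

theorem JetSec.lieDerivMap_fsmul (δ : GaugeSec E F V) (ν : JetSec E F V) (m : M)
    (f : SmoothFun E M) (δ' : GaugeSec E F V) :
    JetSec.lieDerivMap δ ν m (GaugeSec.fsmul f δ') = f m • JetSec.lieDerivMap δ ν m δ' := by
  change GaugeSec.op δ (JetSec.pair ν (GaugeSec.fsmul f δ')) m -
    JetSec.pair ν (GaugeSec.bracket δ (GaugeSec.fsmul f δ')) m =
    f m • (GaugeSec.op δ (JetSec.pair ν δ') m - JetSec.pair ν (GaugeSec.bracket δ δ') m)
  have h1 : JetSec.pair ν (GaugeSec.fsmul f δ') = (JetSec.pair ν δ').fsmul f :=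
    Sec.ext' fun m => (ν.1 m).1.map_smul (f m) (δ'.1 m)
  have h2 : JetSec.pair ν (GaugeSec.bracket δ (GaugeSec.fsmul f δ')) m =
      f m • JetSec.pair ν (GaugeSec.bracket δ δ') m +
        (GaugeSec.anchor δ).deriv f m • JetSec.pair ν δ' m := by
    rw [GaugeSec.bracket_fsmul_right]
    change (ν.1 m).1 (f m • (GaugeSec.bracket δ δ').1 m +
      (GaugeSec.anchor δ).deriv f m • δ'.1 m) = _
    rw [(ν.1 m).1.map_add, (ν.1 m).1.map_smul, (ν.1 m).1.map_smul]
    rfl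
  rw [h1, h2, GaugeSec.op_fsmul, smul_sub]
  exact add_sub_add_right_eq_sub _ _ _

/-- The Lie derivative `L_δ ν`, determined by `⟨L_δ ν, δ'⟩ = δ⟨ν, δ'⟩ - ⟨ν, [δ, δ']⟩`. -/
def JetSec.lieDeriv (δ : GaugeSec E F V) (ν : JetSec E F V) : JetSec E F V :=
  ⟨fun m => ⟨gaugeLift m (JetSec.lieDerivMap δ ν m) (JetSec.lieDerivMap_fsmul δ ν m), fun Φ => by
    obtain ⟨A₀, rfl⟩ := exists_clm_eq Φ (0 : Sec E F V)
    obtain ⟨A, rfl⟩ := exists_sec_apply_eq (E := E) (F := F →L[ℝ] F)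
      (V := fun m => V m →L[ℝ] V m) m A₀
    have h1 := gaugeLift_apply m (JetSec.lieDerivMap δ ν m) (JetSec.lieDerivMap_fsmul δ ν m) (GaugeSec.ofHom A)
    have h2 := gaugeLift_apply m (JetSec.lieDerivMap δ ν m) (JetSec.lieDerivMap_fsmul δ ν m) (GaugeSec.one V)
    refine h1.trans (Eq.trans ?_ (congrArg (A m) h2.symm))
    have h3 (B : Sec E (F →L[ℝ] F) (fun m => V m →L[ℝ] V m)) (p : M) :
        JetSec.pair ν (GaugeSec.ofHom B) p = B p (JetSec.proj ν p) := (ν.1 p).2 (B p).toLinearMap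
    -- the bracket of `δ` with an endomorphism field is an endomorphism field
    obtain ⟨B, hB⟩ := GaugeSec.exists_eq_ofHom (GaugeSec.bracket δ (GaugeSec.ofHom A)) (by
      change (GaugeSec.anchor δ).bracket 0 = 0
      have := VF.bracket_smul_right 0 (GaugeSec.anchor δ) 0
      simpa using this)
    have hone : GaugeSec.bracket δ (GaugeSec.one V) = 0 := by
      refine GaugeSec.ext (fun u => ?_) ?_
      · change GaugeSec.op δ u - GaugeSec.op δ u = 0
        rw [sub_self]
      · change (GaugeSec.anchor δ).bracket 0 = 0
        have := VF.bracket_smul_right 0 (GaugeSec.anchor δ) 0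
        simpa using this
    have hBm : B m (JetSec.proj ν m) = GaugeSec.op (GaugeSec.bracket δ (GaugeSec.ofHom A))
        (JetSec.proj ν) m := by rw [hB]; rfl
    change GaugeSec.op δ (JetSec.pair ν (GaugeSec.ofHom A)) m -
      JetSec.pair ν (GaugeSec.bracket δ (GaugeSec.ofHom A)) m =
      A m (GaugeSec.op δ (JetSec.proj ν) m - JetSec.pair ν (GaugeSec.bracket δ (GaugeSec.one V)) m)
    have h0 : JetSec.pair ν (0 : GaugeSec E F V) m = 0 := (ν.1 m).1.map_zero
    have h4 : JetSec.pair ν (GaugeSec.ofHom A) = GaugeSec.op (GaugeSec.ofHom A) (JetSec.proj ν) :=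
      Sec.ext' fun p => h3 A p
    rw [hone, h0, sub_zero, hB, h3, hBm, GaugeSec.op_bracket, h4]
    exact sub_sub_cancel _ _⟩,
  fun δ' => by
    have h : ContMDiff 𝓘(ℝ, E) (𝓘(ℝ, E).prod 𝓘(ℝ, F)) ∞ (fun m => TotalSpace.mk' F m
        ((GaugeSec.op δ (JetSec.pair ν δ') - JetSec.pair ν (GaugeSec.bracket δ δ') :
          Sec E F V) m)) := ContMDiffSection.contMDiff _
    refine h.congr fun m => ?_
    exact congrArg (TotalSpace.mk' F m) (gaugeLift_apply m (JetSec.lieDerivMap δ ν m) (JetSec.lieDerivMap_fsmul δ ν m) δ')⟩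

theorem JetSec.pair_lieDeriv (δ δ' : GaugeSec E F V) (ν : JetSec E F V) :
    JetSec.pair (JetSec.lieDeriv δ ν) δ' =
      GaugeSec.op δ (JetSec.pair ν δ') - JetSec.pair ν (GaugeSec.bracket δ δ') :=
  Sec.ext' fun m => gaugeLift_apply m (JetSec.lieDerivMap δ ν m) (JetSec.lieDerivMap_fsmul δ ν m) δ'

end Jet

section Poisson

variable [T2Space M]

section SkewAlgebroid

/-- A section of `Hom(V, V')` applied to a section of `V`. -/
def Sec.app [∀ m, IsTopologicalAddGroup (V m)] [∀ m, ContinuousSMul ℝ (V m)]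
    {F' : Type*} [NormedAddCommGroup F'] [NormedSpace ℝ F']
    {V' : M → Type*} [TopologicalSpace (TotalSpace F' V')] [∀ m, AddCommGroup (V' m)]
    [∀ m, Module ℝ (V' m)] [∀ m, TopologicalSpace (V' m)] [FiberBundle F' V']
    [VectorBundle ℝ F' V'] [∀ m, IsTopologicalAddGroup (V' m)] [∀ m, ContinuousSMul ℝ (V' m)]
    (A : Sec E (F →L[ℝ] F') (fun m => V m →L[ℝ] V' m)) (u : Sec E F V) : Sec E F' V' :=
  ⟨fun m => A m (u m), ContMDiff.clm_bundle_apply A.contMDiff u.contMDiff⟩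

variable (E F V) in
/-- An anchor and a skew-symmetric bracket on sections satisfying the Leibniz rule: a Lie algebroid
structure on the vector bundle `V`, except that the Jacobi identity is not required. -/
structure SkewAlgebroid [∀ m, IsTopologicalAddGroup (V m)] [∀ m, ContinuousSMul ℝ (V m)] where
  anchor : Sec E (F →L[ℝ] E) (fun m => V m →L[ℝ] TangentSpace 𝓘(ℝ, E) m)
  bracket : Sec E F V → Sec E F V → Sec E F V
  skew : ∀ u v, bracket u v = - bracket v u
  add_right : ∀ u v w, bracket u (v + w) = bracket u v + bracket u w
  smul_right : ∀ (c : ℝ) u v, bracket u (c • v) = c • bracket u v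
  leibniz : ∀ (f : SmoothFun E M) u v,
    bracket u (v.fsmul f) = (bracket u v).fsmul f + v.fsmul (VF.deriv (anchor.app u) f)

variable [∀ m, IsTopologicalAddGroup (V m)] [∀ m, ContinuousSMul ℝ (V m)]

/-- The operator `[v, ·]`, as a section of `𝔇V`. -/
def SkewAlgebroid.ad (A : SkewAlgebroid E F V) (v : Sec E F V) : GaugeSec E F V :=
  GaugeSec.mk ⟨⟨A.bracket v, A.add_right v⟩, fun c w => A.smul_right c v w⟩ (A.anchor.app v)
    (fun f u => A.leibniz f v u)

theorem SkewAlgebroid.ad_add (A : SkewAlgebroid E F V) (v w : Sec E F V) :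
    A.ad (v + w) = A.ad v + A.ad w := by
  refine GaugeSec.ext (fun u => ?_) (Sec.ext' fun m => (A.anchor m).map_add (v m) (w m))
  change A.bracket (v + w) u = A.bracket v u + A.bracket w u
  rw [A.skew, A.add_right, A.skew v, A.skew w, neg_add]

theorem SkewAlgebroid.ad_smul (A : SkewAlgebroid E F V) (c : ℝ) (v : Sec E F V) :
    A.ad (c • v) = c • A.ad v := by
  refine GaugeSec.ext (fun u => ?_) (Sec.ext' fun m => (A.anchor m).map_smul c (v m))
  change A.bracket (c • v) u = c • A.bracket v u
  rw [A.skew, A.smul_right, A.skew v, smul_neg]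

theorem SkewAlgebroid.ad_fsmul (A : SkewAlgebroid E F V) (f : SmoothFun E M) (v : Sec E F V)
    (m : M) : (A.ad (v.fsmul f)).1 m = f m • (A.ad v).1 m -
      Gauge.ofEnd (((mvfderiv 𝓘(ℝ, E) f m).toLinearMap ∘ₗ (A.anchor m).toLinearMap).smulRight
        (v m)) := by
  refine Subtype.ext (Prod.ext (LinearMap.ext fun u => ?_) ?_)
  · change A.bracket (v.fsmul f) u m =
      f m • A.bracket v u m - mvfderiv 𝓘(ℝ, E) f m (A.anchor m (u m)) • v m
    have h (w : Sec E F V) : (-w) m = -(w m) := rfl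
    rw [A.skew, A.leibniz, A.skew v, h, h, smul_neg]
    change -(f m • A.bracket u v m + mvfderiv 𝓘(ℝ, E) f m (A.anchor m (u m)) • v m) = _
    rw [neg_add, sub_eq_add_neg]
  · change A.anchor m (f m • v m) = f m • A.anchor m (v m) - 0
    rw [map_smul, sub_zero]

/-- For `ν` in the fibre of `𝔍V` at `m`, the map `v ↦ -ν([v, ·])`. -/
def SkewAlgebroid.sharpOp (A : SkewAlgebroid E F V) {m : M} (ν : Jet E F V m) :
    Sec E F V →ₗ[ℝ] V m where
  toFun v := - ν.1 ((A.ad v).1 m)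
  map_add' v w := by
    rw [A.ad_add]
    exact (congrArg Neg.neg (ν.1.map_add ((A.ad v).1 m) ((A.ad w).1 m))).trans (neg_add _ _)
  map_smul' c v := by
    rw [A.ad_smul]
    exact (congrArg Neg.neg (ν.1.map_smul c ((A.ad v).1 m))).trans (smul_neg _ _).symm

/-- The bundle map `π : 𝔍V → 𝔇V` with `π([u]_m) = [u, ·](m)` on 1-jets. -/
def SkewAlgebroid.sharp (A : SkewAlgebroid E F V) {m : M} :
    Jet E F V m →ₗ[ℝ] Gauge E F V m where
  toFun ν := ⟨(A.sharpOp ν, A.anchor m (Jet.proj ν)), fun f u => by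
    change - ν.1 ((A.ad (u.fsmul f)).1 m) = f m • - ν.1 ((A.ad u).1 m) +
      mvfderiv 𝓘(ℝ, E) f m (A.anchor m (Jet.proj ν)) • u m
    rw [A.ad_fsmul, map_sub, ν.1.map_smul, ν.2, neg_sub, smul_neg, sub_eq_add_neg, add_comm]
    rfl⟩
  map_add' ν μ := by
    refine Subtype.ext (Prod.ext (LinearMap.ext fun u => ?_) ?_)
    · exact neg_add (ν.1 ((A.ad u).1 m)) (μ.1 ((A.ad u).1 m))
    · exact (A.anchor m).map_add (Jet.proj ν) (Jet.proj μ)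
  map_smul' c ν := by
    refine Subtype.ext (Prod.ext (LinearMap.ext fun u => ?_) ?_)
    · exact (smul_neg c (ν.1 ((A.ad u).1 m))).symm
    · exact (A.anchor m).map_smul c (Jet.proj ν)

/-- `π` on sections. -/
def SkewAlgebroid.sharpSec (A : SkewAlgebroid E F V) (ν : JetSec E F V) : GaugeSec E F V :=
  ⟨fun m => A.sharp (ν.1 m), fun u => (-(JetSec.pair ν (A.ad u))).contMDiff,
    (A.anchor.app (JetSec.proj ν)).contMDiff⟩

theorem SkewAlgebroid.sharpSec_jet (A : SkewAlgebroid E F V) (u : Sec E F V) :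
    A.sharpSec (JetSec.jet u) = A.ad u := by
  refine GaugeSec.ext (fun v => ?_) rfl
  rw [show GaugeSec.op (A.ad u) v = A.bracket u v from rfl, A.skew]
  rfl

variable [FiniteDimensional ℝ F]

/-- The bracket `[μ, ν]_π = L_{π μ} ν - L_{π ν} μ - d⟨π μ, ν⟩` on `Γ(𝔍V)`. -/
def SkewAlgebroid.jetBracket (A : SkewAlgebroid E F V) (μ ν : JetSec E F V) : JetSec E F V :=
  JetSec.lieDeriv (A.sharpSec μ) ν - JetSec.lieDeriv (A.sharpSec ν) μ -
    JetSec.jet (JetSec.pair ν (A.sharpSec μ))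

end SkewAlgebroid

section Cotangent

variable (E M) in
/-- The fibres of the cotangent bundle. -/
abbrev Cotangent : M → Type _ := fun m => TangentSpace 𝓘(ℝ, E) m →L[ℝ] Trivial M ℝ m

variable (E M) in
/-- Smooth 1-forms. -/
abbrev OneForm : Type _ := Sec E (E →L[ℝ] ℝ) (Cotangent E M)

theorem contMDiff_trivial_iff {g : M → ℝ} :
    ContMDiff 𝓘(ℝ, E) (𝓘(ℝ, E).prod 𝓘(ℝ, ℝ)) ∞ (fun m => TotalSpace.mk' ℝ (E := Trivial M ℝ) m (g m)) ↔
      ContMDiff 𝓘(ℝ, E) 𝓘(ℝ, ℝ) ∞ g :=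
  ⟨fun h m => (contMDiffAt_section m).1 (h m), fun h m => (contMDiffAt_section m).2 (h m)⟩

/-- The smooth function `α(X)`. -/
def OneForm.apply (α : OneForm E M) (X : VF E M) : SmoothFun E M :=
  ⟨fun m => α m (X m), contMDiff_trivial_iff.1 (ContMDiff.clm_bundle_apply α.contMDiff X.contMDiff)⟩

/-- The differential of a smooth function. -/
def OneForm.d (f : SmoothFun E M) : OneForm E M :=
  ⟨fun m => mvfderiv 𝓘(ℝ, E) f m, contMDiff_hom_of_apply (V := (TangentSpace 𝓘(ℝ, E) : M → Type _))
    (V' := Trivial M ℝ) (fun m => mvfderiv 𝓘(ℝ, E) f m)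
    fun X => contMDiff_trivial_iff.2 (VF.deriv X f).contMDiff⟩

variable (E M) in
/-- A bivector field, as a skew-symmetric bundle map `Π : T*M → TM`. -/
structure Bivector where
  sharp : Sec E ((E →L[ℝ] ℝ) →L[ℝ] E) (fun m : M => Cotangent E M m →L[ℝ] TangentSpace 𝓘(ℝ, E) m)
  skew : ∀ (m : M) (α β : Cotangent E M m), α (sharp m β) = - β (sharp m α)

/-- The vector field `Π(α)`. -/
def Bivector.vf (P : Bivector E M) (α : OneForm E M) : VF E M := P.sharp.app α

theorem Bivector.skew_apply (P : Bivector E M) (α β : OneForm E M) (m : M) :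
    α.apply (P.vf β) m = - β.apply (P.vf α) m := P.skew m (α m) (β m)

theorem VF.deriv_add (X : VF E M) (f g : SmoothFun E M) (m : M) :
    X.deriv (f + g) m = X.deriv f m + X.deriv g m := by
  have h := mvfderiv_add (I := 𝓘(ℝ, E)) (f.mdifferentiableAt (x := m)) (g.mdifferentiableAt (x := m))
  exact congrArg (fun L => L (X m)) h

theorem VF.deriv_mul (X : VF E M) (f g : SmoothFun E M) (m : M) :
    X.deriv (f * g) m = f m * X.deriv g m + g m * X.deriv f m := by
  have h := mvfderiv_smul (I := 𝓘(ℝ, E)) (f.mdifferentiableAt (x := m)) (g.mdifferentiableAt (x := m))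
  refine (congrArg (fun L => L (X m)) h).trans ?_
  change f m * _ + _ * g m = _
  rw [mul_comm _ (g m)]
  rfl

theorem VF.deriv_smul (X : VF E M) (c : ℝ) (f : SmoothFun E M) (m : M) :
    X.deriv (c • f) m = c * X.deriv f m := by
  have h := mvfderiv_smul (I := 𝓘(ℝ, E)) (a := fun _ => c) (x := m) mdifferentiableAt_const
    (f.mdifferentiableAt (x := m))
  rw [mvfderiv_const] at h
  refine (congrArg (fun L => L (X m)) h).trans ?_
  rw [add_apply, smul_apply, smul_eq_mul]
  simp only [ContinuousLinearMap.smulRight_apply, zero_apply, zero_smul, add_zero]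
  rfl

/-- The value at `m` of `Πα(β(X)) - β([Πα, X]) - Πβ(α(X)) + α([Πβ, X]) - X(β(Πα))`, that is, of
`[α, β] = L_{Πα} β - L_{Πβ} α - d(Π(α, β))` on `X`. -/
def Bivector.bracketFun (P : Bivector E M) (α β : OneForm E M) (X : VF E M) : SmoothFun E M :=
  (P.vf α).deriv (β.apply X) - β.apply ((P.vf α).bracket X) - (P.vf β).deriv (α.apply X) +
    α.apply ((P.vf β).bracket X) - X.deriv (β.apply (P.vf α))

theorem OneForm.apply_add (α : OneForm E M) (X Y : VF E M) :
    α.apply (X + Y) = α.apply X + α.apply Y :=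
  ContMDiffMap.ext fun m => (α m).map_add (X m) (Y m)

theorem OneForm.apply_smul (α : OneForm E M) (c : ℝ) (X : VF E M) :
    α.apply (c • X) = c • α.apply X :=
  ContMDiffMap.ext fun m => (α m).map_smul c (X m)

theorem OneForm.apply_fsmul (α : OneForm E M) (f : SmoothFun E M) (X : VF E M) :
    α.apply (X.fsmul f) = f * α.apply X :=
  ContMDiffMap.ext fun m => (α m).map_smul (f m) (X m)

theorem OneForm.fsmul_apply (α : OneForm E M) (f : SmoothFun E M) (X : VF E M) :
    OneForm.apply (α.fsmul f) X = f * α.apply X := rfl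

theorem VF.fsmul_deriv (X : VF E M) (f g : SmoothFun E M) (m : M) :
    VF.deriv (X.fsmul f) g m = f m * X.deriv g m :=
  (mvfderiv 𝓘(ℝ, E) g m).map_smul (f m) (X m)

theorem VF.bracket_fsmul_left (f : SmoothFun E M) (X Y : VF E M) :
    VF.bracket (X.fsmul f) Y = (X.bracket Y).fsmul f - X.fsmul (Y.deriv f) := by
  rw [VF.bracket_swap, VF.bracket_fsmul_right, VF.bracket_swap X]
  refine Sec.ext' fun m => ?_
  change -(f m • Y.bracket X m + Y.deriv f m • X m) = f m • -(Y.bracket X m) - Y.deriv f m • X m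
  rw [smul_neg, neg_add, sub_eq_add_neg]

theorem Bivector.bracketFun_apply (P : Bivector E M) (α β : OneForm E M) (X : VF E M) (m : M) :
    P.bracketFun α β X m = (P.vf α).deriv (β.apply X) m - β.apply ((P.vf α).bracket X) m -
      (P.vf β).deriv (α.apply X) m + α.apply ((P.vf β).bracket X) m -
      X.deriv (β.apply (P.vf α)) m := rfl

/-- The bracket `[α, β] = L_{Πα} β - L_{Πβ} α - d(Π(α, β))` of 1-forms at the point `m`. -/
def Bivector.bracketAt (P : Bivector E M) (α β : OneForm E M) (m : M) :
    TangentSpace 𝓘(ℝ, E) m →ₗ[ℝ] ℝ :=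
  tensorialLift (E := E) (F := E) (V := (TangentSpace 𝓘(ℝ, E) : M → Type _)) m
    { toFun := fun X => P.bracketFun α β X m
      map_add' := fun X Y => by
        have hadd (f g : SmoothFun E M) : (f + g) m = f m + g m := rfl
        have h' (f : SmoothFun E M) : VF.deriv (X + Y) f m = VF.deriv X f m + VF.deriv Y f m :=
          (mvfderiv 𝓘(ℝ, E) f m).map_add (X m) (Y m)
        simp only [P.bracketFun_apply, VF.bracket_add_right, OneForm.apply_add, VF.deriv_add, h', hadd]
        ring
      map_smul' := fun c X => by
        have hsmul (f : SmoothFun E M) : (c • f) m = c * f m := rfl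
        have h' (f : SmoothFun E M) : VF.deriv (c • X) f m = c * VF.deriv X f m :=
          (mvfderiv 𝓘(ℝ, E) f m).map_smul c (X m)
        simp only [P.bracketFun_apply, VF.bracket_smul_right, OneForm.apply_smul, VF.deriv_smul, h',
          hsmul, RingHom.id_apply, smul_eq_mul]
        ring }
    (fun f X => by
      have h (γ : OneForm E M) (Y : VF E M) : γ.apply (Y.bracket (X.fsmul f)) m =
          f m * γ.apply (Y.bracket X) m + Y.deriv f m * γ.apply X m := by
        rw [VF.bracket_fsmul_right, OneForm.apply_add, OneForm.apply_fsmul, OneForm.apply_fsmul]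
        rfl
      change P.bracketFun α β (X.fsmul f) m = f m • P.bracketFun α β X m
      simp only [P.bracketFun_apply, h, OneForm.apply_fsmul, VF.deriv_mul, VF.fsmul_deriv,
        smul_eq_mul]
      ring)

theorem Bivector.bracketAt_apply (P : Bivector E M) (α β : OneForm E M) (m : M) (X : VF E M) :
    P.bracketAt α β m (X m) = P.bracketFun α β X m :=
  tensorialLift_apply (E := E) (F := E) (V := (TangentSpace 𝓘(ℝ, E) : M → Type _)) m _ _ X

/-- The bracket `[α, β] = L_{Πα} β - L_{Πβ} α - d(Π(α, β))` of 1-forms. -/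
def Bivector.bracket (P : Bivector E M) (α β : OneForm E M) : OneForm E M :=
  have : ∀ m : M, FiniteDimensional ℝ (TangentSpace 𝓘(ℝ, E) m) := fun _ =>
    inferInstanceAs (FiniteDimensional ℝ E)
  have : ∀ m : M, T2Space (TangentSpace 𝓘(ℝ, E) m) := fun _ => inferInstanceAs (T2Space E)
  ⟨fun m => LinearMap.toContinuousLinearMap (P.bracketAt α β m),
    contMDiff_hom_of_apply (V := (TangentSpace 𝓘(ℝ, E) : M → Type _)) (V' := Trivial M ℝ)
      (fun m => LinearMap.toContinuousLinearMap (P.bracketAt α β m)) fun X => by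
      refine contMDiff_trivial_iff.2 ((P.bracketFun α β X).contMDiff.congr fun m => ?_)
      exact P.bracketAt_apply α β m X⟩

theorem Bivector.bracket_apply (P : Bivector E M) (α β : OneForm E M) (X : VF E M) (m : M) :
    P.bracket α β m (X m) = P.bracketFun α β X m := P.bracketAt_apply α β m X

theorem OneForm.ext {α β : OneForm E M} (h : ∀ (X : VF E M) m, α m (X m) = β m (X m)) :
    α = β := by
  refine Sec.ext' fun m => ContinuousLinearMap.ext fun v => ?_
  obtain ⟨X, rfl⟩ := exists_sec_apply_eq (E := E) (F := E)
    (V := (TangentSpace 𝓘(ℝ, E) : M → Type _)) m v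
  exact h X m

/-- The bracket of 1-forms and the anchor `Π` on the cotangent bundle. -/
def Bivector.algebroid (P : Bivector E M) : SkewAlgebroid E (E →L[ℝ] ℝ) (Cotangent E M) where
  anchor := P.sharp
  bracket := P.bracket
  skew α β := OneForm.ext fun X m => by
    change _ = - (P.bracket β α m (X m))
    rw [P.bracket_apply, P.bracket_apply, P.bracketFun_apply, P.bracketFun_apply]
    have h : OneForm.apply β (P.vf α) = (-1 : ℝ) • OneForm.apply α (P.vf β) := ContMDiffMap.ext fun p => by
      rw [P.skew_apply]
      exact (neg_one_mul _).symm
    rw [h, VF.deriv_smul]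
    ring
  add_right α β γ := OneForm.ext fun X m => by
    change _ = P.bracket α β m (X m) + P.bracket α γ m (X m)
    have h1 (Y : VF E M) : OneForm.apply (β + γ) Y = OneForm.apply β Y + OneForm.apply γ Y := rfl
    have h2 : P.vf (β + γ) = P.vf β + P.vf γ :=
      Sec.ext' fun p => (P.sharp p).map_add (β p) (γ p)
    have h3 (f : SmoothFun E M) : VF.deriv (P.vf β + P.vf γ) f m =
        (P.vf β).deriv f m + (P.vf γ).deriv f m :=
      (mvfderiv 𝓘(ℝ, E) f m).map_add (P.vf β m) (P.vf γ m)
    have h4 (f g : SmoothFun E M) : (f + g) m = f m + g m := rfl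
    simp only [P.bracket_apply, P.bracketFun_apply, h1, h2, h3, VF.deriv_add,
      VF.bracket_add_left, OneForm.apply_add, h4]
    ring
  smul_right c α β := OneForm.ext fun X m => by
    change _ = c * P.bracket α β m (X m)
    have h1 (Y : VF E M) : OneForm.apply (c • β) Y = c • OneForm.apply β Y := rfl
    have h2 : P.vf (c • β) = c • P.vf β :=
      Sec.ext' fun p => (P.sharp p).map_smul c (β p)
    have h3 (f : SmoothFun E M) : VF.deriv (c • P.vf β) f m = c * (P.vf β).deriv f m :=
      (mvfderiv 𝓘(ℝ, E) f m).map_smul c (P.vf β m)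
    have h4 (f : SmoothFun E M) : (c • f) m = c * f m := rfl
    simp only [P.bracket_apply, P.bracketFun_apply, h1, h2, h3, VF.deriv_smul,
      VF.bracket_smul_left, OneForm.apply_smul, h4]
    ring
  leibniz f α β := OneForm.ext fun X m => by
    change _ = f m * P.bracket α β m (X m) + (P.vf α).deriv f m * OneForm.apply β X m
    have h2 : P.vf (β.fsmul f) = (P.vf β).fsmul f :=
      Sec.ext' fun p => (P.sharp p).map_smul (f p) (β p)
    have h4 (f g : SmoothFun E M) : (f * g) m = f m * g m := rfl
    have h5 : OneForm.apply α (VF.bracket ((P.vf β).fsmul f) X) m =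
        f m * OneForm.apply α ((P.vf β).bracket X) m + X.deriv f m * OneForm.apply β (P.vf α) m := by
      have h6 : X.deriv f m * OneForm.apply α (P.vf β) m = -(X.deriv f m * OneForm.apply β (P.vf α) m) := by
        rw [P.skew_apply]; ring
      rw [VF.bracket_fsmul_left, ← neg_eq_iff_eq_neg.2 h6, ← sub_eq_add_neg]
      change (α m) (f m • (P.vf β).bracket X m - X.deriv f m • P.vf β m) = _
      rw [map_sub, map_smul, map_smul]
      rfl
    simp only [P.bracket_apply, P.bracketFun_apply, OneForm.fsmul_apply, h2, h4, h5, VF.deriv_mul,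
      VF.fsmul_deriv]
    ring

end Cotangent

section Poisson

variable (E M) in
/-- A Poisson structure: a bivector field `Π` whose bracket `{f, g} = dg(Π df)` satisfies the
Jacobi identity. -/
structure PoissonStructure extends Bivector E M where
  jacobi : ∀ f g h : SmoothFun E M,
    let br (a b : SmoothFun E M) : SmoothFun E M :=
      (OneForm.d b).apply (toBivector.vf (OneForm.d a))
    br f (br g h) + br g (br h f) + br h (br f g) = 0

variable (E M) in
/-- A symplectic form: a closed nondegenerate 2-form `ω`, given as the bundle map
`X ↦ ω(X, ·)`. -/
structure SymplecticForm where
  flat : Sec E (E →L[ℝ] (E →L[ℝ] ℝ)) (fun m : M => TangentSpace 𝓘(ℝ, E) m →L[ℝ] Cotangent E M m)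
  alternating : ∀ (m : M) (x : TangentSpace 𝓘(ℝ, E) m), flat m x x = 0
  nondegenerate : ∀ (m : M) (x : TangentSpace 𝓘(ℝ, E) m), (∀ y, flat m x y = 0) → x = 0
  closed : ∀ X Y Z : VF E M,
    let w (A B : VF E M) : SmoothFun E M := OneForm.apply (flat.app A) B
    X.deriv (w Y Z) - Y.deriv (w X Z) + Z.deriv (w X Y)
      - w (X.bracket Y) Z + w (X.bracket Z) Y - w (Y.bracket Z) X = 0

end Poisson

section Algebroid

universe w w'

variable (E M) in
/-- The data of a Lie algebroid over `M`: fibres, the space of smooth sections among all families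
of elements of the fibres, the anchor, and the bracket of smooth sections. -/
structure AlgebroidData where
  Fiber : M → Type w
  [groupInst : ∀ m, AddCommGroup (Fiber m)]
  [moduleInst : ∀ m, Module ℝ (Fiber m)]
  sections : Submodule ℝ (∀ m, Fiber m)
  anchor : ∀ m, Fiber m →ₗ[ℝ] TangentSpace 𝓘(ℝ, E) m
  bracket : sections → sections → sections

attribute [instance] AlgebroidData.groupInst AlgebroidData.moduleInst

/-- The data form a Lie algebroid: a smooth vector bundle (the smooth sections are a sheaf of
modules over the smooth functions, with local frames consisting of bases of the fibres), a smooth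
anchor, and a Lie bracket on smooth sections that satisfies the Leibniz rule and that the anchor
maps to the Lie bracket of vector fields. -/
structure AlgebroidData.IsLieAlgebroid (A : AlgebroidData.{w} E M) : Prop where
  fsmul_mem : ∀ (f : SmoothFun E M), ∀ s ∈ A.sections, (fun m => f m • s m) ∈ A.sections
  mem_of_local : ∀ s : (∀ m, A.Fiber m),
    (∀ m₀, ∃ t ∈ A.sections, ∀ᶠ m in 𝓝 m₀, s m = t m) → s ∈ A.sections
  exists_frame : ∀ m₀ : M, ∃ (n : ℕ) (e : Fin n → A.sections),
    (∀ᶠ m in 𝓝 m₀, LinearIndependent ℝ (fun i => (e i).1 m) ∧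
      Submodule.span ℝ (Set.range fun i => (e i).1 m) = ⊤) ∧
    ∀ s ∈ A.sections, ∃ c : Fin n → SmoothFun E M,
      ∀ᶠ m in 𝓝 m₀, s m = ∑ i, c i m • (e i).1 m
  anchor_smooth : ∀ s ∈ A.sections, ContMDiff 𝓘(ℝ, E) (𝓘(ℝ, E).prod 𝓘(ℝ, E)) ∞
    (fun m => TotalSpace.mk' E (E := (TangentSpace 𝓘(ℝ, E) : M → Type _)) m (A.anchor m (s m)))
  bracket_add : ∀ r s t, A.bracket r (s + t) = A.bracket r s + A.bracket r t
  bracket_smul : ∀ (c : ℝ) s t, A.bracket s (c • t) = c • A.bracket s t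
  bracket_skew : ∀ s t, A.bracket s t = - A.bracket t s
  jacobi : ∀ r s t, A.bracket r (A.bracket s t) + A.bracket s (A.bracket t r) +
    A.bracket t (A.bracket r s) = 0
  leibniz : ∀ (f : SmoothFun E M) (s t t' : A.sections), (∀ m, t'.1 m = f m • t.1 m) →
    ∀ m, (A.bracket s t').1 m =
      f m • (A.bracket s t).1 m + mvfderiv 𝓘(ℝ, E) f m (A.anchor m (s.1 m)) • t.1 m
  anchor_bracket : ∀ (s t : A.sections) (m : M), A.anchor m ((A.bracket s t).1 m) =
    mlieBracket 𝓘(ℝ, E) (fun p => A.anchor p (s.1 p)) (fun p => A.anchor p (t.1 p)) m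

/-- The family of linear maps `φ` is a morphism of Lie algebroids over the identity of `M`:
a smooth bundle map that preserves anchors and brackets. -/
structure AlgebroidData.IsMorphism (A : AlgebroidData.{w} E M) (B : AlgebroidData.{w'} E M)
    (φ : ∀ m, A.Fiber m →ₗ[ℝ] B.Fiber m) : Prop where
  map_mem : ∀ s ∈ A.sections, (fun m => φ m (s m)) ∈ B.sections
  map_anchor : ∀ (m : M) (v : A.Fiber m), B.anchor m (φ m v) = A.anchor m v
  map_bracket : ∀ (s t : A.sections) (m : M), φ m ((A.bracket s t).1 m) =
    (B.bracket ⟨fun p => φ p (s.1 p), map_mem s.1 s.2⟩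
      ⟨fun p => φ p (t.1 p), map_mem t.1 t.2⟩).1 m

/-- `φ` is an isomorphism of Lie algebroids: a morphism with an inverse that is a morphism. -/
def AlgebroidData.IsIsomorphism (A : AlgebroidData.{w} E M) (B : AlgebroidData.{w'} E M)
    (φ : ∀ m, A.Fiber m →ₗ[ℝ] B.Fiber m) : Prop :=
  A.IsMorphism B φ ∧ ∃ ψ : ∀ m, B.Fiber m →ₗ[ℝ] A.Fiber m, B.IsMorphism A ψ ∧
    ∀ m, ψ m ∘ₗ φ m = LinearMap.id ∧ φ m ∘ₗ ψ m = LinearMap.id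

variable (E F V) in
/-- The gauge algebroid `𝔇V`. -/
def gaugeAlgebroid : AlgebroidData E M where
  Fiber m := Gauge E F V m
  sections := GaugeSec E F V
  anchor _ := Gauge.anchor
  bracket := GaugeSec.bracket

/-- The jet algebroid `𝔍V` of an algebroid `V`, with the bracket `[·, ·]_π` and the anchor given
by that of `𝔇V` and `π`. -/
def jetAlgebroid [FiniteDimensional ℝ F] [∀ m, IsTopologicalAddGroup (V m)]
    [∀ m, ContinuousSMul ℝ (V m)] (A : SkewAlgebroid E F V) : AlgebroidData E M where
  Fiber m := Jet E F V m
  sections := JetSec E F V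
  anchor _ := Gauge.anchor ∘ₗ A.sharp
  bracket := A.jetBracket

variable (E M) in
/-- The gauge algebroid `𝔇(TM)` of the tangent bundle. -/
abbrev tangentGauge : AlgebroidData E M :=
  gaugeAlgebroid E E (TangentSpace 𝓘(ℝ, E) : M → Type _)

/-- The jet algebroid `𝔍(T*M)` of the cotangent Lie algebroid of a Poisson manifold. -/
abbrev PoissonStructure.cotangentJet (P : PoissonStructure E M) : AlgebroidData E M :=
  jetAlgebroid P.toBivector.algebroid

end Algebroid

section Lift

variable (E M) in
/-- The fibre of `Hom(TM, T*M)` at `m`. -/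
abbrev HomTangentCotangent (m : M) : Type _ := TangentSpace 𝓘(ℝ, E) m →ₗ[ℝ] Cotangent E M m

variable (E M) in
/-- The fibre of `𝔍(T*M)` at `m`. -/
abbrev CotangentJet (m : M) : Type _ := Jet E (E →L[ℝ] ℝ) (Cotangent E M) m

variable (E M) in
/-- The fibre of `𝔇(TM)` at `m`. -/
abbrev TangentGauge (m : M) : Type _ := Gauge E E (TangentSpace 𝓘(ℝ, E) : M → Type _) m

variable [T2Space M]

/-- `φ : 𝔍(T*M) → 𝔇(TM)` is a morphism of Lie algebroids which is `-1 ⊗ Π` on `Hom(TM, T*M)`,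
which lifts `Π : T*M → TM`, and which maps the 1-jet of `α` at `m` to the operator
`X ↦ [Π α, X](m)`. -/
structure PoissonStructure.IsLift (P : PoissonStructure E M)
    (φ : ∀ m, CotangentJet E M m →ₗ[ℝ] TangentGauge E M m) : Prop where
  isMorphism : P.cotangentJet.IsMorphism (tangentGauge E M) φ
  left_square : ∀ (m : M) (y : HomTangentCotangent E M m),
    φ m (Jet.incl y) = Gauge.ofEnd (-((P.sharp m).toLinearMap ∘ₗ y))
  right_square : ∀ (m : M) (ν : CotangentJet E M m),
    Gauge.anchor (φ m ν) = P.sharp m (Jet.proj ν)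
  map_jet : ∀ (α : OneForm E M) (X : VF E M) (m : M),
    (φ m ((JetSec.jet α).1 m)).1.1 X = (P.vf α).bracket X m

end Lift

end Poisson

end Sections

end

/-! The Leibniz rule makes every identity to be proved a tensorial one. Let a bundle carry an anchor
ρ and a skew bracket obeying Leibniz. The defect ρ[s,t] − [ρs,ρt] is then linear over smooth
functions. Once it vanishes, the Jacobiator is linear too. For an anchor-preserving bundle map φ, so
is φ[s,t] − [φs,φt]. A tensor vanishes if it does so on sections whose values exhaust each fibre
(`AlgebroidData.IsSkew.isLieAlgebroid`, `AlgebroidData.IsSkew.isMorphism`).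

On T*M the exact forms suffice: [df,dg] = d{f,g} (`Bivector.bracket_d_d`), so everything reduces to
the Jacobi identity for functions. On 𝔍V the jet prolongations suffice: every fibre element is a
1-jet (`Jet.exists_jet_eq`) and [𝕕u,𝕕v]_π = 𝕕[u,v] (`SkewAlgebroid.jetBracket_jet`), so 𝔍V inherits
its axioms from V. On 𝔇V the bracket is a commutator and the axioms hold directly. Local frames of
𝔇V and 𝔍V come from their exact sequences: a frame of the quotient is lifted and joined to a frame
of the kernel (`HasFrame.extension`).

The lift exists because [Πα,X] + Π(L_X α) is tensorial in α (it is −(L_X Π)α), while L_X α at m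
depends only on [α]_m, since L_X is a section of 𝔇(T*M). Hence [Πα,X](m) is a function of the 1-jet
(`Bivector.bracket_vf_eq`). The same formula shows that the lift is smooth and that it equals −Π∘y
on 𝕖(y), where the tensorial term drops out. On jets, compatibility with brackets says that Π
preserves brackets and that ad is a homomorphism on vector fields.

If Π is bijective, the five lemma makes the lift bijective on fibres, and Cramer's rule in local
frames makes its inverse smooth (`HasFrame.inverse_mem_local`). For a symplectic form, Π is the
inverse of x ↦ ω(x,·), and dω evaluated on three Hamiltonian fields is the Jacobiator of the Poisson
bracket. -/

noncomputable section

/-! ### Local frames, tensoriality and smooth inverses -/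

section Frames

variable {E : Type*} [NormedAddCommGroup E] [NormedSpace ℝ E] [FiniteDimensional ℝ E]
  {M : Type*} [TopologicalSpace M] [ChartedSpace E M]

variable (E) in
/-- The families in `S` have a local frame near `m₀`. -/
def HasFrame {Fib : M → Type*} [∀ m, AddCommGroup (Fib m)] [∀ m, Module ℝ (Fib m)]
    (S : Submodule ℝ (∀ m, Fib m)) (m₀ : M) : Prop :=
  ∃ (n : ℕ) (e : Fin n → S),
    (∀ᶠ m in 𝓝 m₀, LinearIndependent ℝ (fun i => (e i).1 m) ∧
      Submodule.span ℝ (Set.range fun i => (e i).1 m) = ⊤) ∧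
    ∀ s ∈ S, ∃ c : Fin n → SmoothFun E M, ∀ᶠ m in 𝓝 m₀, s m = ∑ i, c i m • (e i).1 m

variable (E) in
/-- `S` is closed under multiplication by smooth functions. -/
def FSMulClosed {Fib : M → Type*} [∀ m, AddCommGroup (Fib m)] [∀ m, Module ℝ (Fib m)]
    (S : Submodule ℝ (∀ m, Fib m)) : Prop :=
  ∀ (f : SmoothFun E M), ∀ s ∈ S, (fun m => f m • s m) ∈ S

theorem hasFrame_of_fintype {Fib : M → Type*} [∀ m, AddCommGroup (Fib m)] [∀ m, Module ℝ (Fib m)]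
    {S : Submodule ℝ (∀ m, Fib m)} {m₀ : M} {ι : Type*} [Fintype ι] (e : ι → S)
    (h : ∀ᶠ m in 𝓝 m₀, LinearIndependent ℝ (fun i => (e i).1 m) ∧
      Submodule.span ℝ (Set.range fun i => (e i).1 m) = ⊤)
    (h' : ∀ s ∈ S, ∃ c : ι → SmoothFun E M, ∀ᶠ m in 𝓝 m₀, s m = ∑ i, c i m • (e i).1 m) :
    HasFrame E S m₀ := by
  let φ := Fintype.equivFin ι
  refine ⟨Fintype.card ι, e ∘ φ.symm, ?_, fun s hs => ?_⟩
  · filter_upwards [h] with m hm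
    refine ⟨hm.1.comp _ φ.symm.injective, ?_⟩
    rw [← hm.2]
    exact congrArg _ (φ.symm.surjective.range_comp fun i => (e i).1 m)
  · obtain ⟨c, hc⟩ := h' s hs
    refine ⟨c ∘ φ.symm, ?_⟩
    filter_upwards [hc] with m hm
    rw [hm]
    exact (φ.symm.sum_comp fun i => c i m • (e i).1 m).symm

section Bump

variable [T2Space M]

theorem exists_bump {m : M} {U : Set M} (hU : U ∈ 𝓝 m) [IsManifold 𝓘(ℝ, E) ∞ M] :
    ∃ f : SmoothFun E M, (∀ᶠ p in 𝓝 m, f p = 1) ∧ ∀ p, p ∉ U → f p = 0 := by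
  obtain ⟨ψ, -, hψ⟩ := (SmoothBumpFunction.nhds_basis_tsupport (I := 𝓘(ℝ, E)) m).mem_iff.1 hU
  exact ⟨⟨ψ, ψ.contMDiff⟩, ψ.eventuallyEq_one,
    fun p hp => image_eq_zero_of_notMem_tsupport fun h => hp (hψ h)⟩

theorem exists_local_inv {m : M} [IsManifold 𝓘(ℝ, E) ∞ M] (d : SmoothFun E M) (hd : d m ≠ 0) :
    ∃ g : SmoothFun E M, ∀ᶠ p in 𝓝 m, g p * d p = 1 := by
  have hU : IsOpen {p | d p ≠ 0} := isOpen_ne_fun d.contMDiff.continuous continuous_const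
  obtain ⟨g, hg⟩ := exists_fun_eventuallyEq hU hd (fun p => (d p)⁻¹) (fun p hp =>
    ((contDiffAt_inv ℝ hp).contMDiffAt.comp p d.contMDiff.contMDiffAt).contMDiffWithinAt)
  refine ⟨g, ?_⟩
  filter_upwards [hg, hU.mem_nhds hd] with p hp hp'
  rw [hp, inv_mul_cancel₀ hp']

end Bump

section Abstract

variable [T2Space M] [IsManifold 𝓘(ℝ, E) ∞ M]
  {Fib : M → Type*} [∀ m, AddCommGroup (Fib m)] [∀ m, Module ℝ (Fib m)]
  {S : Submodule ℝ (∀ m, Fib m)}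

/-- Multiplication of a family by a smooth function. -/
def FSMulClosed.smul (hS : FSMulClosed E S) (f : SmoothFun E M) (s : S) : S :=
  ⟨fun m => f m • s.1 m, hS f s.1 s.2⟩

/-- Expand `s` in the frame near `m`. Independence at `m` forces the coefficients to vanish there,
and a cutoff equal to 1 at `m` turns the local expansion into an identity of global sections, to
which `T` can be applied. -/
theorem HasFrame.tensorial {m : M} (h : HasFrame E S m) (hS : FSMulClosed E S)
    {W : Type*} [AddCommGroup W] [Module ℝ W] (T : S →ₗ[ℝ] W)
    (hT : ∀ f s, T (hS.smul f s) = f m • T s) {s : S} (hs : s.1 m = 0) : T s = 0 := by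
  obtain ⟨n, e, he, hc⟩ := h
  obtain ⟨c, hc⟩ := hc s.1 s.2
  obtain ⟨f, hf, hf'⟩ := exists_bump (E := E) hc
  have h1 : hS.smul f s = hS.smul f (∑ i, hS.smul (c i) (e i)) := by
    refine Subtype.ext (funext fun p => ?_)
    change f p • s.1 p = f p • (∑ i, hS.smul (c i) (e i) : S).1 p
    by_cases hp : s.1 p = ∑ i, c i p • (e i).1 p
    · rw [hp, Submodule.coe_sum, Finset.sum_apply]
      rfl
    · rw [hf' p hp, zero_smul, zero_smul]
  have h2 := congrArg T h1
  rw [hT, hT, hf.self_of_nhds, one_smul, one_smul, map_sum] at h2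
  rw [h2]
  refine Finset.sum_eq_zero fun i _ => ?_
  have h3 := hc.self_of_nhds
  rw [hs] at h3
  rw [hT, Fintype.linearIndependent_iff.1 he.self_of_nhds.1 (fun i => c i m) h3.symm i, zero_smul]

theorem HasFrame.tensorial_eq {m : M} (h : HasFrame E S m) (hS : FSMulClosed E S)
    {W : Type*} [AddCommGroup W] [Module ℝ W] (T : S →ₗ[ℝ] W)
    (hT : ∀ f s, T (hS.smul f s) = f m • T s) {s t : S} (hs : s.1 m = t.1 m) : T s = T t := by
  rw [← sub_eq_zero, ← map_sub]
  exact h.tensorial hS T hT (sub_eq_zero.2 hs)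

end Abstract

section Extension

variable {K G Q : M → Type*} [∀ m, AddCommGroup (K m)] [∀ m, Module ℝ (K m)]
  [∀ m, AddCommGroup (G m)] [∀ m, Module ℝ (G m)] [∀ m, AddCommGroup (Q m)] [∀ m, Module ℝ (Q m)]
  {SK : Submodule ℝ (∀ m, K m)} {SG : Submodule ℝ (∀ m, G m)} {SQ : Submodule ℝ (∀ m, Q m)}

/-- For an exact sequence 0 → K → G → Q → 0, the image of a frame of K together with lifts of a
frame of Q is a frame of G. Lifts and preimages of sections are required only near `m₀`, which is
what cutoffs and local connections can supply. -/
theorem HasFrame.extension {m₀ : M} (hK : HasFrame E SK m₀) (hQ : HasFrame E SQ m₀)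
    (hG : FSMulClosed E SG)
    (i : ∀ m, K m →ₗ[ℝ] G m) (p : ∀ m, G m →ₗ[ℝ] Q m) (hi : ∀ m, Function.Injective (i m))
    (hip : ∀ m v, p m v = 0 ↔ ∃ k, i m k = v)
    (hiS : ∀ s ∈ SK, (fun m => i m (s m)) ∈ SG) (hpS : ∀ s ∈ SG, (fun m => p m (s m)) ∈ SQ)
    (hp : ∀ q ∈ SQ, ∃ s ∈ SG, ∀ᶠ m in 𝓝 m₀, p m (s m) = q m)
    (hker : ∀ s ∈ SG, (∀ᶠ m in 𝓝 m₀, p m (s m) = 0) → ∃ k ∈ SK, ∀ᶠ m in 𝓝 m₀, i m (k m) = s m) :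
    HasFrame E SG m₀ := by
  obtain ⟨a, k, hk, hkc⟩ := hK
  obtain ⟨b, q, hq, hqc⟩ := hQ
  choose g hgS hg using fun j => hp (q j).1 (q j).2
  have hpi (m) (x : K m) : p m (i m x) = 0 := (hip m _).2 ⟨x, rfl⟩
  refine hasFrame_of_fintype (ι := Fin a ⊕ Fin b)
    (Sum.elim (fun j => ⟨_, hiS (k j).1 (k j).2⟩) (fun j => ⟨g j, hgS j⟩)) ?_ ?_
  · filter_upwards [hk, hq, eventually_all.2 hg] with m hkm hqm hgm
    constructor
    · rw [Fintype.linearIndependent_iff]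
      intro c hc
      rw [Fintype.sum_sum_type] at hc
      simp only [Sum.elim_inl, Sum.elim_inr] at hc
      have h1 : ∀ j, c (Sum.inr j) = 0 := by
        have := congrArg (p m) hc
        simp only [map_add, map_sum, map_smul, hpi, hgm, smul_zero, Finset.sum_const_zero,
          zero_add, map_zero] at this
        exact Fintype.linearIndependent_iff.1 hqm.1 _ this
      simp only [h1, zero_smul, Finset.sum_const_zero, add_zero] at hc
      have h2 : i m (∑ j, c (Sum.inl j) • (k j).1 m) = i m 0 := by
        simpa only [map_sum, map_smul, map_zero] using hc
      have h3 := Fintype.linearIndependent_iff.1 hkm.1 _ (hi m h2)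
      rintro (j | j)
      · exact h3 j
      · exact h1 j
    · refine eq_top_iff.2 fun v _ => ?_
      have hv : p m v ∈ Submodule.span ℝ (Set.range fun j => (q j).1 m) := by
        rw [hqm.2]; trivial
      obtain ⟨c, hc⟩ := (Submodule.mem_span_range_iff_exists_fun ℝ).1 hv
      obtain ⟨x, hx⟩ := (hip m (v - ∑ j, c j • g j m)).1 (by
        simp only [map_sub, map_sum, map_smul, hgm, hc, sub_self])
      have hx' : x ∈ Submodule.span ℝ (Set.range fun j => (k j).1 m) := by
        rw [hkm.2]; trivial
      obtain ⟨d, hd⟩ := (Submodule.mem_span_range_iff_exists_fun ℝ).1 hx'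
      refine (Submodule.mem_span_range_iff_exists_fun ℝ).2 ⟨Sum.elim d c, ?_⟩
      rw [Fintype.sum_sum_type]
      simp only [Sum.elim_inl, Sum.elim_inr]
      rw [eq_comm, ← sub_eq_iff_eq_add, ← hx, ← hd]
      simp only [map_sum, map_smul]
  · intro s hs
    obtain ⟨c, hc⟩ := hqc _ (hpS s hs)
    have hG' (f : Fin b → SmoothFun E M) : (fun m => ∑ j, f j m • g j m) ∈ SG := by
      have : (fun m => ∑ j, f j m • g j m) = ∑ j, fun m => f j m • g j m := by
        funext m; simp
      rw [this]
      exact SG.sum_mem fun j _ => hG (f j) _ (hgS j)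
    -- Subtracting the combination of lifted frame sections with the Q-coordinates of `s` leaves a
    -- section killed by `p` near `m₀`, hence one that comes from K there.
    obtain ⟨x, hx, hx'⟩ := hker _ (SG.sub_mem hs (hG' c)) (by
      filter_upwards [hc, eventually_all.2 hg] with m hcm hgm
      simp only [Pi.sub_apply, map_sub, map_sum, map_smul, hgm, hcm, sub_self])
    obtain ⟨d, hd⟩ := hkc x hx
    refine ⟨Sum.elim d c, ?_⟩
    filter_upwards [hx', hd] with m hm hdm
    rw [Fintype.sum_sum_type]
    simp only [Sum.elim_inl, Sum.elim_inr]
    rw [← sub_eq_iff_eq_add]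
    refine hm.symm.trans ?_
    rw [hdm]
    simp only [map_sum, map_smul]

end Extension

section Inverse

variable [T2Space M] [IsManifold 𝓘(ℝ, E) ∞ M] {A B : M → Type*}
  [∀ m, AddCommGroup (A m)] [∀ m, Module ℝ (A m)]
  [∀ m, AddCommGroup (B m)] [∀ m, Module ℝ (B m)]
  {SA : Submodule ℝ (∀ m, A m)} {SB : Submodule ℝ (∀ m, B m)}

/-- In frames `φ` is a square matrix of smooth functions, invertible at `m₀` and hence nearby.
Cramer's rule writes the coordinates of the preimage as smooth functions. -/
theorem HasFrame.inverse_mem_local {m₀ : M} (hA : HasFrame E SA m₀) (hB : HasFrame E SB m₀)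
    (hAf : FSMulClosed E SA) (φ : ∀ m, A m ≃ₗ[ℝ] B m)
    (hφ : ∀ s ∈ SA, (fun m => φ m (s m)) ∈ SB) {t : ∀ m, B m} (ht : t ∈ SB) :
    ∃ s ∈ SA, ∀ᶠ m in 𝓝 m₀, (φ m).symm (t m) = s m := by
  obtain ⟨n, e, he, -⟩ := hA
  obtain ⟨k, f, hf, hfc⟩ := hB
  have hnk : n = k := by
    have h1 := Module.finrank_eq_card_basis
      (Module.Basis.mk he.self_of_nhds.1 he.self_of_nhds.2.ge)
    have h2 := Module.finrank_eq_card_basis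
      (Module.Basis.mk hf.self_of_nhds.1 hf.self_of_nhds.2.ge)
    have h3 := (φ m₀).finrank_eq
    simp only [Fintype.card_fin] at h1 h2
    omega
  subst hnk
  choose a ha using fun i => hfc _ (hφ (e i).1 (e i).2)
  obtain ⟨c, hc⟩ := hfc t ht
  let a' : Matrix (Fin n) (Fin n) (SmoothFun E M) := Matrix.of a
  let ev (m : M) : SmoothFun E M →+* ℝ :=
    { toFun := fun f => f m, map_one' := rfl, map_mul' := fun _ _ => rfl, map_zero' := rfl,
      map_add' := fun _ _ => rfl }
  -- A nonzero left null vector of the matrix at `m₀` would give a nonzero vector killed by `φ m₀`.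
  have hdet : a'.det m₀ ≠ 0 := by
    intro h0
    have h1 : (a'.map (ev m₀)).det = 0 := by
      rw [← h0]
      exact (RingHom.map_det (ev m₀) a').symm
    obtain ⟨v, hv, hv'⟩ := Matrix.exists_vecMul_eq_zero_iff.2 h1
    apply hv
    have h2 : φ m₀ (∑ i, v i • (e i).1 m₀) = φ m₀ 0 := by
      rw [map_sum, map_zero]
      calc ∑ i, φ m₀ (v i • (e i).1 m₀) = ∑ i, v i • ∑ j, a i j m₀ • (f j).1 m₀ := by
            refine Finset.sum_congr rfl fun i _ => ?_
            rw [map_smul]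
            exact congrArg _ (ha i).self_of_nhds
        _ = ∑ j, (∑ i, v i * a i j m₀) • (f j).1 m₀ := by
            simp only [Finset.smul_sum, Finset.sum_smul, smul_smul]
            exact Finset.sum_comm
        _ = 0 := by
            refine Finset.sum_eq_zero fun j _ => ?_
            have h3 : ∑ i, v i * a i j m₀ = 0 := congrFun hv' j
            rw [h3, zero_smul]
    exact funext (Fintype.linearIndependent_iff.1 he.self_of_nhds.1 v ((φ m₀).injective h2))
  obtain ⟨g, hg⟩ := exists_local_inv a'.det hdet
  -- This is the row vector `c` times adj/det; `g` is a global smooth function that agrees with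
  -- 1/det near `m₀`.
  let d (i : Fin n) : SmoothFun E M := g * ∑ j, c j * a'.adjugate j i
  refine ⟨fun m => ∑ i, d i m • (e i).1 m, ?_, ?_⟩
  · have : (fun m => ∑ i, d i m • (e i).1 m) = ∑ i, fun m => d i m • (e i).1 m := by
      funext m; simp
    rw [this]
    exact SA.sum_mem fun j _ => hAf (d j) _ (e j).2
  · filter_upwards [hg, eventually_all.2 ha, hc] with m hgm ham hcm
    rw [LinearEquiv.symm_apply_eq, map_sum, hcm]
    -- The computation takes place in the ring of smooth functions, where adj · a' = det holds
    -- globally; only afterwards is it evaluated at points with g · det = 1.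
    have h1 : ∀ l, ∑ i, d i * a' i l = g * a'.det * c l := by
      intro l
      have h2 : (Matrix.vecMul (Matrix.vecMul c a'.adjugate) a') l = a'.det * c l := by
        rw [Matrix.vecMul_vecMul, Matrix.adjugate_mul, Matrix.vecMul_smul, Matrix.vecMul_one]
        rfl
      rw [mul_assoc, ← h2]
      change ∑ i, g * (∑ j, c j * a'.adjugate j i) * a' i l = g * ∑ i, (∑ j, c j * a'.adjugate j i) * a' i l
      rw [Finset.mul_sum]
      exact Finset.sum_congr rfl fun i _ => mul_assoc _ _ _
    have h3 (l) : ∑ i, d i m * a i l m = c l m := by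
      have h4 := congrArg (ev m) (h1 l)
      rw [map_sum, map_mul, map_mul] at h4
      have h5 : ev m g * ev m a'.det = 1 := hgm
      rw [h5, one_mul] at h4
      exact h4
    symm
    calc ∑ i, φ m (d i m • (e i).1 m) = ∑ i, d i m • ∑ j, a i j m • (f j).1 m := by
          refine Finset.sum_congr rfl fun i _ => ?_
          rw [map_smul]
          exact congrArg _ (ham i)
      _ = ∑ j, (∑ i, d i m * a i j m) • (f j).1 m := by
          simp only [Finset.smul_sum, Finset.sum_smul, smul_smul]
          exact Finset.sum_comm
      _ = _ := by simp only [h3]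

end Inverse

section SecFrame

variable [T2Space M] [IsManifold 𝓘(ℝ, E) ∞ M]
  {F : Type*} [NormedAddCommGroup F] [NormedSpace ℝ F] [FiniteDimensional ℝ F]
  {V : M → Type*} [TopologicalSpace (TotalSpace F V)] [∀ m, AddCommGroup (V m)]
  [∀ m, Module ℝ (V m)] [∀ m, TopologicalSpace (V m)] [FiberBundle F V] [VectorBundle ℝ F V]
  [ContMDiffVectorBundle ∞ F V 𝓘(ℝ, E)]

variable (E F V) in
/-- The smooth sections of `V` among all families of elements of the fibres. -/
def secSubmodule : Submodule ℝ (∀ m, V m) where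
  carrier := {s | ContMDiff 𝓘(ℝ, E) (𝓘(ℝ, E).prod 𝓘(ℝ, F)) ∞ (fun m => TotalSpace.mk' F m (s m))}
  zero_mem' := (0 : Sec E F V).contMDiff
  add_mem' ha hb := ha.add_section hb
  smul_mem' c _ ha := ha.const_smul_section (a := c)

theorem secSubmodule_fsmul : FSMulClosed E (secSubmodule E F V) := fun f s hs =>
  (Sec.fsmul f (⟨s, hs⟩ : Sec E F V)).contMDiff

/-- The frame of a local trivialization and the coefficient functions in it are cut off to global
objects that agree with the originals near `m`. -/
theorem secSubmodule_hasFrame (m : M) : HasFrame E (secSubmodule E F V) m := by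
  have : ContMDiffVectorBundle 1 F V 𝓘(ℝ, E) := ContMDiffVectorBundle.of_le (n := ∞) (by simp)
  let t := trivializationAt F V m
  have hm : m ∈ t.baseSet := FiberBundle.mem_baseSet_trivializationAt F V m
  let b := Module.finBasis ℝ F
  have hfr (i) := t.contMDiffOn_localFrame_baseSet (I := 𝓘(ℝ, E)) ∞ b i
  choose S hS using fun i => exists_sec_eventuallyEq t.open_baseSet hm _ (hfr i)
  refine hasFrame_of_fintype (fun i => ⟨S i, (S i).contMDiff⟩) ?_ fun s hs => ?_
  · filter_upwards [eventually_all.2 hS, t.open_baseSet.mem_nhds hm] with p hp hpb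
    have h := t.isLocalFrameOn_localFrame_baseSet 𝓘(ℝ, E) ∞ b
    simp only [hp]
    exact ⟨h.linearIndependent hpb, eq_top_iff.2 (h.generating hpb)⟩
  · have hco (i) := contMDiffOn_baseSet_localFrameCoeff (k := ∞) (e := t) b
      (s := s) hs.contMDiffOn i
    choose c hc using fun i => exists_fun_eventuallyEq t.open_baseSet hm _ (hco i)
    refine ⟨c, ?_⟩
    filter_upwards [t.eventually_eq_localFrame_sum_coeff_smul (I := 𝓘(ℝ, E)) b (s := s) hm,
      eventually_all.2 hS, eventually_all.2 hc] with p h1 h2 h3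
    rw [h1]
    exact Finset.sum_congr rfl fun i _ => by rw [h2, h3]; rfl

theorem secSubmodule_mem_of_local {s : ∀ m, V m}
    (h : ∀ m₀, ∃ t ∈ secSubmodule E F V, ∀ᶠ m in 𝓝 m₀, s m = t m) : s ∈ secSubmodule E F V := by
  intro m₀
  obtain ⟨t, ht, hst⟩ := h m₀
  refine (ht m₀).congr_of_eventuallyEq ?_
  filter_upwards [hst] with m hm
  rw [hm]

theorem inverse_mem_secSubmodule {A B : M → Type*} [∀ m, AddCommGroup (A m)]
    [∀ m, Module ℝ (A m)] [∀ m, AddCommGroup (B m)] [∀ m, Module ℝ (B m)]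
    {SA : Submodule ℝ (∀ m, A m)} {SB : Submodule ℝ (∀ m, B m)}
    (hA : ∀ m, HasFrame E SA m) (hB : ∀ m, HasFrame E SB m) (hAf : FSMulClosed E SA)
    (hAl : ∀ s : (∀ m, A m), (∀ m₀, ∃ t ∈ SA, ∀ᶠ m in 𝓝 m₀, s m = t m) → s ∈ SA)
    (φ : ∀ m, A m ≃ₗ[ℝ] B m) (hφ : ∀ s ∈ SA, (fun m => φ m (s m)) ∈ SB)
    {t : ∀ m, B m} (ht : t ∈ SB) : (fun m => (φ m).symm (t m)) ∈ SA :=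
  hAl _ fun m₀ => (hA m₀).inverse_mem_local (hB m₀) hAf φ hφ ht

end SecFrame

end Frames

/-! ### The gauge algebroid 𝔇V -/

section GaugeAlgebroid

variable {E : Type*} [NormedAddCommGroup E] [NormedSpace ℝ E] [FiniteDimensional ℝ E]
  {M : Type*} [TopologicalSpace M] [ChartedSpace E M] [IsManifold 𝓘(ℝ, E) ∞ M] [T2Space M]

/-- A covector is a linear function in the chart at `m`, which is then cut off. The normalisation
f(m) = 0 gives d(f u) = α(d)(f) u(m) for d in 𝔇V at `m`, so that `f u` realises an arbitrary jet of
rank one in the kernel of the projection. -/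
theorem exists_fun_mvfderiv_eq (m : M) (y : TangentSpace 𝓘(ℝ, E) m →L[ℝ] ℝ) :
    ∃ f : SmoothFun E M, f m = 0 ∧ mvfderiv 𝓘(ℝ, E) f m = y := by
  have hM1 : IsManifold 𝓘(ℝ, E) 1 M := IsManifold.of_le (n := ∞) (by simp)
  set φ := extChartAt 𝓘(ℝ, E) m with hφ
  obtain ⟨e, he⟩ := isInvertible_mfderiv_extChartAt (I := 𝓘(ℝ, E)) (mem_extChartAt_source m)
  -- Here `e` is the derivative of the chart at `m`, so y ∘ e⁻¹ is the linear function on the model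
  -- space whose pullback has differential `y`.
  let y' : E →L[ℝ] ℝ := y.comp e.symm.toContinuousLinearMap
  have hg : ContMDiffOn 𝓘(ℝ, E) 𝓘(ℝ, E) ∞ φ (chartAt E m).source := contMDiffOn_extChartAt
  have hsub : ContMDiff 𝓘(ℝ, E) 𝓘(ℝ, ℝ) ∞ (fun v : E => y' (v - φ m)) :=
    (y'.contDiff.comp (contDiff_id.sub contDiff_const)).contMDiff
  obtain ⟨f, hf⟩ := exists_fun_eventuallyEq (chartAt E m).open_source (mem_chart_source E m)
    (fun p => y' (φ p - φ m)) (hsub.comp_contMDiffOn hg)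
  refine ⟨f, by rw [hf.self_of_nhds, sub_self, map_zero], ?_⟩
  have h1 : mfderiv 𝓘(ℝ, E) 𝓘(ℝ, ℝ) f m =
      mfderiv 𝓘(ℝ, E) 𝓘(ℝ, ℝ) ((fun v : E => y' (v - φ m)) ∘ φ) m :=
    Filter.EventuallyEq.mfderiv_eq hf
  have h2 : MDifferentiableAt 𝓘(ℝ, E) 𝓘(ℝ, E) φ m := mdifferentiableAt_extChartAt (mem_chart_source E m)
  have h3 : HasFDerivAt (fun v : E => y' (v - φ m)) y' (φ m) :=
    y'.hasFDerivAt.comp (φ m) ((hasFDerivAt_id _).sub_const _)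
  have h4 : mfderiv 𝓘(ℝ, E) 𝓘(ℝ, ℝ) (fun v : E => y' (v - φ m)) (φ m) = y' := by
    rw [mfderiv_eq_fderiv]; exact h3.fderiv
  rw [mfderiv_comp m (hsub.mdifferentiableAt (by simp)) h2, h4] at h1
  ext v
  have h5 : mfderiv 𝓘(ℝ, E) 𝓘(ℝ, E) φ m v = e v := (congrArg (fun L => L v) he).symm
  refine (congrArg (fun L => L v) h1).trans ((congrArg y' h5).trans ?_)
  exact congrArg y (e.symm_apply_apply v)

theorem VF.bracket_jacobi (X Y Z : VF E M) :
    X.bracket (Y.bracket Z) + Y.bracket (Z.bracket X) + Z.bracket (X.bracket Y) = 0 := by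
  have : IsManifold 𝓘(ℝ, E) (minSmoothness ℝ 3) M := by
    simp only [minSmoothness_of_isRCLikeNormedField]
    exact IsManifold.of_le (n := ∞) (WithTop.coe_le_coe.2 le_top)
  have h2 (W : VF E M) (m : M) : ContMDiffAt 𝓘(ℝ, E) 𝓘(ℝ, E).tangent (minSmoothness ℝ 2)
      (fun p => (W p : TangentBundle 𝓘(ℝ, E) M)) m := by
    simp only [minSmoothness_of_isRCLikeNormedField]
    exact (W.contMDiff m).of_le (WithTop.coe_le_coe.2 le_top)
  have h : X.bracket (Y.bracket Z) = (X.bracket Y).bracket Z + Y.bracket (X.bracket Z) :=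
    Sec.ext' fun m => leibniz_identity_mlieBracket_apply (h2 X m) (h2 Y m) (h2 Z m)
  have h3 : Y.bracket (-X.bracket Z) = -Y.bracket (X.bracket Z) := by
    simpa using VF.bracket_smul_right (-1) Y (X.bracket Z)
  rw [h, VF.bracket_swap (X.bracket Y) Z, VF.bracket_swap Z X, h3]
  abel

variable {F : Type*} [NormedAddCommGroup F] [NormedSpace ℝ F]
  {V : M → Type*} [TopologicalSpace (TotalSpace F V)] [∀ m, AddCommGroup (V m)]
  [∀ m, Module ℝ (V m)] [∀ m, TopologicalSpace (V m)] [FiberBundle F V] [VectorBundle ℝ F V]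
  [ContMDiffVectorBundle ∞ F V 𝓘(ℝ, E)]

/-- A cut-off connection lifts X to an operator with anchor χX, and χ = 1 at `m`. -/
theorem Gauge.anchor_surjective (m : M) :
    Function.Surjective (Gauge.anchor : Gauge E F V m →ₗ[ℝ] TangentSpace 𝓘(ℝ, E) m) := by
  intro v
  obtain ⟨X, rfl⟩ := exists_sec_apply_eq (E := E) (F := E) m v
  obtain ⟨D, χ, -, hχ, hD⟩ := exists_local_connection (E := E) (F := F) (V := V) m
  refine ⟨(D X).1 m, ?_⟩
  change GaugeSec.anchor (D X) m = _
  rw [hD]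
  change χ m • X m = X m
  rw [hχ.self_of_nhds, one_smul]

theorem Gauge.ofEnd_injective (m : M) :
    Function.Injective (Gauge.ofEnd : (V m →ₗ[ℝ] V m) →ₗ[ℝ] Gauge E F V m) := by
  intro Φ Ψ h
  refine LinearMap.ext fun v => ?_
  obtain ⟨u, rfl⟩ := exists_sec_apply_eq (E := E) (F := F) m v
  exact congrArg (fun d : Gauge E F V m => d.1.1 u) h

variable [FiniteDimensional ℝ F]

theorem Gauge.anchor_eq_zero_iff {m : M} (d : Gauge E F V m) :
    Gauge.anchor d = 0 ↔ ∃ Φ, Gauge.ofEnd Φ = d :=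
  ⟨fun h => (Gauge.exists_eq_ofEnd d h).imp fun _ h => h.symm, by rintro ⟨Φ, rfl⟩; rfl⟩

theorem gaugeSec_fsmulClosed : FSMulClosed E (GaugeSec E F V) :=
  fun f δ hδ => (GaugeSec.fsmul f ⟨δ, hδ⟩).2

theorem gaugeSec_mem_of_local {s : ∀ m, Gauge E F V m}
    (h : ∀ m₀, ∃ t ∈ GaugeSec E F V, ∀ᶠ m in 𝓝 m₀, s m = t m) : s ∈ GaugeSec E F V := by
  refine ⟨fun u m₀ => ?_, fun m₀ => ?_⟩
  · obtain ⟨t, ht, hst⟩ := h m₀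
    refine (ht.1 u m₀).congr_of_eventuallyEq ?_
    filter_upwards [hst] with m hm
    rw [hm]
  · obtain ⟨t, ht, hst⟩ := h m₀
    refine (ht.2 m₀).congr_of_eventuallyEq ?_
    filter_upwards [hst] with m hm
    rw [hm]

variable [∀ m, IsTopologicalAddGroup (V m)] [∀ m, ContinuousSMul ℝ (V m)]

/-- `HasFrame.extension` is applied to gl(V) → 𝔇V → TM. A local connection lifts vector fields, and
operators with zero anchor are smooth endomorphism fields. -/
theorem gaugeSec_hasFrame (m₀ : M) : HasFrame E (GaugeSec E F V) m₀ := by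
  refine HasFrame.extension
    (secSubmodule_hasFrame (E := E) (F := F →L[ℝ] F) (V := fun m => V m →L[ℝ] V m) m₀)
    (secSubmodule_hasFrame (E := E) (F := E) (V := (TangentSpace 𝓘(ℝ, E) : M → Type _)) m₀)
    gaugeSec_fsmulClosed (fun m => Gauge.ofEnd ∘ₗ ContinuousLinearMap.coeLM ℝ)
    (fun m => Gauge.anchor) ?_ ?_ ?_ ?_ ?_ ?_
  · intro m A B h
    exact ContinuousLinearMap.coe_injective (Gauge.ofEnd_injective m h)
  · intro m d
    refine (Gauge.anchor_eq_zero_iff d).trans ⟨?_, ?_⟩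
    · rintro ⟨Φ, rfl⟩
      obtain ⟨A, rfl⟩ := exists_clm_eq Φ (0 : Sec E F V)
      exact ⟨A, rfl⟩
    · rintro ⟨A, rfl⟩
      exact ⟨_, rfl⟩
  · exact fun s hs => (GaugeSec.ofHom ⟨s, hs⟩).2
  · exact fun s hs => hs.2
  · intro X hX
    obtain ⟨D, χ, -, hχ, hD⟩ := exists_local_connection (E := E) (F := F) (V := V) m₀
    refine ⟨_, (D ⟨X, hX⟩).2, ?_⟩
    filter_upwards [hχ] with m hm
    change GaugeSec.anchor (D ⟨X, hX⟩) m = _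
    rw [hD]
    change χ m • X m = X m
    rw [hm, one_smul]
  · intro s hs h0
    -- The anchor of `s` vanishes only near `m₀`; after multiplication by `f` it vanishes
    -- everywhere, so the product is a global endomorphism field.
    obtain ⟨f, hf, hf'⟩ := exists_bump (E := E) h0
    obtain ⟨A, hA⟩ := GaugeSec.exists_eq_ofHom (GaugeSec.fsmul f ⟨s, hs⟩) (by
      refine Sec.ext' fun p => ?_
      change f p • Gauge.anchor (s p) = 0
      by_cases hp : Gauge.anchor (s p) = 0
      · rw [hp, smul_zero]
      · rw [hf' p hp, zero_smul])
    refine ⟨A, A.contMDiff, ?_⟩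
    filter_upwards [hf] with m hm
    have h1 := congrArg (fun δ : GaugeSec E F V => δ.1 m) hA
    refine h1.symm.trans ?_
    change f m • s m = s m
    rw [hm, one_smul]

theorem GaugeSec.bracket_swap (δ δ' : GaugeSec E F V) :
    GaugeSec.bracket δ δ' = - GaugeSec.bracket δ' δ :=
  GaugeSec.ext (fun _ => (neg_sub _ _).symm) (VF.bracket_swap _ _)

theorem GaugeSec.bracket_jacobi (r s t : GaugeSec E F V) :
    GaugeSec.bracket r (GaugeSec.bracket s t) + GaugeSec.bracket s (GaugeSec.bracket t r) +
      GaugeSec.bracket t (GaugeSec.bracket r s) = 0 := by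
  refine GaugeSec.ext (fun u => ?_) (VF.bracket_jacobi _ _ _)
  change GaugeSec.op (GaugeSec.bracket r (GaugeSec.bracket s t)) u +
    GaugeSec.op (GaugeSec.bracket s (GaugeSec.bracket t r)) u +
    GaugeSec.op (GaugeSec.bracket t (GaugeSec.bracket r s)) u = 0
  simp only [GaugeSec.op_bracket, map_sub]
  abel

theorem gaugeAlgebroid_isLieAlgebroid : (gaugeAlgebroid E F V).IsLieAlgebroid where
  fsmul_mem := gaugeSec_fsmulClosed
  mem_of_local _ := gaugeSec_mem_of_local
  exists_frame := gaugeSec_hasFrame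
  anchor_smooth _ hs := hs.2
  bracket_add := GaugeSec.bracket_add_right
  bracket_smul := GaugeSec.bracket_smul_right
  bracket_skew := GaugeSec.bracket_swap
  jacobi := GaugeSec.bracket_jacobi
  leibniz f s t t' h m := by
    have h1 : t' = GaugeSec.fsmul f t := Subtype.ext (funext h)
    rw [h1]
    exact congrArg (fun δ : GaugeSec E F V => δ.1 m) (GaugeSec.bracket_fsmul_right f s t)
  anchor_bracket _ _ _ := rfl

end GaugeAlgebroid

/-! ### Checking Lie algebroid axioms and morphisms on generating sections -/

section Generators

universe w w'

variable {E : Type*} [NormedAddCommGroup E] [NormedSpace ℝ E] [FiniteDimensional ℝ E]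
  {M : Type*} [TopologicalSpace M] [ChartedSpace E M] [IsManifold 𝓘(ℝ, E) ∞ M] [T2Space M]

/-- `A` has all the properties of a Lie algebroid except possibly the Jacobi identity and the
compatibility of the anchor with the brackets. -/
structure AlgebroidData.IsSkew (A : AlgebroidData.{w} E M) : Prop where
  fsmul_mem : FSMulClosed E A.sections
  mem_of_local : ∀ s : (∀ m, A.Fiber m),
    (∀ m₀, ∃ t ∈ A.sections, ∀ᶠ m in 𝓝 m₀, s m = t m) → s ∈ A.sections
  exists_frame : ∀ m₀ : M, HasFrame E A.sections m₀
  anchor_smooth : ∀ s ∈ A.sections, ContMDiff 𝓘(ℝ, E) (𝓘(ℝ, E).prod 𝓘(ℝ, E)) ∞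
    (fun m => TotalSpace.mk' E (E := (TangentSpace 𝓘(ℝ, E) : M → Type _)) m (A.anchor m (s m)))
  bracket_add : ∀ r s t, A.bracket r (s + t) = A.bracket r s + A.bracket r t
  bracket_smul : ∀ (c : ℝ) s t, A.bracket s (c • t) = c • A.bracket s t
  bracket_skew : ∀ s t, A.bracket s t = - A.bracket t s
  leibniz : ∀ (f : SmoothFun E M) (s t : A.sections) (m : M),
    (A.bracket s (fsmul_mem.smul f t)).1 m =
      f m • (A.bracket s t).1 m + mvfderiv 𝓘(ℝ, E) f m (A.anchor m (s.1 m)) • t.1 m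

theorem AlgebroidData.IsLieAlgebroid.isSkew {A : AlgebroidData.{w} E M} (h : A.IsLieAlgebroid) :
    A.IsSkew where
  fsmul_mem := h.fsmul_mem
  mem_of_local := h.mem_of_local
  exists_frame := h.exists_frame
  anchor_smooth := h.anchor_smooth
  bracket_add := h.bracket_add
  bracket_smul := h.bracket_smul
  bracket_skew := h.bracket_skew
  leibniz f s t m := h.leibniz f s t _ (fun _ => rfl) m

namespace AlgebroidData.IsSkew

variable {A : AlgebroidData.{w} E M} (h : A.IsSkew)

/-- The anchor on sections. -/
def anchorVF : A.sections →ₗ[ℝ] VF E M where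
  toFun s := ⟨fun m => A.anchor m (s.1 m), h.anchor_smooth s.1 s.2⟩
  map_add' s t := Sec.ext' fun m => (A.anchor m).map_add (s.1 m) (t.1 m)
  map_smul' c s := Sec.ext' fun m => (A.anchor m).map_smul c (s.1 m)

/-- The operator `[s, ·]` on sections. -/
def ad (s : A.sections) : A.sections →ₗ[ℝ] A.sections where
  toFun := A.bracket s
  map_add' := h.bracket_add s
  map_smul' c := h.bracket_smul c s

theorem anchorVF_fsmul (f : SmoothFun E M) (s : A.sections) :
    h.anchorVF (h.fsmul_mem.smul f s) = (h.anchorVF s).fsmul f :=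
  Sec.ext' fun m => (A.anchor m).map_smul (f m) (s.1 m)

theorem ad_fsmul (f : SmoothFun E M) (s t : A.sections) :
    h.ad s (h.fsmul_mem.smul f t) =
      h.fsmul_mem.smul f (h.ad s t) + h.fsmul_mem.smul ((h.anchorVF s).deriv f) t :=
  Subtype.ext (funext fun m => h.leibniz f s t m)

/-- A skew-symmetric bilinear operation on sections that is linear over the smooth functions
vanishes if it vanishes on sections that span the fibres. -/
theorem eq_zero_of_generators {G : Set A.sections}
    (hG : ∀ (m : M) (v : A.Fiber m), ∃ g ∈ G, g.1 m = v) {m : M}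
    {W : Type*} [AddCommGroup W] [Module ℝ W] (β : A.sections → A.sections →ₗ[ℝ] W)
    (hβ : ∀ f s t, β s (h.fsmul_mem.smul f t) = f m • β s t) (hskew : ∀ s t, β s t = - β t s)
    (h0 : ∀ s ∈ G, ∀ t ∈ G, β s t = 0) (s t : A.sections) : β s t = 0 := by
  obtain ⟨a, ha, has⟩ := hG m (s.1 m)
  obtain ⟨b, hb, hbt⟩ := hG m (t.1 m)
  -- Linearity over functions makes β(r, ·) depend only on the value at `m`; skew-symmetry carries
  -- this over to the first argument.
  have e (r) := fun {x y} hxy => (h.exists_frame m).tensorial_eq h.fsmul_mem (β r)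
    (fun f t => hβ f r t) (s := x) (t := y) hxy
  rw [e s hbt.symm, hskew, e b has.symm, h0 b hb a ha, neg_zero]

/-- Replacing `t` by `f t` adds the same term (ρs)(f) ρt to both sides, so their difference is
tensorial and can be tested on `G`. -/
theorem anchor_bracket {G : Set A.sections}
    (hG : ∀ (m : M) (v : A.Fiber m), ∃ g ∈ G, g.1 m = v)
    (h0 : ∀ s ∈ G, ∀ t ∈ G, h.anchorVF (A.bracket s t) = (h.anchorVF s).bracket (h.anchorVF t))
    (s t : A.sections) : h.anchorVF (A.bracket s t) = (h.anchorVF s).bracket (h.anchorVF t) := by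
  refine Sec.ext' fun m => ?_
  let β (s : A.sections) : A.sections →ₗ[ℝ] TangentSpace 𝓘(ℝ, E) m :=
    Sec.eval E E (TangentSpace 𝓘(ℝ, E) : M → Type _) m ∘ₗ
      (h.anchorVF ∘ₗ h.ad s - (⟨⟨(h.anchorVF s).bracket, VF.bracket_add_right _⟩,
        fun c => VF.bracket_smul_right c _⟩ : VF E M →ₗ[ℝ] VF E M) ∘ₗ h.anchorVF)
  have hβ (s t) : β s t = (h.anchorVF (A.bracket s t) -
    (h.anchorVF s).bracket (h.anchorVF t) : VF E M) m := rfl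
  refine sub_eq_zero.1 (h.eq_zero_of_generators hG (m := m) β ?_ ?_ ?_ s t)
  · intro f s t
    have h1 : A.bracket s (h.fsmul_mem.smul f t) = _ := h.ad_fsmul f s t
    rw [hβ, hβ, h1, map_add, anchorVF_fsmul, anchorVF_fsmul, anchorVF_fsmul,
      VF.bracket_fsmul_right, add_sub_add_right_eq_sub]
    exact (smul_sub (f m) _ _).symm
  · intro s t
    have h1 : h.anchorVF (A.bracket s t) - (h.anchorVF s).bracket (h.anchorVF t) =
      - (h.anchorVF (A.bracket t s) - (h.anchorVF t).bracket (h.anchorVF s)) := by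
      rw [h.bracket_skew, VF.bracket_swap, map_neg]
      abel
    rw [hβ, hβ, h1]
    rfl
  · intro s hs t ht
    rw [hβ, h0 s hs t ht, sub_self]
    rfl

/-- Once the anchor preserves brackets, the Jacobiator is linear over functions in its last
argument; cyclic invariance gives the other two. -/
theorem jacobi {G : Set A.sections}
    (hG : ∀ (m : M) (v : A.Fiber m), ∃ g ∈ G, g.1 m = v)
    (hanchor : ∀ s t, h.anchorVF (A.bracket s t) = (h.anchorVF s).bracket (h.anchorVF t))
    (h0 : ∀ r ∈ G, ∀ s ∈ G, ∀ t ∈ G, A.bracket r (A.bracket s t) + A.bracket s (A.bracket t r) +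
      A.bracket t (A.bracket r s) = 0) (r s t : A.sections) :
    A.bracket r (A.bracket s t) + A.bracket s (A.bracket t r) + A.bracket t (A.bracket r s) = 0 := by
  let J (r s t : A.sections) : A.sections :=
    A.bracket r (A.bracket s t) + A.bracket s (A.bracket t r) + A.bracket t (A.bracket r s)
  -- The Jacobiator as the failure of ad to be a homomorphism, which exhibits it as an operator on
  -- the third argument.
  let L (r s : A.sections) : A.sections →ₗ[ℝ] A.sections :=
    h.ad r ∘ₗ h.ad s - h.ad s ∘ₗ h.ad r - h.ad (A.bracket r s)
  have hcyc (r s t) : J r s t = J t r s := by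
    simp only [J]
    abel
  have hL (r s t) : L r s t = J r s t := by
    have h1 : A.bracket s (A.bracket t r) = - A.bracket s (A.bracket r t) := by
      rw [h.bracket_skew t r]
      exact (h.ad s).map_neg _
    simp only [J]
    rw [h1, h.bracket_skew t, ← sub_eq_add_neg, ← sub_eq_add_neg]
    rfl
  have hLf (f r s t) : L r s (h.fsmul_mem.smul f t) = h.fsmul_mem.smul f (L r s t) := by
    have h1 : L r s (h.fsmul_mem.smul f t) = h.ad r (h.ad s (h.fsmul_mem.smul f t)) -
      h.ad s (h.ad r (h.fsmul_mem.smul f t)) - h.ad (A.bracket r s) (h.fsmul_mem.smul f t) := rfl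
    rw [h1]
    -- Mixed first-order terms in `f` cancel in pairs. What remains besides the multiple of `f` is
    -- (ρr ρs − ρs ρr − ρ[r,s])(f) t, which is zero because ρ[r,s] = [ρr,ρs].
    simp only [h.ad_fsmul, map_add, hanchor]
    refine Subtype.ext (funext fun m => ?_)
    have h2 : ((h.anchorVF r).bracket (h.anchorVF s)).deriv f m =
        (h.anchorVF r).deriv ((h.anchorVF s).deriv f) m -
          (h.anchorVF s).deriv ((h.anchorVF r).deriv f) m := VF.bracket_deriv _ _ f m
    change f m • (h.ad r (h.ad s t)).1 m + (h.anchorVF r).deriv f m • (h.ad s t).1 m +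
        ((h.anchorVF s).deriv f m • (h.ad r t).1 m +
          (h.anchorVF r).deriv ((h.anchorVF s).deriv f) m • t.1 m) -
      (f m • (h.ad s (h.ad r t)).1 m + (h.anchorVF s).deriv f m • (h.ad r t).1 m +
        ((h.anchorVF r).deriv f m • (h.ad s t).1 m +
          (h.anchorVF s).deriv ((h.anchorVF r).deriv f) m • t.1 m)) -
      (f m • (h.ad (A.bracket r s) t).1 m +
        ((h.anchorVF r).bracket (h.anchorVF s)).deriv f m • t.1 m) =
      f m • ((h.ad r (h.ad s t)).1 m - (h.ad s (h.ad r t)).1 m - (h.ad (A.bracket r s) t).1 m)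
    rw [h2, sub_smul, smul_sub, smul_sub]
    abel
  refine Subtype.ext (funext fun m => ?_)
  have key (r s) {x y : A.sections} (hxy : x.1 m = y.1 m) : (J r s x).1 m = (J r s y).1 m := by
    have := (h.exists_frame m).tensorial_eq h.fsmul_mem
      ((LinearMap.proj m ∘ₗ A.sections.subtype) ∘ₗ L r s)
      (fun f t => congrArg (fun u : A.sections => u.1 m) (hLf f r s t)) hxy
    rw [← hL, ← hL]
    exact this
  obtain ⟨a, ha, har⟩ := hG m (r.1 m)
  obtain ⟨b, hb, hbs⟩ := hG m (s.1 m)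
  obtain ⟨c, hc, hct⟩ := hG m (t.1 m)
  change (J r s t).1 m = 0
  -- Each argument in turn is rotated into the last slot and there replaced by an element of `G`
  -- with the same value at `m`.
  rw [key r s hct.symm, hcyc, key c r hbs.symm, hcyc, key b c har.symm]
  exact congrArg (fun u : A.sections => u.1 m) (h0 b hb c hc a ha)

theorem isLieAlgebroid {G : Set A.sections}
    (hG : ∀ (m : M) (v : A.Fiber m), ∃ g ∈ G, g.1 m = v)
    (h0 : ∀ s ∈ G, ∀ t ∈ G, h.anchorVF (A.bracket s t) = (h.anchorVF s).bracket (h.anchorVF t))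
    (hJ : ∀ r ∈ G, ∀ s ∈ G, ∀ t ∈ G, A.bracket r (A.bracket s t) + A.bracket s (A.bracket t r) +
      A.bracket t (A.bracket r s) = 0) : A.IsLieAlgebroid where
  fsmul_mem := h.fsmul_mem
  mem_of_local := h.mem_of_local
  exists_frame := h.exists_frame
  anchor_smooth := h.anchor_smooth
  bracket_add := h.bracket_add
  bracket_smul := h.bracket_smul
  bracket_skew := h.bracket_skew
  jacobi := h.jacobi hG (h.anchor_bracket hG h0) hJ
  leibniz f s t t' ht m := by
    obtain rfl : t' = h.fsmul_mem.smul f t := Subtype.ext (funext ht)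
    exact h.leibniz f s t m
  anchor_bracket s t m := congrArg (fun X : VF E M => X m) (h.anchor_bracket hG h0 s t)

/-- The Leibniz terms of φ[s, f t] and [φs, f φt] agree because φ preserves anchors, so the defect
φ[s,t] − [φs,φt] is tensorial. -/
theorem isMorphism (h : A.IsSkew) {B : AlgebroidData.{w'} E M} (hB : B.IsSkew) {G : Set A.sections}
    (hG : ∀ (m : M) (v : A.Fiber m), ∃ g ∈ G, g.1 m = v)
    (φ : ∀ m, A.Fiber m →ₗ[ℝ] B.Fiber m)
    (hmem : ∀ s ∈ A.sections, (fun m => φ m (s m)) ∈ B.sections)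
    (hanchor : ∀ (m : M) (v : A.Fiber m), B.anchor m (φ m v) = A.anchor m v)
    (h0 : ∀ s ∈ G, ∀ t ∈ G, ∀ m, φ m ((A.bracket s t).1 m) =
      (B.bracket ⟨_, hmem s.1 s.2⟩ ⟨_, hmem t.1 t.2⟩).1 m) : A.IsMorphism B φ where
  map_mem := hmem
  map_anchor := hanchor
  map_bracket s t m := by
    let Φ : A.sections →ₗ[ℝ] B.sections :=
      { toFun := fun s => ⟨_, hmem s.1 s.2⟩
        map_add' := fun s t => Subtype.ext (funext fun m => (φ m).map_add (s.1 m) (t.1 m))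
        map_smul' := fun c s => Subtype.ext (funext fun m => (φ m).map_smul c (s.1 m)) }
    have hΦf (f s) : Φ (h.fsmul_mem.smul f s) = hB.fsmul_mem.smul f (Φ s) :=
      Subtype.ext (funext fun m => (φ m).map_smul (f m) (s.1 m))
    have hΦa (s) : hB.anchorVF (Φ s) = h.anchorVF s := Sec.ext' fun m => hanchor m (s.1 m)
    let β (s : A.sections) : A.sections →ₗ[ℝ] B.Fiber m :=
      (LinearMap.proj m ∘ₗ B.sections.subtype) ∘ₗ (Φ ∘ₗ h.ad s - hB.ad (Φ s) ∘ₗ Φ)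
    have hβ (s t) : β s t = (Φ (h.ad s t) - hB.ad (Φ s) (Φ t)).1 m := rfl
    refine sub_eq_zero.1 (h.eq_zero_of_generators hG (m := m) β ?_ ?_ ?_ s t)
    · intro f s t
      rw [hβ, hβ, h.ad_fsmul, map_add, hΦf, hΦf, hΦf, hB.ad_fsmul, hΦa, add_sub_add_right_eq_sub]
      exact (smul_sub (f m) _ _).symm
    · intro s t
      have h1 : Φ (h.ad s t) - hB.ad (Φ s) (Φ t) = -(Φ (h.ad t s) - hB.ad (Φ t) (Φ s)) := by
        have h2 : h.ad s t = - h.ad t s := h.bracket_skew s t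
        have h3 : hB.ad (Φ s) (Φ t) = - hB.ad (Φ t) (Φ s) := hB.bracket_skew _ _
        rw [h2, h3, map_neg]
        abel
      rw [hβ, hβ, h1]
      rfl
    · intro s hs t ht
      exact sub_eq_zero.2 (h0 s hs t ht m)

/-- Smoothness of the fibrewise inverse is the only analytic point and comes from
`HasFrame.inverse_mem_local`. Its compatibility with brackets is checked after applying the
injective map `φ`. -/
theorem isIsomorphism (h : A.IsSkew) {B : AlgebroidData.{w'} E M} (hB : B.IsSkew)
    {φ : ∀ m, A.Fiber m →ₗ[ℝ] B.Fiber m} (hφ : A.IsMorphism B φ)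
    (hbij : ∀ m, Function.Bijective (φ m)) : A.IsIsomorphism B φ := by
  let e (m : M) : A.Fiber m ≃ₗ[ℝ] B.Fiber m := LinearEquiv.ofBijective (φ m) (hbij m)
  have hmem (t) (ht : t ∈ B.sections) : (fun m => (e m).symm (t m)) ∈ A.sections :=
    h.mem_of_local _ fun m₀ => (h.exists_frame m₀).inverse_mem_local (hB.exists_frame m₀)
      h.fsmul_mem e hφ.map_mem ht
  have hes (m) (v : B.Fiber m) : φ m ((e m).symm v) = v := (e m).apply_symm_apply v
  refine ⟨hφ, fun m => (e m).symm.toLinearMap, ⟨hmem, fun m v => ?_, fun s t m => ?_⟩, fun m =>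
    ⟨LinearMap.ext (e m).symm_apply_apply, LinearMap.ext (e m).apply_symm_apply⟩⟩
  · rw [← hφ.map_anchor]
    exact congrArg _ (hes m v)
  · apply (hbij m).1
    rw [hφ.map_bracket]
    refine (hes m _).trans ?_
    have h1 (r : B.sections) : (⟨fun p => φ p ((e p).symm (r.1 p)), hφ.map_mem _ (hmem r.1 r.2)⟩ :
      B.sections) = r := Subtype.ext (funext fun p => hes p (r.1 p))
    exact congrArg (fun u : B.sections => u.1 m) (congrArg₂ B.bracket (h1 s) (h1 t)).symm

end AlgebroidData.IsSkew

end Generators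

/-! ### The jet algebroid 𝔍V -/

section JetAlgebroid

variable {E : Type*} [NormedAddCommGroup E] [NormedSpace ℝ E] [FiniteDimensional ℝ E]
  {M : Type*} [TopologicalSpace M] [ChartedSpace E M] [IsManifold 𝓘(ℝ, E) ∞ M] [T2Space M]
  {F : Type*} [NormedAddCommGroup F] [NormedSpace ℝ F] [FiniteDimensional ℝ F]
  {V : M → Type*} [TopologicalSpace (TotalSpace F V)] [∀ m, AddCommGroup (V m)]
  [∀ m, Module ℝ (V m)] [∀ m, TopologicalSpace (V m)] [FiberBundle F V] [VectorBundle ℝ F V]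
  [ContMDiffVectorBundle ∞ F V 𝓘(ℝ, E)]

theorem Jet.incl_injective (m : M) :
    Function.Injective (Jet.incl : (TangentSpace 𝓘(ℝ, E) m →ₗ[ℝ] V m) → Jet E F V m) := by
  intro y z h
  refine LinearMap.ext fun v => ?_
  obtain ⟨d, rfl⟩ := Gauge.anchor_surjective (E := E) (F := F) (V := V) m v
  exact congrArg (fun ν : Jet E F V m => ν.1 d) h

/-- Choose a linear splitting g of the anchor. The difference d − g(α(d)) is an endomorphism Φ, and
ν(Φ) = Φ(ν(1)) = 0, so ν factors through the anchor as (ν ∘ g) ∘ α. -/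
theorem Jet.proj_eq_zero_iff {m : M} (ν : Jet E F V m) :
    Jet.proj ν = 0 ↔ ∃ y, Jet.incl y = ν := by
  constructor
  · intro h
    obtain ⟨g, hg⟩ := LinearMap.exists_rightInverse_of_surjective
      (Gauge.anchor : Gauge E F V m →ₗ[ℝ] TangentSpace 𝓘(ℝ, E) m)
      (LinearMap.range_eq_top.2 (Gauge.anchor_surjective m))
    have hg' (v) : Gauge.anchor (g v) = v := congrArg (fun L => L v) hg
    refine ⟨ν.1 ∘ₗ g, Subtype.ext (LinearMap.ext fun d => ?_)⟩
    obtain ⟨Φ, hΦ⟩ := (Gauge.anchor_eq_zero_iff (d - g (Gauge.anchor d))).1 (by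
      rw [map_sub, hg', sub_self])
    have h1 : ν.1 (d - g (Gauge.anchor d)) = 0 := by
      rw [← hΦ, ν.2]
      exact (congrArg Φ h).trans (map_zero Φ)
    rw [map_sub, sub_eq_zero] at h1
    exact h1.symm
  · rintro ⟨y, rfl⟩
    exact map_zero y

theorem exists_clm_tangent_eq {m : M} {W : Type*} [AddCommGroup W] [Module ℝ W]
    [TopologicalSpace W] [IsTopologicalAddGroup W] [ContinuousSMul ℝ W]
    (y : TangentSpace 𝓘(ℝ, E) m →ₗ[ℝ] W) :
    ∃ A : TangentSpace 𝓘(ℝ, E) m →L[ℝ] W, A.toLinearMap = y :=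
  have : FiniteDimensional ℝ (TangentSpace 𝓘(ℝ, E) m) := inferInstanceAs (FiniteDimensional ℝ E)
  have : T2Space (TangentSpace 𝓘(ℝ, E) m) := inferInstanceAs (T2Space E)
  ⟨LinearMap.toContinuousLinearMap y, rfl⟩

/-- A section with the right value at `m` reduces the claim to ν = 𝕖(y). With a basis b_i of T_mM,
such a ν is the jet of Σ f_i s_i, where f_i vanishes at `m` with differential the dual basis
covector b^i, and s_i(m) = y(b_i). Thus the algebraic fibre of 𝔍V consists exactly of 1-jets. -/
theorem Jet.exists_jet_eq {m : M} (ν : Jet E F V m) :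
    ∃ u : Sec E F V, (JetSec.jet u).1 m = ν := by
  obtain ⟨u₀, hu₀⟩ := exists_sec_apply_eq (E := E) (F := F) m (Jet.proj ν)
  obtain ⟨y, hy⟩ := (Jet.proj_eq_zero_iff (ν - (JetSec.jet u₀).1 m)).1 (by
    rw [map_sub, ← hu₀]
    exact sub_self _)
  let b : Module.Basis _ ℝ (TangentSpace 𝓘(ℝ, E) m) := Module.finBasis ℝ E
  choose a ha using fun i => exists_clm_tangent_eq (b.coord i)
  choose f hf hf' using fun i => exists_fun_mvfderiv_eq (E := E) m (a i)
  choose s hs using fun i => exists_sec_apply_eq (E := E) (F := F) m (y (b i))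
  refine ⟨u₀ + ∑ i, (s i).fsmul (f i), Subtype.ext (LinearMap.ext fun d => ?_)⟩
  have h1 : ν.1 d = y (Gauge.anchor d) + d.1.1 u₀ := by
    have h2 : (ν - (JetSec.jet u₀).1 m).1 d = y (Gauge.anchor d) := by rw [← hy]; rfl
    rw [← h2]
    exact (sub_add_cancel (ν.1 d) (d.1.1 u₀)).symm
  have h3 (i) : d.1.1 ((s i).fsmul (f i)) = b.repr (Gauge.anchor d) i • y (b i) := by
    rw [d.2, hf, zero_smul, zero_add, hf', hs]
    exact congrArg (fun L : TangentSpace 𝓘(ℝ, E) m →ₗ[ℝ] ℝ => L (Gauge.anchor d) • y (b i)) (ha i)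
  change d.1.1 (u₀ + ∑ i, (s i).fsmul (f i)) = _
  rw [map_add, map_sum, h1, add_comm]
  congr 1
  simp only [h3]
  conv_rhs => rw [← b.sum_repr (Gauge.anchor d)]
  simp only [map_sum, map_smul]

/-- A section with a given 1-jet at `m`. -/
def Jet.rep {m : M} (ν : Jet E F V m) : Sec E F V := (Jet.exists_jet_eq ν).choose

theorem Jet.jet_rep {m : M} (ν : Jet E F V m) : (JetSec.jet (Jet.rep ν)).1 m = ν :=
  (Jet.exists_jet_eq ν).choose_spec

theorem JetSec.jet_add (u v : Sec E F V) (m : M) :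
    (JetSec.jet (u + v)).1 m = (JetSec.jet u).1 m + (JetSec.jet v).1 m :=
  Subtype.ext (LinearMap.ext fun d => d.1.1.map_add u v)

theorem JetSec.jet_smul (c : ℝ) (u : Sec E F V) (m : M) :
    (JetSec.jet (c • u)).1 m = c • (JetSec.jet u).1 m :=
  Subtype.ext (LinearMap.ext fun d => d.1.1.map_smul c u)

theorem Jet.jet_rep_add {m : M} (ν μ : Jet E F V m) :
    (JetSec.jet (Jet.rep (ν + μ))).1 m = (JetSec.jet (Jet.rep ν + Jet.rep μ)).1 m := by
  rw [JetSec.jet_add, Jet.jet_rep, Jet.jet_rep, Jet.jet_rep]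

theorem Jet.jet_rep_smul {m : M} (c : ℝ) (ν : Jet E F V m) :
    (JetSec.jet (Jet.rep (c • ν))).1 m = (JetSec.jet (c • Jet.rep ν)).1 m := by
  rw [JetSec.jet_smul, Jet.jet_rep, Jet.jet_rep]

theorem Jet.proj_surjective (m : M) :
    Function.Surjective (Jet.proj : Jet E F V m →ₗ[ℝ] V m) := by
  intro v
  obtain ⟨u, rfl⟩ := exists_sec_apply_eq (E := E) (F := F) m v
  exact ⟨(JetSec.jet u).1 m, rfl⟩

/-- Multiplication of a section of `𝔍V` by a smooth function. -/
def JetSec.fsmul (f : SmoothFun E M) (ν : JetSec E F V) : JetSec E F V :=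
  ⟨fun m => f m • ν.1 m, fun δ => (Sec.fsmul f (JetSec.pair ν δ)).contMDiff⟩

theorem jetSec_fsmulClosed : FSMulClosed E (JetSec E F V) :=
  fun f ν hν => (JetSec.fsmul f ⟨ν, hν⟩).2

theorem jetSec_mem_of_local {s : ∀ m, Jet E F V m}
    (h : ∀ m₀, ∃ t ∈ JetSec E F V, ∀ᶠ m in 𝓝 m₀, s m = t m) : s ∈ JetSec E F V := by
  intro δ m₀
  obtain ⟨t, ht, hst⟩ := h m₀
  refine (ht δ m₀).congr_of_eventuallyEq ?_
  filter_upwards [hst] with m hm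
  rw [hm]

variable [∀ m, IsTopologicalAddGroup (V m)] [∀ m, ContinuousSMul ℝ (V m)]

/-- `HasFrame.extension` is applied to Hom(TM, V) → 𝔍V → V. Jet prolongation lifts sections of V; it
is not linear over functions, but only the existence of a smooth lift is needed. -/
theorem jetSec_hasFrame (m₀ : M) : HasFrame E (JetSec E F V) m₀ := by
  refine HasFrame.extension
    (secSubmodule_hasFrame (E := E) (F := E →L[ℝ] F)
      (V := fun m => TangentSpace 𝓘(ℝ, E) m →L[ℝ] V m) m₀)
    (secSubmodule_hasFrame (E := E) (F := F) (V := V) m₀)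
    jetSec_fsmulClosed
    (fun m => { toFun := fun y => Jet.incl y.toLinearMap
                map_add' := fun _ _ => rfl
                map_smul' := fun _ _ => rfl })
    (fun m => Jet.proj) ?_ ?_ ?_ ?_ ?_ ?_
  · intro m A B h
    exact ContinuousLinearMap.coe_injective (Jet.incl_injective m h)
  · intro m ν
    refine (Jet.proj_eq_zero_iff ν).trans ⟨?_, ?_⟩
    · rintro ⟨y, rfl⟩
      obtain ⟨A, rfl⟩ := exists_clm_tangent_eq y
      exact ⟨A, rfl⟩
    · rintro ⟨y, rfl⟩
      exact ⟨_, rfl⟩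
  · exact fun s hs δ => ContMDiff.clm_bundle_apply hs δ.2.2
  · exact fun s hs => (JetSec.proj ⟨s, hs⟩).contMDiff
  · exact fun u hu => ⟨_, (JetSec.jet ⟨u, hu⟩).2, Eventually.of_forall fun m => rfl⟩
  · intro s hs h0
    obtain ⟨f, hf, hf'⟩ := exists_bump (E := E) h0
    have hy (m : M) : ∃ y : TangentSpace 𝓘(ℝ, E) m →L[ℝ] V m,
        Jet.incl y.toLinearMap = f m • s m := by
      obtain ⟨y, hy⟩ := (Jet.proj_eq_zero_iff (f m • s m)).1 (by
        rw [map_smul]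
        by_cases hp : Jet.proj (s m) = 0
        · rw [hp, smul_zero]
        · rw [hf' m hp, zero_smul])
      obtain ⟨A, rfl⟩ := exists_clm_tangent_eq y
      exact ⟨A, hy⟩
    choose y hy using hy
    refine ⟨y, contMDiff_hom_of_apply (V := (TangentSpace 𝓘(ℝ, E) : M → Type _)) y
      fun X m₁ => ?_, ?_⟩
    -- Near `m₁` a local connection lifts X to a smooth section D X of 𝔇V with anchor X, so y(X) =
    -- ⟨f s, D X⟩ is smooth there.
    · obtain ⟨D, χ, -, hχ, hD⟩ := exists_local_connection (E := E) (F := F) (V := V) m₁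
      refine ((JetSec.fsmul f ⟨s, hs⟩).2 (D X) m₁).congr_of_eventuallyEq ?_
      filter_upwards [hχ] with m hm
      have h1 : Gauge.anchor ((D X).1 m) = X m := by
        have h2 : GaugeSec.anchor (D X) m = χ m • X m := by rw [hD]; rfl
        rw [hm, one_smul] at h2
        exact h2
      have h3 : (f m • s m).1 ((D X).1 m) = y m (X m) := by
        rw [← hy m, ← h1]
        rfl
      exact congrArg _ h3.symm
    · filter_upwards [hf] with m hm
      refine (hy m).trans ?_
      rw [hm, one_smul]

namespace JetSec

theorem ext {ν ν' : JetSec E F V} (h : ∀ δ, pair ν δ = pair ν' δ) : ν = ν' := by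
  refine Subtype.ext (funext fun m => Subtype.ext (LinearMap.ext fun d => ?_))
  obtain ⟨δ, rfl⟩ := exists_gaugeSec_apply_eq m d
  exact congrArg (fun u : Sec E F V => u m) (h δ)

theorem pair_add_left (μ ν : JetSec E F V) (δ : GaugeSec E F V) :
    pair (μ + ν) δ = pair μ δ + pair ν δ := rfl

theorem pair_smul_left (c : ℝ) (ν : JetSec E F V) (δ : GaugeSec E F V) :
    pair (c • ν) δ = c • pair ν δ := rfl

theorem pair_fsmul_left (f : SmoothFun E M) (ν : JetSec E F V) (δ : GaugeSec E F V) :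
    pair (fsmul f ν) δ = (pair ν δ).fsmul f := rfl

theorem pair_add_right (ν : JetSec E F V) (δ δ' : GaugeSec E F V) :
    pair ν (δ + δ') = pair ν δ + pair ν δ' :=
  Sec.ext' fun m => (ν.1 m).1.map_add (δ.1 m) (δ'.1 m)

theorem pair_sub_right (ν : JetSec E F V) (δ δ' : GaugeSec E F V) :
    pair ν (δ - δ') = pair ν δ - pair ν δ' :=
  Sec.ext' fun m => (ν.1 m).1.map_sub (δ.1 m) (δ'.1 m)

theorem pair_smul_right (c : ℝ) (ν : JetSec E F V) (δ : GaugeSec E F V) :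
    pair ν (c • δ) = c • pair ν δ :=
  Sec.ext' fun m => (ν.1 m).1.map_smul c (δ.1 m)

theorem pair_fsmul_right (f : SmoothFun E M) (ν : JetSec E F V) (δ : GaugeSec E F V) :
    pair ν (GaugeSec.fsmul f δ) = (pair ν δ).fsmul f :=
  Sec.ext' fun m => (ν.1 m).1.map_smul (f m) (δ.1 m)

theorem pair_jet (u : Sec E F V) (δ : GaugeSec E F V) : pair (jet u) δ = GaugeSec.op δ u := rfl

end JetSec

theorem GaugeSec.op_add (δ δ' : GaugeSec E F V) (u : Sec E F V) :
    GaugeSec.op (δ + δ') u = GaugeSec.op δ u + GaugeSec.op δ' u := rfl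

theorem GaugeSec.op_smul (c : ℝ) (δ : GaugeSec E F V) (u : Sec E F V) :
    GaugeSec.op (c • δ) u = c • GaugeSec.op δ u := rfl

theorem GaugeSec.bracket_add_left (δ δ' ε : GaugeSec E F V) :
    GaugeSec.bracket (δ + δ') ε = GaugeSec.bracket δ ε + GaugeSec.bracket δ' ε := by
  rw [GaugeSec.bracket_swap, GaugeSec.bracket_add_right, GaugeSec.bracket_swap δ,
    GaugeSec.bracket_swap δ']
  exact neg_add (GaugeSec.bracket ε δ) (GaugeSec.bracket ε δ')

theorem GaugeSec.bracket_smul_left (c : ℝ) (δ ε : GaugeSec E F V) :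
    GaugeSec.bracket (c • δ) ε = c • GaugeSec.bracket δ ε := by
  rw [GaugeSec.bracket_swap, GaugeSec.bracket_smul_right, GaugeSec.bracket_swap δ]
  exact (smul_neg c (GaugeSec.bracket ε δ)).symm

theorem GaugeSec.bracket_fsmul_left (f : SmoothFun E M) (δ ε : GaugeSec E F V) :
    GaugeSec.bracket (GaugeSec.fsmul f δ) ε = GaugeSec.fsmul f (GaugeSec.bracket δ ε) -
      GaugeSec.fsmul ((GaugeSec.anchor ε).deriv f) δ := by
  rw [GaugeSec.bracket_swap, GaugeSec.bracket_fsmul_right, GaugeSec.bracket_swap δ]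
  refine Subtype.ext (funext fun m => ?_)
  change -(f m • (GaugeSec.bracket ε δ).1 m + (GaugeSec.anchor ε).deriv f m • δ.1 m) =
    f m • -(GaugeSec.bracket ε δ).1 m - (GaugeSec.anchor ε).deriv f m • δ.1 m
  rw [neg_add, smul_neg, sub_eq_add_neg]

namespace SkewAlgebroid

variable (A : SkewAlgebroid E F V)

/-- At a point μ is the jet of some u. Then ⟨ν, πμ⟩ = ν([u,·]), while ⟨μ, πν⟩ = (πν)(u) = −ν([u,·])
by the definition of π. -/
theorem pair_sharpSec_swap (μ ν : JetSec E F V) :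
    JetSec.pair μ (A.sharpSec ν) = - JetSec.pair ν (A.sharpSec μ) := by
  refine Sec.ext' fun m => ?_
  obtain ⟨u, hu⟩ := Jet.exists_jet_eq (μ.1 m)
  have h1 : A.sharp (μ.1 m) = (A.ad u).1 m := by
    rw [← hu]
    exact congrArg (fun δ : GaugeSec E F V => δ.1 m) (A.sharpSec_jet u)
  change (μ.1 m).1 (A.sharp (ν.1 m)) = -((ν.1 m).1 (A.sharp (μ.1 m)))
  rw [h1, ← hu]
  rfl

theorem sharpSec_add (μ ν : JetSec E F V) :
    A.sharpSec (μ + ν) = A.sharpSec μ + A.sharpSec ν :=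
  Subtype.ext (funext fun m => A.sharp.map_add (μ.1 m) (ν.1 m))

theorem sharpSec_smul (c : ℝ) (ν : JetSec E F V) : A.sharpSec (c • ν) = c • A.sharpSec ν :=
  Subtype.ext (funext fun m => A.sharp.map_smul c (ν.1 m))

theorem sharpSec_fsmul (f : SmoothFun E M) (ν : JetSec E F V) :
    A.sharpSec (JetSec.fsmul f ν) = GaugeSec.fsmul f (A.sharpSec ν) :=
  Subtype.ext (funext fun m => A.sharp.map_smul (f m) (ν.1 m))

theorem pair_jetBracket (μ ν : JetSec E F V) (δ : GaugeSec E F V) :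
    JetSec.pair (A.jetBracket μ ν) δ =
      (GaugeSec.op (A.sharpSec μ) (JetSec.pair ν δ) -
        JetSec.pair ν (GaugeSec.bracket (A.sharpSec μ) δ)) -
      (GaugeSec.op (A.sharpSec ν) (JetSec.pair μ δ) -
        JetSec.pair μ (GaugeSec.bracket (A.sharpSec ν) δ)) -
      GaugeSec.op δ (JetSec.pair ν (A.sharpSec μ)) := by
  rw [← JetSec.pair_lieDeriv, ← JetSec.pair_lieDeriv]
  rfl

/-- Paired with δ, the commutators collapse L_{πμ}ν to δ[u,v] and L_{πν}μ to δ[v,u]. The result is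
δ[u,v] − δ[v,u] − δ[u,v] = δ[u,v]. No Jacobi identity for V enters. -/
theorem jetBracket_jet (u v : Sec E F V) :
    A.jetBracket (JetSec.jet u) (JetSec.jet v) = JetSec.jet (A.bracket u v) := by
  refine JetSec.ext fun δ => ?_
  have h (u v : Sec E F V) : GaugeSec.op (A.ad u) v = A.bracket u v := rfl
  rw [pair_jetBracket]
  simp only [JetSec.pair_jet, sharpSec_jet, GaugeSec.op_bracket, h]
  rw [A.skew v u, map_neg]
  abel

theorem jetBracket_swap (μ ν : JetSec E F V) : A.jetBracket μ ν = - A.jetBracket ν μ := by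
  refine JetSec.ext fun δ => ?_
  have h : JetSec.pair (-A.jetBracket ν μ) δ = - JetSec.pair (A.jetBracket ν μ) δ := rfl
  rw [h, pair_jetBracket, pair_jetBracket, A.pair_sharpSec_swap ν μ, map_neg]
  abel

theorem jetBracket_add (μ ν ν' : JetSec E F V) :
    A.jetBracket μ (ν + ν') = A.jetBracket μ ν + A.jetBracket μ ν' := by
  refine JetSec.ext fun δ => ?_
  simp only [JetSec.pair_add_left, JetSec.pair_add_right, pair_jetBracket, sharpSec_add,
    GaugeSec.op_add, GaugeSec.bracket_add_left, map_add]
  abel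

theorem jetBracket_smul (c : ℝ) (μ ν : JetSec E F V) :
    A.jetBracket μ (c • ν) = c • A.jetBracket μ ν := by
  refine JetSec.ext fun δ => ?_
  simp only [JetSec.pair_smul_left, JetSec.pair_smul_right, pair_jetBracket, sharpSec_smul,
    GaugeSec.op_smul, GaugeSec.bracket_smul_left, map_smul, smul_sub]

/-- The unwanted terms carry the factor α(δ)(f). One comes from [fπν, δ] and is a multiple of ⟨μ,
πν⟩; the other comes from δ(f⟨ν, πμ⟩). They cancel by the skew-symmetry of the pairing. -/
theorem jetBracket_fsmul (f : SmoothFun E M) (μ ν : JetSec E F V) :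
    A.jetBracket μ (JetSec.fsmul f ν) = JetSec.fsmul f (A.jetBracket μ ν) +
      JetSec.fsmul ((GaugeSec.anchor (A.sharpSec μ)).deriv f) ν := by
  refine JetSec.ext fun δ => ?_
  have hop (ε : GaugeSec E F V) (u : Sec E F V) :
      GaugeSec.op (GaugeSec.fsmul f ε) u = (GaugeSec.op ε u).fsmul f := rfl
  simp only [JetSec.pair_add_left, JetSec.pair_fsmul_left, pair_jetBracket, sharpSec_fsmul,
    GaugeSec.op_fsmul, GaugeSec.bracket_fsmul_left, JetSec.pair_sub_right,
    JetSec.pair_fsmul_right, hop]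
  rw [A.pair_sharpSec_swap μ ν]
  refine Sec.ext' fun m => ?_
  generalize JetSec.pair ν δ = a
  set b := GaugeSec.op (A.sharpSec μ) a m
  set c := JetSec.pair ν (GaugeSec.bracket (A.sharpSec μ) δ) m
  set d := GaugeSec.op (A.sharpSec ν) (JetSec.pair μ δ) m
  set e := JetSec.pair μ (GaugeSec.bracket (A.sharpSec ν) δ) m
  generalize JetSec.pair ν (A.sharpSec μ) = g
  set i := GaugeSec.op δ g m
  set x := (GaugeSec.anchor (A.sharpSec μ)).deriv f m
  set y := (GaugeSec.anchor δ).deriv f m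
  change (f m • b + x • a m - f m • c) - (f m • d - (f m • e - y • (-(g m)))) -
    (f m • i + y • g m) = f m • ((b - c) - (d - e) - i) + x • a m
  module

theorem jetAlgebroid_isSkew : (jetAlgebroid A).IsSkew where
  fsmul_mem := jetSec_fsmulClosed
  mem_of_local _ := jetSec_mem_of_local
  exists_frame := jetSec_hasFrame
  anchor_smooth s hs := (A.sharpSec ⟨s, hs⟩).2.2
  bracket_add := A.jetBracket_add
  bracket_smul := A.jetBracket_smul
  bracket_skew := A.jetBracket_swap
  leibniz f s t m := congrArg (fun ν : JetSec E F V => ν.1 m) (A.jetBracket_fsmul f s t)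

/-- The jets 𝕕u exhaust the fibres, and on them both identities are the images under 𝕕 of those of
V. -/
theorem jetAlgebroid_isLieAlgebroid
    (hanchor : ∀ u v, A.anchor.app (A.bracket u v) =
      VF.bracket (A.anchor.app u) (A.anchor.app v))
    (hjacobi : ∀ u v w, A.bracket u (A.bracket v w) + A.bracket v (A.bracket w u) +
      A.bracket w (A.bracket u v) = 0) : (jetAlgebroid A).IsLieAlgebroid := by
  refine A.jetAlgebroid_isSkew.isLieAlgebroid (G := Set.range JetSec.jet) ?_ ?_ ?_
  · intro m ν
    obtain ⟨u, hu⟩ := Jet.exists_jet_eq ν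
    exact ⟨_, ⟨u, rfl⟩, hu⟩
  · rintro _ ⟨u, rfl⟩ _ ⟨v, rfl⟩
    change A.jetAlgebroid_isSkew.anchorVF (A.jetBracket (JetSec.jet u) (JetSec.jet v)) = _
    rw [jetBracket_jet]
    exact hanchor u v
  · rintro _ ⟨u, rfl⟩ _ ⟨v, rfl⟩ _ ⟨w, rfl⟩
    change A.jetBracket (JetSec.jet u) (A.jetBracket (JetSec.jet v) (JetSec.jet w)) +
      A.jetBracket (JetSec.jet v) (A.jetBracket (JetSec.jet w) (JetSec.jet u)) +
      A.jetBracket (JetSec.jet w) (A.jetBracket (JetSec.jet u) (JetSec.jet v)) = 0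
    simp only [jetBracket_jet]
    refine JetSec.ext fun δ => ?_
    simp only [JetSec.pair_add_left, JetSec.pair_jet, ← map_add, hjacobi]
    exact map_zero _

/-- The algebroid data given by an anchor and a bracket on the sections of a vector bundle. -/
def toAlgebroidData : AlgebroidData E M where
  Fiber := V
  sections := secSubmodule E F V
  anchor m := (A.anchor m).toLinearMap
  bracket s t := ⟨A.bracket ⟨s.1, s.2⟩ ⟨t.1, t.2⟩, (A.bracket ⟨s.1, s.2⟩ ⟨t.1, t.2⟩).contMDiff⟩

theorem toAlgebroidData_isSkew : A.toAlgebroidData.IsSkew where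
  fsmul_mem := secSubmodule_fsmul (V := V)
  mem_of_local _ := secSubmodule_mem_of_local (V := V)
  exists_frame := secSubmodule_hasFrame (V := V)
  anchor_smooth s hs := (A.anchor.app ⟨s, hs⟩).contMDiff
  bracket_add r s t := Subtype.ext (congrArg (fun u : Sec E F V => (u : ∀ m, V m))
    (A.add_right ⟨r.1, r.2⟩ ⟨s.1, s.2⟩ ⟨t.1, t.2⟩))
  bracket_smul c s t := Subtype.ext (congrArg (fun u : Sec E F V => (u : ∀ m, V m))
    (A.smul_right c ⟨s.1, s.2⟩ ⟨t.1, t.2⟩))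
  bracket_skew s t := Subtype.ext (congrArg (fun u : Sec E F V => (u : ∀ m, V m))
    (A.skew ⟨s.1, s.2⟩ ⟨t.1, t.2⟩))
  leibniz f s t m := congrArg (fun u : Sec E F V => u m)
    (A.leibniz f ⟨s.1, s.2⟩ ⟨t.1, t.2⟩)

/-- The anchor preserves brackets and the Jacobi identity holds, if this is so for sections that
span the fibres. -/
theorem anchor_bracket_and_jacobi {G : Set (Sec E F V)}
    (hG : ∀ (m : M) (v : V m), ∃ g ∈ G, g m = v)
    (h0 : ∀ u ∈ G, ∀ v ∈ G, A.anchor.app (A.bracket u v) =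
      VF.bracket (A.anchor.app u) (A.anchor.app v))
    (hJ : ∀ u ∈ G, ∀ v ∈ G, ∀ w ∈ G, A.bracket u (A.bracket v w) + A.bracket v (A.bracket w u) +
      A.bracket w (A.bracket u v) = 0) :
    (∀ u v, A.anchor.app (A.bracket u v) = VF.bracket (A.anchor.app u) (A.anchor.app v)) ∧
    ∀ u v w, A.bracket u (A.bracket v w) + A.bracket v (A.bracket w u) +
      A.bracket w (A.bracket u v) = 0 := by
  have h := A.toAlgebroidData_isSkew
  let q (u : Sec E F V) : A.toAlgebroidData.sections :=
    (⟨u, u.contMDiff⟩ : secSubmodule E F V)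
  have hG' (m : M) (v : V m) : ∃ g ∈ q '' G, g.1 m = v := by
    obtain ⟨g, hg, hgm⟩ := hG m v
    exact ⟨q g, ⟨g, hg, rfl⟩, hgm⟩
  have ha := h.anchor_bracket hG' (by
    rintro _ ⟨u, hu, rfl⟩ _ ⟨v, hv, rfl⟩
    exact h0 u hu v hv)
  have hj := h.jacobi hG' ha (by
    rintro _ ⟨u, hu, rfl⟩ _ ⟨v, hv, rfl⟩ _ ⟨w, hw, rfl⟩
    exact Subtype.ext (congrArg (fun u : Sec E F V => (u : ∀ m, V m)) (hJ u hu v hv w hw)))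
  exact ⟨fun u v => ha (q u) (q v), fun u v w => Sec.ext' fun m =>
    congrArg (fun s : A.toAlgebroidData.sections => s.1 m) (hj (q u) (q v) (q w))⟩

end SkewAlgebroid

end JetAlgebroid

/-! ### The cotangent Lie algebroid of a Poisson manifold -/

section CotangentAlgebroid

variable {E : Type*} [NormedAddCommGroup E] [NormedSpace ℝ E] [FiniteDimensional ℝ E]
  {M : Type*} [TopologicalSpace M] [ChartedSpace E M] [IsManifold 𝓘(ℝ, E) ∞ M] [T2Space M]

/-- Differentials of global smooth functions exhaust the covectors at `m`, and covectors separate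
tangent vectors. -/
theorem tangent_eq_of_mvfderiv {m : M} {v w : TangentSpace 𝓘(ℝ, E) m}
    (h : ∀ f : SmoothFun E M, mvfderiv 𝓘(ℝ, E) f m v = mvfderiv 𝓘(ℝ, E) f m w) : v = w := by
  rw [← sub_eq_zero, ← Module.forall_dual_apply_eq_zero_iff ℝ]
  intro y
  obtain ⟨A, rfl⟩ := exists_clm_tangent_eq y
  obtain ⟨f, -, hf⟩ := exists_fun_mvfderiv_eq m A
  change A (v - w) = 0
  rw [map_sub, ← hf, h, sub_self]

theorem VF.ext_deriv {X Y : VF E M} (h : ∀ f m, X.deriv f m = Y.deriv f m) : X = Y :=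
  Sec.ext' fun m => tangent_eq_of_mvfderiv fun f => h f m

theorem VF.deriv_neg (X : VF E M) (f : SmoothFun E M) (m : M) :
    X.deriv (-f) m = - X.deriv f m := by
  have h : -f = (-1 : ℝ) • f := ContMDiffMap.ext fun p => (neg_one_mul (f p)).symm
  rw [h, VF.deriv_smul, neg_one_mul]

theorem OneForm.d_apply (f : SmoothFun E M) (X : VF E M) :
    (OneForm.d f).apply X = X.deriv f := rfl

theorem OneForm.exists_d_eq (m : M) (α : Cotangent E M m) :
    ∃ f : SmoothFun E M, OneForm.d f m = α :=
  (exists_fun_mvfderiv_eq m α).imp fun _ h => h.2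

namespace Bivector

variable (P : Bivector E M)

/-- The bracket `{f, g} = dg(Π df)` of functions. -/
def poisson (f g : SmoothFun E M) : SmoothFun E M := (P.vf (OneForm.d f)).deriv g

theorem poisson_swap (f g : SmoothFun E M) : P.poisson f g = - P.poisson g f :=
  ContMDiffMap.ext fun m => P.skew_apply (OneForm.d g) (OneForm.d f) m

/-- On a field X the second-order terms leave X(Πdf·g) − X(Πdg·f) − X{f,g}, which is X{f,g} by
skew-symmetry. This holds for every bivector, without the Jacobi identity. -/
theorem bracket_d_d (f g : SmoothFun E M) :
    P.bracket (OneForm.d f) (OneForm.d g) = OneForm.d (P.poisson f g) := by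
  refine OneForm.ext fun X m => ?_
  rw [P.bracket_apply, P.bracketFun_apply]
  simp only [OneForm.d_apply]
  have h1 (Y : VF E M) (k : SmoothFun E M) : (Y.bracket X).deriv k m =
      Y.deriv (X.deriv k) m - X.deriv (Y.deriv k) m := VF.bracket_deriv Y X k m
  rw [h1, h1]
  have h2 : X.deriv ((P.vf (OneForm.d g)).deriv f) m =
      - X.deriv ((P.vf (OneForm.d f)).deriv g) m := by
    rw [← VF.deriv_neg]
    exact congrArg (fun k : SmoothFun E M => X.deriv k m) (P.poisson_swap g f)
  rw [h2]
  change _ = X.deriv ((P.vf (OneForm.d f)).deriv g) m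
  ring

end Bivector

namespace PoissonStructure

variable (P : PoissonStructure E M)

theorem poisson_jacobi (f g h : SmoothFun E M) (m : M) :
    P.poisson f (P.poisson g h) m + P.poisson g (P.poisson h f) m +
      P.poisson h (P.poisson f g) m = 0 :=
  congrArg (fun k : SmoothFun E M => k m) (P.jacobi f g h)

/-- Applied to a third function h, this is the Jacobi identity in the form {{f,g},h} = {f,{g,h}} −
{g,{f,h}}. -/
theorem vf_d_poisson (f g : SmoothFun E M) :
    P.vf (OneForm.d (P.poisson f g)) =
      (P.vf (OneForm.d f)).bracket (P.vf (OneForm.d g)) := by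
  refine VF.ext_deriv fun h m => ?_
  have h1 : ((P.vf (OneForm.d f)).bracket (P.vf (OneForm.d g))).deriv h m =
      P.poisson f (P.poisson g h) m - P.poisson g (P.poisson f h) m :=
    VF.bracket_deriv _ _ h m
  have h2 : P.poisson g (P.poisson f h) m = - P.poisson g (P.poisson h f) m := by
    rw [P.poisson_swap f h]
    exact VF.deriv_neg _ _ m
  have h3 : P.poisson (P.poisson f g) h m = - P.poisson h (P.poisson f g) m :=
    congrArg (fun k : SmoothFun E M => k m) (P.poisson_swap (P.poisson f g) h)
  have h4 := P.poisson_jacobi f g h m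
  change P.poisson (P.poisson f g) h m = _
  rw [h1, h2, h3]
  linarith

theorem _root_.OneForm.d_eq_zero {f : SmoothFun E M} (h : f = 0) : OneForm.d f = 0 := by
  refine OneForm.ext fun X m => ?_
  subst h
  have := VF.deriv_smul X 0 (0 : SmoothFun E M) m
  rw [zero_smul, zero_mul] at this
  exact this

/-- Exact forms take every value in T*_mM, so both identities need checking only on differentials of
functions. -/
theorem anchor_bracket_and_jacobi :
    (∀ α β : OneForm E M, P.vf (P.bracket α β) = (P.vf α).bracket (P.vf β)) ∧
    ∀ α β γ : OneForm E M, P.bracket α (P.bracket β γ) + P.bracket β (P.bracket γ α) +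
      P.bracket γ (P.bracket α β) = 0 := by
  refine P.algebroid.anchor_bracket_and_jacobi (G := Set.range OneForm.d) ?_ ?_ ?_
  · intro m α
    obtain ⟨f, hf⟩ := OneForm.exists_d_eq m α
    exact ⟨_, ⟨f, rfl⟩, hf⟩
  · rintro _ ⟨f, rfl⟩ _ ⟨g, rfl⟩
    change P.vf (P.bracket (OneForm.d f) (OneForm.d g)) = _
    rw [P.bracket_d_d]
    exact P.vf_d_poisson f g
  · rintro _ ⟨f, rfl⟩ _ ⟨g, rfl⟩ _ ⟨h, rfl⟩
    change P.bracket (OneForm.d f) (P.bracket (OneForm.d g) (OneForm.d h)) +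
      P.bracket (OneForm.d g) (P.bracket (OneForm.d h) (OneForm.d f)) +
      P.bracket (OneForm.d h) (P.bracket (OneForm.d f) (OneForm.d g)) = 0
    -- The Jacobiator of df, dg, dh becomes a sum of differentials, namely d of the Jacobiator of f,
    -- g, h.
    simp only [P.bracket_d_d]
    refine OneForm.ext fun X m => ?_
    change X.deriv _ m + X.deriv _ m + X.deriv _ m = 0
    rw [← VF.deriv_add, ← VF.deriv_add]
    have h0 : P.poisson f (P.poisson g h) + P.poisson g (P.poisson h f) +
      P.poisson h (P.poisson f g) = 0 := P.jacobi f g h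
    exact congrArg (fun α : OneForm E M => α m (X m)) (OneForm.d_eq_zero h0)

theorem cotangentJet_isLieAlgebroid : P.cotangentJet.IsLieAlgebroid :=
  P.algebroid.jetAlgebroid_isLieAlgebroid P.anchor_bracket_and_jacobi.1
    P.anchor_bracket_and_jacobi.2

end PoissonStructure

end CotangentAlgebroid

/-! ### Lie derivatives as gauge operators, and the five lemma -/

section TangentLift

variable {E : Type*} [NormedAddCommGroup E] [NormedSpace ℝ E] [FiniteDimensional ℝ E]
  {M : Type*} [TopologicalSpace M] [ChartedSpace E M] [IsManifold 𝓘(ℝ, E) ∞ M] [T2Space M]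

/-- A 1-form from an operation on vector fields that is linear over the smooth functions. -/
theorem OneForm.exists_apply_eq (T : VF E M → SmoothFun E M)
    (hadd : ∀ X Y, T (X + Y) = T X + T Y)
    (hf : ∀ (f : SmoothFun E M) (X : VF E M), T (X.fsmul f) = f * T X) :
    ∃ α : OneForm E M, ∀ X, α.apply X = T X := by
  -- Real scalars act as constant functions, so real homogeneity is a case of `hf`.
  have hsmul (c : ℝ) (X : VF E M) : T (c • X) = c • T X :=
    hf (⟨fun _ => c, contMDiff_const⟩ : SmoothFun E M) X
  let L (m : M) : TangentSpace 𝓘(ℝ, E) m →ₗ[ℝ] ℝ :=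
    tensorialLift (E := E) (F := E) (V := (TangentSpace 𝓘(ℝ, E) : M → Type _)) m
      { toFun := fun X => T X m
        map_add' := fun X Y => by rw [hadd]; rfl
        map_smul' := fun c X => by rw [hsmul]; rfl }
      (fun f X => congrArg (fun k : SmoothFun E M => k m) (hf f X))
  have hL (X : VF E M) (m : M) : L m (X m) = T X m :=
    tensorialLift_apply (E := E) (F := E) (V := (TangentSpace 𝓘(ℝ, E) : M → Type _)) m _ _ X
  choose A hA using fun m => exists_clm_tangent_eq (L m)
  have hAX (X : VF E M) (m : M) : A m (X m) = T X m := by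
    rw [← hL, ← hA]
    rfl
  exact ⟨⟨A, contMDiff_hom_of_apply (V := (TangentSpace 𝓘(ℝ, E) : M → Type _))
    (V' := Trivial M ℝ) A fun X => contMDiff_trivial_iff.2 ((T X).contMDiff.congr (hAX X))⟩,
    fun X => ContMDiffMap.ext (hAX X)⟩

theorem OneForm.exists_lieDeriv (X : VF E M) (α : OneForm E M) :
    ∃ β : OneForm E M, ∀ Y, β.apply Y = X.deriv (α.apply Y) - α.apply (X.bracket Y) := by
  refine OneForm.exists_apply_eq _ (fun Y Z => ContMDiffMap.ext fun m => ?_)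
    fun f Y => ContMDiffMap.ext fun m => ?_
  · change X.deriv _ m - _ = (X.deriv (α.apply Y) m - α.apply (X.bracket Y) m) +
      (X.deriv (α.apply Z) m - α.apply (X.bracket Z) m)
    rw [VF.bracket_add_right, OneForm.apply_add, OneForm.apply_add, VF.deriv_add]
    exact add_sub_add_comm _ _ _ _
  · change X.deriv _ m - _ = f m * (X.deriv (α.apply Y) m - α.apply (X.bracket Y) m)
    rw [VF.bracket_fsmul_right, OneForm.apply_add, OneForm.apply_fsmul, OneForm.apply_fsmul,
      OneForm.apply_fsmul, VF.deriv_mul]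
    change _ - (f m * α.apply (X.bracket Y) m + X.deriv f m * α.apply Y m) = _
    ring

/-- The Lie derivative of a 1-form. -/
def OneForm.lieDeriv (X : VF E M) (α : OneForm E M) : OneForm E M :=
  (OneForm.exists_lieDeriv X α).choose

theorem OneForm.lieDeriv_apply (X : VF E M) (α : OneForm E M) (Y : VF E M) (m : M) :
    OneForm.lieDeriv X α m (Y m) = X.deriv (α.apply Y) m - α.apply (X.bracket Y) m :=
  congrArg (fun k : SmoothFun E M => k m) ((OneForm.exists_lieDeriv X α).choose_spec Y)

/-- The Lie derivative along `X`, as a section of `𝔇(T*M)`. -/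
def VF.lieGauge (X : VF E M) : GaugeSec E (E →L[ℝ] ℝ) (Cotangent E M) :=
  GaugeSec.mk
    { toFun := OneForm.lieDeriv X
      map_add' := fun α β => OneForm.ext fun Y m => by
        change _ = OneForm.lieDeriv X α m (Y m) + OneForm.lieDeriv X β m (Y m)
        rw [OneForm.lieDeriv_apply, OneForm.lieDeriv_apply, OneForm.lieDeriv_apply]
        have h (Z : VF E M) : OneForm.apply (α + β) Z = OneForm.apply α Z + OneForm.apply β Z := rfl
        rw [h, h, VF.deriv_add]
        exact add_sub_add_comm _ _ _ _
      map_smul' := fun c α => OneForm.ext fun Y m => by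
        change _ = c * OneForm.lieDeriv X α m (Y m)
        rw [OneForm.lieDeriv_apply, OneForm.lieDeriv_apply]
        have h (Z : VF E M) : OneForm.apply (c • α) Z = c • OneForm.apply α Z := rfl
        rw [h, h, VF.deriv_smul]
        exact (mul_sub c _ _).symm }
    X (fun f α => OneForm.ext fun Y m => by
      change OneForm.lieDeriv X (α.fsmul f) m (Y m) =
        f m * OneForm.lieDeriv X α m (Y m) + X.deriv f m * OneForm.apply α Y m
      rw [OneForm.lieDeriv_apply, OneForm.lieDeriv_apply, OneForm.fsmul_apply,
        OneForm.fsmul_apply, VF.deriv_mul]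
      change _ - f m * OneForm.apply α (X.bracket Y) m = _
      ring)

/-- The operator `[Y, ·]` on vector fields, as a section of `𝔇(TM)`. -/
def VF.adGauge (Y : VF E M) : GaugeSec E E (TangentSpace 𝓘(ℝ, E) : M → Type _) :=
  GaugeSec.mk ⟨⟨Y.bracket, VF.bracket_add_right Y⟩, fun c => VF.bracket_smul_right c Y⟩ Y
    (fun f X => VF.bracket_fsmul_right f Y X)

theorem VF.adGauge_add (Y Z : VF E M) : (Y + Z).adGauge = Y.adGauge + Z.adGauge :=
  GaugeSec.ext (fun X => VF.bracket_add_left Y Z X) rfl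

theorem VF.adGauge_smul (c : ℝ) (Y : VF E M) : (c • Y).adGauge = c • Y.adGauge :=
  GaugeSec.ext (fun X => VF.bracket_smul_left c Y X) rfl

/-- The Jacobi identity for vector fields, read as the statement that ad is a homomorphism. -/
theorem VF.adGauge_bracket (Y Z : VF E M) :
    (Y.bracket Z).adGauge = GaugeSec.bracket Y.adGauge Z.adGauge := by
  refine GaugeSec.ext (fun (X : VF E M) => ?_) rfl
  change (Y.bracket Z).bracket X = Y.bracket (Z.bracket X) - Z.bracket (Y.bracket X)
  have h := VF.bracket_jacobi Y Z X
  have h1 : Z.bracket (X.bracket Y) = - Z.bracket (Y.bracket X) := by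
    rw [VF.bracket_swap X Y]
    simpa using VF.bracket_smul_right (-1) Z (Y.bracket X)
  rw [h1, VF.bracket_swap X (Y.bracket Z)] at h
  rw [eq_comm, ← sub_eq_zero, ← h]
  abel

/-- The five lemma for a morphism of short exact sequences. -/
theorem bijective_of_short_exact {K G Q K' G' Q' : Type*} [AddCommGroup G] [Module ℝ G]
    [AddCommGroup Q] [Module ℝ Q] [AddCommGroup K'] [Module ℝ K'] [AddCommGroup G'] [Module ℝ G']
    [AddCommGroup Q'] [Module ℝ Q'] (i : K → G) (p : G →ₗ[ℝ] Q) (i' : K' →ₗ[ℝ] G')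
    (p' : G' →ₗ[ℝ] Q') (k : K → K') (φ : G →ₗ[ℝ] G') (q : Q →ₗ[ℝ] Q')
    (hip : ∀ g, p g = 0 → ∃ x, i x = g) (hp : Function.Surjective p)
    (hi' : Function.Injective i') (hip' : ∀ g, p' g = 0 → ∃ x, i' x = g)
    (hk : ∀ x, k x = 0 → i x = 0) (hk' : Function.Surjective k) (hq : Function.Bijective q)
    (hl : ∀ x, φ (i x) = i' (k x)) (hr : ∀ g, p' (φ g) = q (p g)) : Function.Bijective φ := by
  constructor
  · refine (injective_iff_map_eq_zero φ).2 fun g hg => ?_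
    have h1 : p g = 0 := hq.1 (by rw [← hr, hg, map_zero, map_zero])
    obtain ⟨x, rfl⟩ := hip g h1
    -- The maps `i` and `k` carry no linear structure, so `hk` plays the part of injectivity of the
    -- left column.
    exact hk x (hi' (by rw [← hl, hg, map_zero]))
  · intro d
    obtain ⟨a, ha⟩ := hq.2 (p' d)
    obtain ⟨g, rfl⟩ := hp a
    obtain ⟨x', hx'⟩ := hip' (d - φ g) (by rw [map_sub, hr, ha, sub_self])
    obtain ⟨x, rfl⟩ := hk' x'
    exact ⟨i x + g, by rw [map_add, hl, hx', sub_add_cancel]⟩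

/-- When `q` is bijective, so is the left column y ↦ −q ∘ y, and the five lemma applies to the two
exact rows. -/
theorem Jet.bijective_of_lift {F : Type*} [NormedAddCommGroup F] [NormedSpace ℝ F]
    [FiniteDimensional ℝ F] {V : M → Type*} [TopologicalSpace (TotalSpace F V)]
    [∀ m, AddCommGroup (V m)] [∀ m, Module ℝ (V m)] [∀ m, TopologicalSpace (V m)]
    [FiberBundle F V] [VectorBundle ℝ F V] [ContMDiffVectorBundle ∞ F V 𝓘(ℝ, E)] {m : M}
    (φ : Jet E F V m →ₗ[ℝ] TangentGauge E M m) (q : V m →ₗ[ℝ] TangentSpace 𝓘(ℝ, E) m)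
    (h : Function.Bijective q) (hl : ∀ y, φ (Jet.incl y) = Gauge.ofEnd (-(q ∘ₗ y)))
    (hr : ∀ ν, Gauge.anchor (φ ν) = q (Jet.proj ν)) : Function.Bijective φ := by
  refine bijective_of_short_exact Jet.incl Jet.proj Gauge.ofEnd Gauge.anchor
    (fun y => -(q ∘ₗ y)) φ q
    (fun ν => (Jet.proj_eq_zero_iff ν).1) (Jet.proj_surjective m) (Gauge.ofEnd_injective m)
    (fun d => (Gauge.anchor_eq_zero_iff d).1) ?_ ?_ h hl hr
  · intro y hy
    have h3 : y = 0 := LinearMap.ext fun v => h.1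
      ((congrArg (fun L => L v) (neg_eq_zero.1 hy)).trans (map_zero q).symm)
    subst h3
    rfl
  · intro Φ
    let e := LinearEquiv.ofBijective q h
    refine ⟨-(e.symm.toLinearMap ∘ₗ Φ), LinearMap.ext fun v => ?_⟩
    change -(e (-(e.symm (Φ v)))) = Φ v
    rw [map_neg, neg_neg, e.apply_symm_apply]

/-! ### The lift of Π to 1-jets -/

namespace Bivector

variable (P : Bivector E M)

theorem vf_add (α β : OneForm E M) : P.vf (α + β) = P.vf α + P.vf β :=
  Sec.ext' fun m => (P.sharp m).map_add (α m) (β m)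

theorem vf_smul (c : ℝ) (α : OneForm E M) : P.vf (c • α) = c • P.vf α :=
  Sec.ext' fun m => (P.sharp m).map_smul c (α m)

theorem vf_fsmul (f : SmoothFun E M) (α : OneForm E M) : P.vf (α.fsmul f) = (P.vf α).fsmul f :=
  Sec.ext' fun m => (P.sharp m).map_smul (f m) (α m)

/-- The operation `α ↦ [Πα, X] + Π(L_X α)`, which is linear over the smooth functions. -/
def lieDerivSharp (X : VF E M) : OneForm E M →ₗ[ℝ] VF E M where
  toFun α := (P.vf α).bracket X + P.vf (OneForm.lieDeriv X α)
  map_add' α β := by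
    have h : OneForm.lieDeriv X (α + β) = OneForm.lieDeriv X α + OneForm.lieDeriv X β :=
      (GaugeSec.op X.lieGauge).map_add α β
    rw [h, vf_add, vf_add, VF.bracket_add_left]
    abel
  map_smul' c α := by
    have h : OneForm.lieDeriv X (c • α) = c • OneForm.lieDeriv X α :=
      (GaugeSec.op X.lieGauge).map_smul c α
    rw [h, vf_smul, vf_smul, VF.bracket_smul_left, RingHom.id_apply, smul_add]

/-- The bracket [fΠα, X] contributes −X(f)Πα and Π(L_X(fα)) contributes X(f)Πα, so the derivative
terms cancel. -/
theorem lieDerivSharp_fsmul (X : VF E M) (f : SmoothFun E M) (α : OneForm E M) (m : M) :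
    P.lieDerivSharp X (α.fsmul f) m = f m • P.lieDerivSharp X α m := by
  have h : OneForm.lieDeriv X (α.fsmul f) =
      (OneForm.lieDeriv X α).fsmul f + α.fsmul (X.deriv f) := GaugeSec.op_fsmul X.lieGauge f α
  change ((P.vf (α.fsmul f)).bracket X + P.vf (OneForm.lieDeriv X (α.fsmul f))) m = _
  rw [h, vf_add, vf_fsmul, vf_fsmul, vf_fsmul, VF.bracket_fsmul_left]
  change f m • (P.vf α).bracket X m - X.deriv f m • P.vf α m +
    (f m • P.vf (OneForm.lieDeriv X α) m + X.deriv f m • P.vf α m) =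
    f m • ((P.vf α).bracket X m + P.vf (OneForm.lieDeriv X α) m)
  module

theorem lieDerivSharp_congr (X : VF E M) {α β : OneForm E M} {m : M} (h : α m = β m) :
    P.lieDerivSharp X α m = P.lieDerivSharp X β m := by
  have h1 := tensorial_pointwise (u := α - β)
    (Sec.eval E E (TangentSpace 𝓘(ℝ, E) : M → Type _) m ∘ₗ P.lieDerivSharp X)
    (fun f α => P.lieDerivSharp_fsmul X f α m) (sub_eq_zero.2 h)
  rw [map_sub, sub_eq_zero] at h1
  exact h1

/-- This splits [Πα,X](m) into a part that sees only α(m) and a part −Π(L_X α)(m), where (L_X α)(m)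
is the jet ν evaluated on the operator L_X. Since `β` only has to agree with α at `m`, it may be
chosen independently of the jet. -/
theorem bracket_vf_eq (X : VF E M) {m : M} {α β : OneForm E M} {ν : CotangentJet E M m}
    (hν : (JetSec.jet α).1 m = ν) (h : α m = β m) :
    (P.vf α).bracket X m = P.lieDerivSharp X β m - P.sharp m (ν.1 (X.lieGauge.1 m)) := by
  rw [← P.lieDerivSharp_congr X h, ← hν]
  exact (add_sub_cancel_right _ _).symm

/-- This is what makes the lift well defined: the operator [Πα,·] at `m` depends on α only through
its 1-jet. -/
theorem adGauge_vf_congr {α β : OneForm E M} {m : M}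
    (h : (JetSec.jet α).1 m = (JetSec.jet β).1 m) :
    (P.vf α).adGauge.1 m = (P.vf β).adGauge.1 m := by
  have h1 : α m = β m := congrArg Jet.proj h
  refine Subtype.ext (Prod.ext (LinearMap.ext fun X => ?_) (congrArg (P.sharp m) h1))
  exact (P.bracket_vf_eq X h h1).trans (P.bracket_vf_eq X rfl rfl).symm

/-- The map `𝔍(T*M) → 𝔇(TM)` at `m` that sends the 1-jet of `α` to `[Πα, ·]`. -/
def jetLift (m : M) : CotangentJet E M m →ₗ[ℝ] TangentGauge E M m where
  toFun ν := (P.vf (Jet.rep ν)).adGauge.1 m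
  map_add' ν μ := by
    refine (P.adGauge_vf_congr (Jet.jet_rep_add ν μ)).trans ?_
    rw [vf_add, VF.adGauge_add]
    rfl
  map_smul' c ν := by
    refine (P.adGauge_vf_congr (Jet.jet_rep_smul c ν)).trans ?_
    rw [vf_smul, VF.adGauge_smul]
    rfl

theorem jetLift_jet (α : OneForm E M) (m : M) :
    P.jetLift m ((JetSec.jet α).1 m) = (P.vf α).adGauge.1 m :=
  P.adGauge_vf_congr (Jet.jet_rep ((JetSec.jet α).1 m))

-- The chosen representative plays no further role; `jetLift_jet` determines the map, because every
-- fibre element is a jet.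
attribute [irreducible] jetLift

theorem anchor_jetLift {m : M} (ν : CotangentJet E M m) :
    Gauge.anchor (P.jetLift m ν) = P.sharp m (Jet.proj ν) := by
  obtain ⟨α, h⟩ := Jet.exists_jet_eq ν
  rw [← h]
  exact (congrArg Gauge.anchor (P.jetLift_jet α m)).trans rfl

/-- A formula without a choice of representative for the jet. It is used with `β` = 0 on the kernel
of the projection, and with `β` the projection of a section of 𝔍(T*M) to obtain smoothness. -/
theorem jetLift_apply {m : M} (ν : CotangentJet E M m) {β : OneForm E M} (h : Jet.proj ν = β m)
    (X : VF E M) : (P.jetLift m ν).1.1 X =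
      P.lieDerivSharp X β m - P.sharp m (ν.1 (X.lieGauge.1 m)) := by
  obtain ⟨α, hα⟩ := Jet.exists_jet_eq ν
  have h1 : (P.jetLift m ν).1.1 X = (P.vf α).bracket X m :=
    congrArg (fun d : TangentGauge E M m => d.1.1 X)
      ((congrArg (P.jetLift m) hα.symm).trans (P.jetLift_jet α m))
  rw [h1]
  exact P.bracket_vf_eq X hα ((congrArg Jet.proj hα).trans h)

theorem jetLift_incl {m : M} (y : HomTangentCotangent E M m) :
    P.jetLift m (Jet.incl y) = Gauge.ofEnd (-((P.sharp m).toLinearMap ∘ₗ y)) := by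
  have h0 : Jet.proj (Jet.incl y : CotangentJet E M m) = 0 :=
    (Jet.proj_eq_zero_iff _).2 ⟨y, rfl⟩
  refine Subtype.ext (Prod.ext (LinearMap.ext fun X => ?_) ?_)
  -- The remaining term is −Π(𝕖(y)(L_X)) = −Π(y(X)), because the anchor of L_X is X.
  · rw [P.jetLift_apply (β := 0) _ h0, map_zero]
    exact zero_sub _
  · refine (P.anchor_jetLift (Jet.incl y)).trans ?_
    rw [h0, map_zero]
    rfl

/-- Applied to X, the family is the difference of two smooth vector fields, one tensorial in the
projection of ν and the other Π applied to the 1-form ⟨ν, L_X⟩. -/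
theorem jetLift_mem (ν : JetSec E (E →L[ℝ] ℝ) (Cotangent E M)) :
    (fun m => P.jetLift m (ν.1 m)) ∈ GaugeSec E E (TangentSpace 𝓘(ℝ, E) : M → Type _) := by
  constructor
  · intro (X : VF E M)
    have h := (P.lieDerivSharp X (JetSec.proj ν) - P.vf (JetSec.pair ν X.lieGauge)).contMDiff
    refine h.congr fun m => ?_
    exact congrArg (TotalSpace.mk' E m) (P.jetLift_apply (ν.1 m) (β := JetSec.proj ν) rfl X)
  · refine (P.vf (JetSec.proj ν)).contMDiff.congr fun m => ?_
    exact congrArg (TotalSpace.mk' E m) (P.anchor_jetLift (ν.1 m))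

/-- The map induced by `jetLift` on sections. -/
def jetLiftSec (ν : JetSec E (E →L[ℝ] ℝ) (Cotangent E M)) :
    GaugeSec E E (TangentSpace 𝓘(ℝ, E) : M → Type _) := ⟨_, P.jetLift_mem ν⟩

theorem jetLiftSec_jet (α : OneForm E M) : P.jetLiftSec (JetSec.jet α) = (P.vf α).adGauge :=
  Subtype.ext (funext fun m => P.jetLift_jet α m)

theorem jetLift_bijective {m : M} (h : Function.Bijective (P.sharp m)) :
    Function.Bijective (P.jetLift m) :=
  Jet.bijective_of_lift (P.jetLift m) (P.sharp m).toLinearMap h P.jetLift_incl P.anchor_jetLift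

end Bivector

namespace PoissonStructure

variable (P : PoissonStructure E M)

/-- On jets the source bracket is 𝕕[α,β], which maps to ad of Π[α,β] = [Πα,Πβ], and ad is a
homomorphism. -/
theorem jetLift_jetBracket_jet (α β : OneForm E M) (m : M) :
    P.jetLift m ((P.algebroid.jetBracket (JetSec.jet α) (JetSec.jet β)).1 m) =
      (GaugeSec.bracket (P.jetLiftSec (JetSec.jet α)) (P.jetLiftSec (JetSec.jet β))).1 m := by
  have h1 : (P.vf (P.bracket α β)).adGauge =
      GaugeSec.bracket (P.jetLiftSec (JetSec.jet α)) (P.jetLiftSec (JetSec.jet β)) :=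
    ((congrArg VF.adGauge (P.anchor_bracket_and_jacobi.1 α β)).trans
      (VF.adGauge_bracket _ _)).trans
      (congrArg₂ GaugeSec.bracket (P.jetLiftSec_jet α) (P.jetLiftSec_jet β)).symm
  exact ((congrArg (fun ν : JetSec E (E →L[ℝ] ℝ) (Cotangent E M) => P.jetLift m (ν.1 m))
    (P.algebroid.jetBracket_jet α β)).trans (P.jetLift_jet (P.bracket α β) m)).trans
    (congrArg (fun δ : GaugeSec E E (TangentSpace 𝓘(ℝ, E) : M → Type _) => δ.1 m) h1)

theorem jetLift_isMorphism : P.cotangentJet.IsMorphism (tangentGauge E M) P.jetLift := by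
  refine P.cotangentJet_isLieAlgebroid.isSkew.isMorphism gaugeAlgebroid_isLieAlgebroid.isSkew
    (G := Set.range JetSec.jet) ?_ _ (fun s hs => P.jetLift_mem ⟨s, hs⟩)
    (fun m ν => P.anchor_jetLift ν) ?_
  · intro m ν
    obtain ⟨u, hu⟩ := Jet.exists_jet_eq ν
    exact ⟨_, ⟨u, rfl⟩, hu⟩
  · rintro _ ⟨α, rfl⟩ _ ⟨β, rfl⟩ m
    exact P.jetLift_jetBracket_jet α β m

theorem jetLift_isLift : P.IsLift P.jetLift where
  isMorphism := P.jetLift_isMorphism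
  left_square _ y := P.jetLift_incl y
  right_square _ ν := P.anchor_jetLift ν
  map_jet α X m := congrArg (fun d : TangentGauge E M m => d.1.1 X) (P.jetLift_jet α m)

theorem jetLift_isIsomorphism (h : ∀ m, Function.Bijective (P.sharp m)) :
    P.cotangentJet.IsIsomorphism (tangentGauge E M) P.jetLift :=
  P.cotangentJet_isLieAlgebroid.isSkew.isIsomorphism gaugeAlgebroid_isLieAlgebroid.isSkew
    P.jetLift_isMorphism fun m => P.jetLift_bijective (h m)

end PoissonStructure

/-! ### The Poisson structure of a symplectic form -/

namespace SymplecticForm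

variable (S : SymplecticForm E M)

theorem flat_swap (m : M) (x y : TangentSpace 𝓘(ℝ, E) m) : S.flat m x y = - S.flat m y x := by
  have h : S.flat m x (x + y) + S.flat m y (x + y) = 0 :=
    (congrArg (fun L : Cotangent E M m => L (x + y)) ((S.flat m).map_add x y)).symm.trans
      (S.alternating m (x + y))
  rw [map_add, map_add, S.alternating, S.alternating, zero_add, add_zero] at h
  exact eq_neg_of_add_eq_zero_left h

theorem flat_bijective (m : M) : Function.Bijective (S.flat m) := by
  have hE : FiniteDimensional ℝ (TangentSpace 𝓘(ℝ, E) m) := inferInstanceAs (FiniteDimensional ℝ E)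
  have hinj : Function.Injective (S.flat m).toLinearMap := by
    rw [← LinearMap.ker_eq_bot, LinearMap.ker_eq_bot']
    intro x hx
    exact S.nondegenerate m x fun y => congrArg (fun L : Cotangent E M m => L y) hx
  have hdim : Module.finrank ℝ (TangentSpace 𝓘(ℝ, E) m) = Module.finrank ℝ (Cotangent E M m) := by
    have h1 : Module.finrank ℝ (E →L[ℝ] ℝ) = Module.finrank ℝ E :=
      (LinearMap.toContinuousLinearMap (𝕜 := ℝ) (E := E) (F' := ℝ)).finrank_eq.symm.trans
        Subspace.dual_finrank_eq
    exact h1.symm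
  have : FiniteDimensional ℝ (Cotangent E M m) := inferInstanceAs (FiniteDimensional ℝ (E →L[ℝ] ℝ))
  exact ⟨hinj, (LinearMap.injective_iff_surjective_of_finrank_eq_finrank hdim).1 hinj⟩

/-- The isomorphism `X ↦ ω(X, ·)`. -/
def flatEquiv (m : M) : TangentSpace 𝓘(ℝ, E) m ≃ₗ[ℝ] Cotangent E M m :=
  LinearEquiv.ofBijective (S.flat m).toLinearMap (S.flat_bijective m)

/-- The inverse of x ↦ ω(x,·) sends smooth 1-forms to smooth vector fields by Cramer's rule in local
frames; its skew-symmetry is that of ω. -/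
theorem exists_bivector : ∃ P : Bivector E M,
    ∀ (m : M) (x : TangentSpace 𝓘(ℝ, E) m), P.sharp m (S.flat m x) = x := by
  have hclm (m : M) : ∃ A : Cotangent E M m →L[ℝ] TangentSpace 𝓘(ℝ, E) m,
      A.toLinearMap = (S.flatEquiv m).symm.toLinearMap := by
    have : T2Space (Cotangent E M m) := FiberBundle.t2Space (E →L[ℝ] ℝ) (Cotangent E M) m
    have : FiniteDimensional ℝ (Cotangent E M m) :=
      VectorBundle.finiteDimensional ℝ (E →L[ℝ] ℝ) (Cotangent E M) m
    exact ⟨LinearMap.toContinuousLinearMap (S.flatEquiv m).symm.toLinearMap, rfl⟩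
  choose A hA using hclm
  have hA' (m : M) (α : Cotangent E M m) : A m α = (S.flatEquiv m).symm α :=
    congrArg (fun L : Cotangent E M m →ₗ[ℝ] TangentSpace 𝓘(ℝ, E) m => L α) (hA m)
  have hflat (m : M) (x : TangentSpace 𝓘(ℝ, E) m) : A m (S.flat m x) = x :=
    (hA' m _).trans ((S.flatEquiv m).symm_apply_apply x)
  refine ⟨⟨⟨A, contMDiff_hom_of_apply (V := Cotangent E M)
    (V' := (TangentSpace 𝓘(ℝ, E) : M → Type _)) A fun α => ?_⟩, fun m α β => ?_⟩, hflat⟩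
  · have h := inverse_mem_secSubmodule
      (secSubmodule_hasFrame (E := E) (F := E) (V := (TangentSpace 𝓘(ℝ, E) : M → Type _)))
      (secSubmodule_hasFrame (E := E) (F := E →L[ℝ] ℝ) (V := Cotangent E M))
      secSubmodule_fsmul (fun _ => secSubmodule_mem_of_local) S.flatEquiv
      (fun X hX => (S.flat.app ⟨X, hX⟩).contMDiff) α.contMDiff
    refine ContMDiff.congr h fun m => ?_
    exact congrArg (TotalSpace.mk' E m) (hA' m (α m))
  · obtain ⟨x, rfl⟩ := (S.flat_bijective m).2 α
    obtain ⟨y, rfl⟩ := (S.flat_bijective m).2 β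
    change S.flat m x (A m (S.flat m y)) = - S.flat m y (A m (S.flat m x))
    rw [hflat, hflat, S.flat_swap]

/-- With H_f = Π df one has ω(H_f, X) = X f. Expanding dω(H_f, H_g, H_h) = 0 then yields the Jacobi
identity. -/
theorem exists_poissonStructure : ∃ P : PoissonStructure E M,
    ∀ (m : M) (x : TangentSpace 𝓘(ℝ, E) m), P.sharp m (S.flat m x) = x := by
  obtain ⟨P, hP⟩ := S.exists_bivector
  have hP' (m : M) (α : Cotangent E M m) : S.flat m (P.sharp m α) = α := by
    obtain ⟨x, rfl⟩ := (S.flat_bijective m).2 α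
    rw [hP]
  let H (f : SmoothFun E M) : VF E M := P.vf (OneForm.d f)
  have hw (f : SmoothFun E M) (X : VF E M) : OneForm.apply (S.flat.app (H f)) X = X.deriv f :=
    ContMDiffMap.ext fun m => congrArg (fun α : Cotangent E M m => α (X m)) (hP' m (OneForm.d f m))
  have hb (f g : SmoothFun E M) : (H f).deriv g = P.poisson f g := rfl
  have hbr (f g h : SmoothFun E M) (m : M) :
      OneForm.apply (S.flat.app ((H f).bracket (H g))) (H h) m =
        -(P.poisson f (P.poisson g h) m - P.poisson g (P.poisson f h) m) := by
    have h1 : OneForm.apply (S.flat.app ((H f).bracket (H g))) (H h) m =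
        - OneForm.apply (S.flat.app (H h)) ((H f).bracket (H g)) m := S.flat_swap m _ _
    rw [h1, hw]
    exact congrArg Neg.neg (VF.bracket_deriv (H f) (H g) h m)
  refine ⟨{ toBivector := P, jacobi := fun f g h => ContMDiffMap.ext fun m => ?_ }, hP⟩
  change P.poisson f (P.poisson g h) m + P.poisson g (P.poisson h f) m +
    P.poisson h (P.poisson f g) m = 0
  have hc : (H f).deriv (OneForm.apply (S.flat.app (H g)) (H h)) m -
      (H g).deriv (OneForm.apply (S.flat.app (H f)) (H h)) m +
      (H h).deriv (OneForm.apply (S.flat.app (H f)) (H g)) m -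
      OneForm.apply (S.flat.app ((H f).bracket (H g))) (H h) m +
      OneForm.apply (S.flat.app ((H f).bracket (H h))) (H g) m -
      OneForm.apply (S.flat.app ((H g).bracket (H h))) (H f) m = 0 :=
    congrArg (fun k : SmoothFun E M => k m) (S.closed (H f) (H g) (H h))
  -- The three derivative terms sum to minus the Jacobiator of f, g, h. Each of the three bracket
  -- terms gives two of its summands, twice the Jacobiator in all, so closedness says that it
  -- vanishes.
  simp only [hbr, hw, hb] at hc
  have hs (a b c : SmoothFun E M) : P.poisson a (P.poisson b c) m =
      - P.poisson a (P.poisson c b) m := by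
    rw [P.poisson_swap b c]
    exact VF.deriv_neg _ _ m
  have h1 := hs f h g
  have h2 := hs g h f
  have h3 := hs h g f
  linarith

end SymplecticForm

end TangentLift

end

theorem mainTheorem8 {E : Type*} [NormedAddCommGroup E] [NormedSpace ℝ E] [FiniteDimensional ℝ E]
    {M : Type*} [TopologicalSpace M] [T2Space M] [ChartedSpace E M] [IsManifold 𝓘(ℝ, E) ∞ M] :
    (∀ P : PoissonStructure E M,
      -- both bundles are Lie algebroids
      P.cotangentJet.IsLieAlgebroid ∧ (tangentGauge E M).IsLieAlgebroid ∧
      -- the rows of the diagram are exact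
      (∀ m : M,
        Function.Injective (Jet.incl : HomTangentCotangent E M m → CotangentJet E M m) ∧
        (∀ ν : CotangentJet E M m, Jet.proj ν = 0 ↔ ∃ y, Jet.incl y = ν) ∧
        Function.Surjective (Jet.proj : CotangentJet E M m →ₗ[ℝ] Cotangent E M m)) ∧
      (∀ m : M,
        Function.Injective (Gauge.ofEnd :
          (TangentSpace 𝓘(ℝ, E) m →ₗ[ℝ] TangentSpace 𝓘(ℝ, E) m) →ₗ[ℝ] TangentGauge E M m) ∧
        (∀ d : TangentGauge E M m, Gauge.anchor d = 0 ↔ ∃ Φ, Gauge.ofEnd Φ = d) ∧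
        Function.Surjective
          (Gauge.anchor : TangentGauge E M m →ₗ[ℝ] TangentSpace 𝓘(ℝ, E) m)) ∧
      -- the morphism, which is an isomorphism when `Π` is nondegenerate
      ∃ φ : ∀ m, CotangentJet E M m →ₗ[ℝ] TangentGauge E M m, P.IsLift φ ∧
        ((∀ m, Function.Bijective (P.sharp m)) →
          P.cotangentJet.IsIsomorphism (tangentGauge E M) φ)) ∧
    -- the case of a symplectic manifold, with the Poisson structure inverse to the symplectic form
    (∀ S : SymplecticForm E M, ∃ P : PoissonStructure E M,
      (∀ (m : M) (x : TangentSpace 𝓘(ℝ, E) m), P.sharp m (S.flat m x) = x) ∧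
      ∃ φ : ∀ m, CotangentJet E M m →ₗ[ℝ] TangentGauge E M m, P.IsLift φ ∧
        P.cotangentJet.IsIsomorphism (tangentGauge E M) φ) := by
  refine ⟨fun P => ⟨P.cotangentJet_isLieAlgebroid, gaugeAlgebroid_isLieAlgebroid,
    fun m => ⟨Jet.incl_injective m, Jet.proj_eq_zero_iff, Jet.proj_surjective m⟩,
    fun m => ⟨Gauge.ofEnd_injective m, Gauge.anchor_eq_zero_iff, Gauge.anchor_surjective m⟩,
    P.jetLift, P.jetLift_isLift, P.jetLift_isIsomorphism⟩, fun S => ?_⟩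
  obtain ⟨P, hP⟩ := S.exists_poissonStructure
  refine ⟨P, hP, P.jetLift, P.jetLift_isLift, P.jetLift_isIsomorphism fun m => ?_⟩
  -- Since Π inverts x ↦ ω(x,·) on one side and the latter is bijective, Π is bijective.
  have h : Function.RightInverse (S.flat m) (P.sharp m) := hP m
  refine ⟨fun α β hαβ => ?_, h.surjective⟩
  obtain ⟨x, rfl⟩ := (S.flat_bijective m).2 α
  obtain ⟨y, rfl⟩ := (S.flat_bijective m).2 β
  rw [hP, hP] at hαβ
  rw [hαβ]
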